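/- **Setting.** Let $\gamma,\tau>0$. Let $\mathbb H=\mathbb R^2\times C[-1,1]$ and $\mathbb D=\{(u,v,W)\in\mathbb R^2\times C^1[-1,1]: W(0)=u\}$ with the maximum norms, where $\|W\|_{C^1}=\max(\sup|W|,\sup|W'|)$, and let $L_{\gamma,\tau}:\mathbb D\to\mathbb H$, $$L_{\gamma,\tau}(u,v,W)=\bigl(v,\;-\tau^2(1+2\gamma)u+\gamma\tau^2(W(1)+W(-1)),\;W'\bigr).$$ Assume that the part of the spectrum of $L_{\gamma,\tau}$ (on the complexified spaces) that lies in $i\mathbb R$ consists of exactly one pair $\pm ik_0$, $k_0>0$, of algebraically simple eigenvalues. Let $P_1$ be the spectral projection of $L_{\gamma,\tau}$ onto the two-dimensional eigenspace of $\pm ik_0$, i.e. the bounded projection on $\mathbb H$ with this range that commutes with $L_{\gamma,\tau}$, and let $Q_h=I-P_1$. Let $$D(k)=-\frac{k^2}{\gamma\tau^2}+2(1-\cos k)+\frac1\gamma\quad(k\in\mathbb C),\qquad p_0=\inf\{|\operatorname{Im}k|: D(k)=0,\ \operatorname{Im}k\ne0\}.$$ For $\nu\in\mathbb R$ and a normed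 space $X$ let $E^\nu_0(X)$ be the space of continuous $f:\mathbb R\to X$ with $\|f\|_{E^\nu_0(X)}=\sup_t e^{-\nu|t|}\|f(t)\|<\infty$; $Q_h\mathbb D$ carries the norm of $\mathbb D$ and $Q_h\mathbb H$ that of $\mathbb H$. Let $A_\nu$ be the space of all $G_2\in E^\nu_0(C^1[-1,1])$ such that, for all $t\in\mathbb R$, $$k_0G_2(t,0)=\gamma\tau^2\int_0^1\sin(k_0(1-s))\,[G_2(t,s)+G_2(t,-s)]\,ds .$$ **Theorem.** The projection $P_1$ exists and is unique, and $p_0>0$. There is a continuous function $\widetilde\gamma:(-p_0,p_0)\to[0,\infty)$ such that, for every $\nu\in(-p_0,p_0)$: 1. The formulas $$k_0G_0(t)=\gamma\tau^2\int_0^1\sin(k_0(1-s))[G_2(t,s)+G_2(t,-s)]\,ds,\qquad G_1(t)=\gamma\tau^2\int_0^1\cos(k_0(1-s))[G_2(t,s)-G_2(t,-s)]\,ds$$ define a bounded linear bijection with bounded inverse $J:G_2\mapsto G=(G_0,G_1,G_2)$ from $A_\nu$ onto $E^\nu_0(Q_h\mathbb D)$. 2. There is a bounded linear map $\widetilde K:A_\nu\to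 E^\nu_0(Q_h\mathbb D)$ such that, for every $G_2\in A_\nu$ and $G=JG_2$, the function $U=\widetilde KG_2$ belongs to $E^\nu_0(Q_h\mathbb D)\cap C^1(\mathbb R,Q_h\mathbb H)$ and satisfies $\partial_tU=L_{\gamma,\tau}U+G$ on $\mathbb R$. 3. This $U$ is the only solution of $\partial_tU=L_{\gamma,\tau}U+G$ in $E^\nu_0(Q_h\mathbb D)\cap C^1(\mathbb R,Q_h\mathbb H)$. 4. $\|\widetilde K\|\le\widetilde\gamma(\nu)$; moreover the solution map $K=\widetilde KJ^{-1}:G\mapsto U$ on $E^\nu_0(Q_h\mathbb D)$ satisfies $\|K\|\le\widetilde\gamma(\nu)$. -/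

import Mathlib

noncomputable section

namespace FKChain

/-- The interval `[-1,1]`. -/
abbrev I : Type := Set.Icc (-1 : ℝ) 1

/-- A function on `[-1,1]` as a function of a real variable (constant outside `[-1,1]`). -/
def ext {Z : Type*} (f : I → Z) : ℝ → Z :=
  Set.IccExtend (by norm_num : (-1 : ℝ) ≤ 1) f

section Spaces

variable (𝕜 : Type*) [RCLike 𝕜]

/-- The pairs `(W, W')` with `W ∈ C¹[-1,1]` (one-sided derivatives at the end points). The second
entry is determined by the first. -/
def C1Sub : Submodule 𝕜 (C(I, 𝕜) × C(I, 𝕜)) where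
  carrier := {p | ∀ s : I, HasDerivWithinAt (ext p.1) (p.2 s) (Set.Icc (-1 : ℝ) 1) s}
  add_mem' := by
    intro p q hp hq s
    exact (hp s).add (hq s)
  zero_mem' := by
    intro s
    exact hasDerivWithinAt_const _ _ _
  smul_mem' := by
    intro a p hp s
    exact (hp s).const_smul a

/-- `C¹[-1,1]` with the norm `max (sup |W|) (sup |W'|)`. -/
def C1 : Type _ := C1Sub 𝕜

instance : NormedAddCommGroup (C1 𝕜) := inferInstanceAs (NormedAddCommGroup (C1Sub 𝕜))

instance : NormedSpace 𝕜 (C1 𝕜) := inferInstanceAs (NormedSpace 𝕜 (C1Sub 𝕜))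

variable {𝕜} in
/-- `W'` for `W ∈ C¹[-1,1]`. -/
def derivC1 (W : C1 𝕜) : C(I, 𝕜) := W.1.2

variable {𝕜} in
/-- `W` as an element of `C[-1,1]`. -/
def toC0 (W : C1 𝕜) : C(I, 𝕜) := W.1.1

theorem continuous_toC0 : Continuous (toC0 (𝕜 := 𝕜)) :=
  continuous_fst.comp continuous_subtype_val

theorem continuous_derivC1 : Continuous (derivC1 (𝕜 := 𝕜)) :=
  continuous_snd.comp continuous_subtype_val

variable {𝕜} in
/-- `W(s)` for `W ∈ C¹[-1,1]` and `s ∈ [-1,1]`. -/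
def evalC1 (W : C1 𝕜) : ℝ → 𝕜 := ext (toC0 W)

/-- `ℍ = 𝕜² × C[-1,1]`, with the maximum norm. -/
abbrev HH : Type _ := 𝕜 × 𝕜 × C(I, 𝕜)

/-- The `(u,v,W) ∈ 𝕜² × C¹[-1,1]` with `W(0) = u`. -/
def DDSub : Submodule 𝕜 (𝕜 × 𝕜 × C1 𝕜) where
  carrier := {U | evalC1 U.2.2 0 = U.1}
  add_mem' := by
    intro U V hU hV
    exact congrArg₂ (· + ·) hU hV
  zero_mem' := rfl
  smul_mem' := by
    intro a U hU
    exact congrArg (a • ·) hU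

/-- `𝔻 = {(u,v,W) ∈ 𝕜² × C¹[-1,1] : W(0) = u}`, with the maximum norm. -/
def DD : Type _ := DDSub 𝕜

instance : NormedAddCommGroup (DD 𝕜) := inferInstanceAs (NormedAddCommGroup (DDSub 𝕜))

instance : NormedSpace 𝕜 (DD 𝕜) := inferInstanceAs (NormedSpace 𝕜 (DDSub 𝕜))

theorem continuous_val : Continuous (fun U : DD 𝕜 => U.1) := continuous_subtype_val

/-- The embedding `𝔻 ⊂ ℍ`. -/
def incl : DD 𝕜 →L[𝕜] HH 𝕜 where
  toFun U := (U.1.1, U.1.2.1, toC0 U.1.2.2)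
  map_add' _ _ := rfl
  map_smul' _ _ := rfl
  cont := by
    have h := continuous_val 𝕜
    have h0 := continuous_toC0 𝕜
    fun_prop

/-- The operator `L_{γ,τ}` from its domain `𝔻` to `ℍ`:
`(u, v, W) ↦ (v, -τ²(1+2γ) u + γτ² (W(1) + W(-1)), W')`. -/
def LL (γ τ : ℝ) : DD 𝕜 →L[𝕜] HH 𝕜 where
  toFun U :=
    (U.1.2.1,
      -((τ ^ 2 * (1 + 2 * γ) : ℝ) : 𝕜) * U.1.1
        + ((γ * τ ^ 2 : ℝ) : 𝕜) * (evalC1 U.1.2.2 1 + evalC1 U.1.2.2 (-1)),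
      derivC1 U.1.2.2)
  map_add' U V := by
    refine Prod.ext rfl (Prod.ext ?_ rfl)
    change -((τ ^ 2 * (1 + 2 * γ) : ℝ) : 𝕜) * (U.1.1 + V.1.1) + ((γ * τ ^ 2 : ℝ) : 𝕜) *
        ((evalC1 U.1.2.2 1 + evalC1 V.1.2.2 1) + (evalC1 U.1.2.2 (-1) + evalC1 V.1.2.2 (-1)))
      = (-((τ ^ 2 * (1 + 2 * γ) : ℝ) : 𝕜) * U.1.1 + ((γ * τ ^ 2 : ℝ) : 𝕜) *
        (evalC1 U.1.2.2 1 + evalC1 U.1.2.2 (-1)))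
      + (-((τ ^ 2 * (1 + 2 * γ) : ℝ) : 𝕜) * V.1.1 + ((γ * τ ^ 2 : ℝ) : 𝕜) *
        (evalC1 V.1.2.2 1 + evalC1 V.1.2.2 (-1)))
    ring
  map_smul' a U := by
    refine Prod.ext rfl (Prod.ext ?_ rfl)
    change -((τ ^ 2 * (1 + 2 * γ) : ℝ) : 𝕜) * (a * U.1.1) + ((γ * τ ^ 2 : ℝ) : 𝕜) *
        (a * evalC1 U.1.2.2 1 + a * evalC1 U.1.2.2 (-1))
      = a * (-((τ ^ 2 * (1 + 2 * γ) : ℝ) : 𝕜) * U.1.1 + ((γ * τ ^ 2 : ℝ) : 𝕜) *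
        (evalC1 U.1.2.2 1 + evalC1 U.1.2.2 (-1)))
    ring
  cont := by
    have h := continuous_val 𝕜
    have h0 := continuous_toC0 𝕜
    have h1 := continuous_derivC1 𝕜
    unfold evalC1 ext Set.IccExtend Function.comp
    fun_prop

end Spaces

section Spectrum

/-- `L_{γ,τ} - z` on the complexified spaces. -/
def shifted (γ τ : ℝ) (z : ℂ) : DD ℂ →L[ℂ] HH ℂ := LL ℂ γ τ - z • incl ℂ

/-- The spectrum of `L_{γ,τ}`: all `z` such that `L_{γ,τ} - z : 𝔻 → ℍ` has no bounded
inverse. (The norm of `𝔻` is equivalent to the graph norm of `L_{γ,τ}`.) -/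
def spec (γ τ : ℝ) : Set ℂ := {z | ¬ (shifted γ τ z).IsInvertible}

/-- The eigenspace of `L_{γ,τ}` for `z`, as a subspace of the complexified `ℍ`. -/
def eigenspace (γ τ : ℝ) (z : ℂ) : Submodule ℂ (HH ℂ) :=
  (LinearMap.ker (shifted γ τ z : DD ℂ →ₗ[ℂ] HH ℂ)).map (incl ℂ : DD ℂ →ₗ[ℂ] HH ℂ)

/-- `z` is an eigenvalue of algebraic multiplicity one: the eigenspace is a line and
`ker (L_{γ,τ} - z)² = ker (L_{γ,τ} - z)`. -/
def IsSimpleEigenvalue (γ τ : ℝ) (z : ℂ) : Prop :=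
  Module.finrank ℂ (eigenspace γ τ z) = 1 ∧
    ∀ U V : DD ℂ, shifted γ τ z U = incl ℂ V → shifted γ τ z V = 0 → shifted γ τ z U = 0

/-- `(γ,τ) ∈ Δ₀`, with the pair `± i k₀`: the part of the spectrum of `L_{γ,τ}` on the imaginary
axis consists of the one pair `± i k₀`, `k₀ > 0`, of simple eigenvalues. -/
structure InDelta0 (γ τ k₀ : ℝ) : Prop where
  pos : 0 < k₀
  spec_eq : spec γ τ ∩ {z | z.re = 0} = {Complex.I * k₀, -(Complex.I * k₀)}
  simple_pos : IsSimpleEigenvalue γ τ (Complex.I * k₀)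
  simple_neg : IsSimpleEigenvalue γ τ (-(Complex.I * k₀))

/-- The embedding of the real space `ℍ` into its complexification. -/
def complexify : HH ℝ →ₗ[ℝ] HH ℂ where
  toFun U := ((U.1 : ℂ), (U.2.1 : ℂ), ⟨fun s => (U.2.2 s : ℂ), by fun_prop⟩)
  map_add' U V := by
    refine Prod.ext ?_ (Prod.ext ?_ ?_)
    · simp
    · simp
    · ext s
      simp
  map_smul' a U := by
    refine Prod.ext ?_ (Prod.ext ?_ ?_)
    · simp
    · simp
    · ext s
      simp

/-- The real (two-dimensional) eigenspace that belongs to the eigenvalues `± i k₀`: the real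
vectors in the sum of the two complex eigenspaces. -/
def centreSpace (γ τ k₀ : ℝ) : Submodule ℝ (HH ℝ) :=
  ((eigenspace γ τ (Complex.I * k₀) ⊔ eigenspace γ τ (-(Complex.I * k₀))).restrictScalars
    ℝ).comap complexify

/-- `P` is the spectral projection `P₁` of `L_{γ,τ}` onto the eigenspace of `± i k₀`: the bounded
projection with this range that commutes with `L_{γ,τ}` (it maps `𝔻` to `𝔻`, and
`L P U = P L U` for `U ∈ 𝔻`). -/
structure IsCentreProjection (γ τ k₀ : ℝ) (P : HH ℝ →L[ℝ] HH ℝ) : Prop where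
  idem : ∀ U, P (P U) = P U
  range_eq : LinearMap.range (P : HH ℝ →ₗ[ℝ] HH ℝ) = centreSpace γ τ k₀
  comm : ∀ U : DD ℝ, ∃ V : DD ℝ, incl ℝ V = P (incl ℝ U) ∧ LL ℝ γ τ V = P (LL ℝ γ τ U)

/-- `Q_h = I - P₁`. -/
def Qh (P : HH ℝ →L[ℝ] HH ℝ) : HH ℝ →L[ℝ] HH ℝ := ContinuousLinearMap.id ℝ (HH ℝ) - P

/-- `Q_h ℍ`, with the norm of `ℍ`. -/
def QhH (P : HH ℝ →L[ℝ] HH ℝ) : Submodule ℝ (HH ℝ) :=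
  LinearMap.range (Qh P : HH ℝ →ₗ[ℝ] HH ℝ)

/-- `Q_h 𝔻`, the image of `𝔻` under `Q_h`, as a subspace of `𝔻` with the norm of `𝔻`. -/
def QhD (P : HH ℝ →L[ℝ] HH ℝ) : Submodule ℝ (DD ℝ) :=
  ((LinearMap.range (incl ℝ : DD ℝ →ₗ[ℝ] HH ℝ)).map (Qh P : HH ℝ →ₗ[ℝ] HH ℝ)).comap
    (incl ℝ : DD ℝ →ₗ[ℝ] HH ℝ)

/-- The embedding `Q_h 𝔻 ⊂ Q_h ℍ`. -/
def inclQh (P : HH ℝ →L[ℝ] HH ℝ) (U : QhD P) : QhH P :=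
  ⟨incl ℝ U.1, by
    obtain ⟨V, -, hV⟩ := U.2
    exact ⟨V, hV⟩⟩

/-- The dispersion function `D(k) = -c² k² + 2 (1 - cos k) + α`, where `c² = 1/(γτ²)` and
`α = 1/γ`, that is, `τ² = α/c²` and `γ = 1/α`. -/
def dispersion (γ τ : ℝ) (k : ℂ) : ℂ :=
  -(1 / ((γ : ℂ) * (τ : ℂ) ^ 2)) * k ^ 2 + 2 * (1 - Complex.cos k) + 1 / (γ : ℂ)

/-- `p₀ = inf {|Im k| : D(k) = 0, Im k ≠ 0}`. -/
def p0 (γ τ : ℝ) : EReal :=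
  sInf {r : EReal | ∃ k : ℂ, dispersion γ τ k = 0 ∧ k.im ≠ 0 ∧ r = ((|k.im| : ℝ) : EReal)}

end Spectrum

section Weighted

variable (ν : ℝ) (X : Type*) [NormedAddCommGroup X] [NormedSpace ℝ X]

/-- The continuous functions `f : ℝ → X` with `sup_t e^{-ν|t|} ‖f t‖ < ∞`. -/
def E0Sub : Submodule ℝ (ℝ → X) where
  carrier := {f | Continuous f ∧ ∃ C : ℝ, ∀ t, Real.exp (-ν * |t|) * ‖f t‖ ≤ C}
  add_mem' := by
    rintro f g ⟨hf, C, hC⟩ ⟨hg, C', hC'⟩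
    refine ⟨hf.add hg, C + C', fun t => ?_⟩
    calc Real.exp (-ν * |t|) * ‖f t + g t‖
        ≤ Real.exp (-ν * |t|) * (‖f t‖ + ‖g t‖) := by gcongr; exact norm_add_le _ _
      _ = Real.exp (-ν * |t|) * ‖f t‖ + Real.exp (-ν * |t|) * ‖g t‖ := by ring
      _ ≤ C + C' := add_le_add (hC t) (hC' t)
  zero_mem' := ⟨continuous_const, 0, fun t => by simp⟩
  smul_mem' := by
    rintro a f ⟨hf, C, hC⟩
    refine ⟨hf.const_smul a, |a| * C, fun t => ?_⟩
    calc Real.exp (-ν * |t|) * ‖a • f t‖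
        = |a| * (Real.exp (-ν * |t|) * ‖f t‖) := by rw [norm_smul, Real.norm_eq_abs]; ring
      _ ≤ |a| * C := by gcongr; exact hC t

/-- The space `E^ν_0(X)`. Its norm is `sup_t e^{-ν|t|} ‖f t‖`, see `E0.norm_eq`. -/
def E0 : Type _ := E0Sub ν X

instance : AddCommGroup (E0 ν X) := inferInstanceAs (AddCommGroup (E0Sub ν X))

instance : Module ℝ (E0 ν X) := inferInstanceAs (Module ℝ (E0Sub ν X))

instance : CoeFun (E0 ν X) (fun _ => ℝ → X) := ⟨fun f => f.1⟩

/-- `f ↦ e^{-ν|·|} f` as a map to the bounded continuous functions. -/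
def E0.weight : E0 ν X →ₗ[ℝ] BoundedContinuousFunction ℝ X where
  toFun f := BoundedContinuousFunction.ofNormedAddCommGroup
    (fun t => Real.exp (-ν * |t|) • f t)
    (by
      have := f.2.1
      fun_prop)
    f.2.2.choose
    (fun t => by
      rw [norm_smul, Real.norm_eq_abs, abs_of_pos (Real.exp_pos _)]
      exact f.2.2.choose_spec t)
  map_add' f g := by
    ext t
    exact smul_add _ _ _
  map_smul' a f := by
    ext t
    exact smul_comm _ _ _

theorem E0.weight_injective : Function.Injective (E0.weight ν X) := by
  intro f g h
  refine Subtype.ext (funext fun t => ?_)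
  have h1 : Real.exp (-ν * |t|) • f t = Real.exp (-ν * |t|) • g t := DFunLike.congr_fun h t
  exact smul_right_injective X (Real.exp_pos _).ne' h1

instance : NormedAddCommGroup (E0 ν X) :=
  NormedAddCommGroup.induced (E0 ν X) (BoundedContinuousFunction ℝ X) (E0.weight ν X)
    (E0.weight_injective ν X)

instance : NormedSpace ℝ (E0 ν X) :=
  NormedSpace.induced ℝ (E0 ν X) (BoundedContinuousFunction ℝ X) (E0.weight ν X)

theorem E0.norm_eq (f : E0 ν X) : ‖f‖ = ⨆ t : ℝ, Real.exp (-ν * |t|) * ‖f t‖ := by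
  change ‖E0.weight ν X f‖ = _
  rw [BoundedContinuousFunction.norm_eq_iSup_norm]
  congr 1
  funext t
  change ‖Real.exp (-ν * |t|) • f t‖ = _
  rw [norm_smul, Real.norm_eq_abs, abs_of_pos (Real.exp_pos _)]

end Weighted

section Forcing

variable (γ τ k₀ : ℝ)

/-- `γτ² ∫_0^1 sin(k₀(1-s)) (W(s) + W(-s)) ds`. -/
def sinInt (W : C1 ℝ) : ℝ :=
  γ * τ ^ 2 * ∫ s in (0 : ℝ)..1, Real.sin (k₀ * (1 - s)) * (evalC1 W s + evalC1 W (-s))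

/-- `γτ² ∫_0^1 cos(k₀(1-s)) (W(s) - W(-s)) ds`. -/
def cosInt (W : C1 ℝ) : ℝ :=
  γ * τ ^ 2 * ∫ s in (0 : ℝ)..1, Real.cos (k₀ * (1 - s)) * (evalC1 W s - evalC1 W (-s))

theorem evalC1_continuous (W : C1 ℝ) : Continuous (evalC1 W) :=
  (toC0 W).continuous.Icc_extend'

theorem sinInt_add (W Z : C1 ℝ) :
    sinInt γ τ k₀ (W + Z) = sinInt γ τ k₀ W + sinInt γ τ k₀ Z := by
  have hW := evalC1_continuous W
  have hZ := evalC1_continuous Z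
  unfold sinInt
  rw [← mul_add, ← intervalIntegral.integral_add
    (Continuous.intervalIntegrable (by fun_prop) _ _)
    (Continuous.intervalIntegrable (by fun_prop) _ _)]
  congr 2
  funext s
  change _ * ((evalC1 W s + evalC1 Z s) + (evalC1 W (-s) + evalC1 Z (-s))) = _
  ring

theorem sinInt_smul (a : ℝ) (W : C1 ℝ) :
    sinInt γ τ k₀ (a • W) = a * sinInt γ τ k₀ W := by
  unfold sinInt
  rw [mul_left_comm a, ← intervalIntegral.integral_const_mul a]
  congr 2
  funext s
  change _ * (a * evalC1 W s + a * evalC1 W (-s)) = _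
  ring

/-- The `G₂ ∈ E^ν_0(C¹[-1,1])` with
`k₀ G₂(t,0) = γτ² ∫_0^1 sin(k₀(1-s)) (G₂(t,s) + G₂(t,-s)) ds` for all `t`. -/
def Adm (ν : ℝ) : Submodule ℝ (E0 ν (C1 ℝ)) where
  carrier := {G₂ | ∀ t, k₀ * evalC1 (G₂ t) 0 = sinInt γ τ k₀ (G₂ t)}
  add_mem' := by
    intro F G hF hG t
    change k₀ * (evalC1 (F t) 0 + evalC1 (G t) 0) = sinInt γ τ k₀ (F t + G t)
    rw [sinInt_add, mul_add, hF t, hG t]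
  zero_mem' := by
    intro t
    have h := sinInt_smul γ τ k₀ 0 0
    rw [zero_smul, zero_mul] at h
    change k₀ * 0 = sinInt γ τ k₀ 0
    rw [h, mul_zero]
  smul_mem' := by
    intro a F hF t
    change k₀ * (a * evalC1 (F t) 0) = sinInt γ τ k₀ (a • F t)
    rw [sinInt_smul, ← hF t]
    ring

/-- `G = (G₀, G₁, G₂)` with `k₀ G₀(t) = γτ² ∫_0^1 sin(k₀(1-s)) (G₂(t,s) + G₂(t,-s)) ds` and
`G₁(t) = γτ² ∫_0^1 cos(k₀(1-s)) (G₂(t,s) - G₂(t,-s)) ds`. -/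
def IsForcing {ν : ℝ} {P : HH ℝ →L[ℝ] HH ℝ} (G₂ : E0 ν (C1 ℝ)) (G : E0 ν (QhD P)) : Prop :=
  ∀ t, k₀ * (G t).1.1.1 = sinInt γ τ k₀ (G₂ t) ∧
    (G t).1.1.2.1 = cosInt γ τ k₀ (G₂ t) ∧
    (G t).1.1.2.2 = G₂ t

/-- `U ∈ E^ν_0(Q_h 𝔻) ∩ C¹(ℝ, Q_h ℍ)` and `∂_t U = L_{γ,τ} U + G` in `ℍ`. -/
def IsSolution {ν : ℝ} {P : HH ℝ →L[ℝ] HH ℝ} (G U : E0 ν (QhD P)) : Prop :=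
  ContDiff ℝ 1 (fun t => inclQh P (U t)) ∧
    ∀ t, HasDerivAt (fun t => incl ℝ (U t).1) (LL ℝ γ τ (U t).1 + incl ℝ (G t).1) t

end Forcing

end FKChain

end

open FKChain

/-! Write θ for the kernel (γτ²/k₀) sin(k₀(1-|s|)) on [-1,1] and Θ for its bilateral Laplace
transform. The eigenvalues of L are the roots of χ(z) = z² + τ²(1+2γ) - 2γτ² cosh z. Because ik₀ is
a root, χ(z) = (z² + k₀²)(1 - Θ(z)) (`InDelta0.charFn_eq`). Simplicity of ik₀ forces χ'(ik₀) ≠ 0,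
equivalently Θ(ik₀) ≠ 1, so Θ avoids 1 on the whole imaginary axis. Since Θ decays quadratically
along vertical lines, it avoids 1 on a strip around the axis, which gives p₀ > 0. The zeros of D
correspond to those of χ under z = ik, so Θ ≠ 1 holds as long as |Re z| < p₀. Inverting Θ/(1 - Θ)
and shifting the contour then yields a resolvent kernel r = θ + θ * r with |r(t)| ≤ B e^{-p|t|}, for
every nonnegative p < p₀ (`exists_resolvent_kernel`).

The projection is explicit. Two real functionals `phiRe` and `phiIm` are rotated into each other by
L, and a vector has no centre part exactly when both vanish: v = cosF(W) and k₀u = sinF(W). Any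
projection commuting with L with the prescribed range kills this common kernel, since there the
equation (L - ik₀)Z = F is solvable (`InDelta0.eq_centreProj`). The constraints also show that an
element of Q_h 𝔻 is determined by its third component, which gives J.

For the evolution equation, the third component solves a transport equation, so W(t,s) = u(t+s)
minus the integral of G₂ along the characteristic. Inserting this into k₀u = sinF(W) turns the
problem into the scalar equation u = θ * u - F, solved by u = -(F + r * F). Differentiating the
constraints in t recovers the first two components of the evolution equation, because G satisfies
the same constraints (`InDelta0.exists_solution_of_resolvent`). With no forcing, W(t,s) = u(t+s) and
u = θ * u; convolving with r gives u = 0 for growth below the rate p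
(`InDelta0.eq_zero_of_hasDerivAt`).

One kernel r serves all |ν| ≤ q < p, so the bounds are locally uniform in ν. The admissible
constants form an upward closed, hence convex, set for each ν, and a partition of unity selects a
continuous bound. -/

namespace FKChain

/-! ### Resolvent kernels by Laplace inversion and contour shift -/

section Resolvent

open MeasureTheory Filter Topology Complex
open scoped FourierTransform

/-- Differentiation under an interval integral, for a jointly continuous integrand with jointly
continuous derivative. -/
theorem hasDerivAt_intervalIntegral_of_continuous {𝕜 E : Type*} [RCLike 𝕜]
    [NormedAddCommGroup E] [NormedSpace ℝ E] [NormedSpace 𝕜 E] {F F' : 𝕜 → ℝ → E}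
    (hF : Continuous (Function.uncurry F)) (hF' : Continuous (Function.uncurry F'))
    (h : ∀ x t, HasDerivAt (fun x => F x t) (F' x t) x) (a b : ℝ) (x₀ : 𝕜) :
    HasDerivAt (fun x => ∫ t in a..b, F x t) (∫ t in a..b, F' x₀ t) x₀ := by
  obtain ⟨C, hC⟩ := ((isCompact_closedBall x₀ 1).prod
    (isCompact_uIcc (a := a) (b := b))).exists_bound_of_continuousOn hF'.continuousOn
  have hF1 : ∀ x, Continuous (F x) := fun x => by
    have : Continuous fun t => Function.uncurry F (x, t) := by fun_prop
    exact this
  have hF1' : ∀ x, Continuous (F' x) := fun x => by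
    have : Continuous fun t => Function.uncurry F' (x, t) := by fun_prop
    exact this
  refine (intervalIntegral.hasDerivAt_integral_of_dominated_loc_of_deriv_le (bound := fun _ => C)
    (Metric.closedBall_mem_nhds x₀ one_pos)
    (Eventually.of_forall fun x => (hF1 x).aestronglyMeasurable)
    ((hF1 x₀).intervalIntegrable _ _) (hF1' x₀).aestronglyMeasurable
    (Eventually.of_forall fun t ht x hx => ?_) intervalIntegrable_const
    (Eventually.of_forall fun t _ x _ => h x t)).2
  exact hC (x, t) ⟨hx, Set.uIoc_subset_uIcc ht⟩

theorem integrable_div_one_add_sq (C : ℝ) : Integrable fun y : ℝ => C / (1 + y ^ 2) := by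
  simpa [div_eq_mul_inv] using integrable_inv_one_add_sq.const_mul C

/-- The integral over a vertical line does not change when the line is moved inside a strip on
which the integrand is holomorphic with quadratic decay. -/
theorem integral_vertical_line_eq {g : ℂ → ℂ} {p C : ℝ}
    (hd : ∀ z : ℂ, |z.re| ≤ p → DifferentiableAt ℂ g z)
    (hb : ∀ z : ℂ, |z.re| ≤ p → ‖g z‖ ≤ C / (1 + z.im ^ 2)) {σ : ℝ} (hσ : |σ| ≤ p) :
    ∫ y : ℝ, g (σ + y * Complex.I) = ∫ y : ℝ, g (y * Complex.I) := by
  have hp : 0 ≤ p := (abs_nonneg σ).trans hσ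
  have hint : ∀ s : ℝ, |s| ≤ p → Integrable fun y : ℝ => g (s + y * Complex.I) := by
    intro s hs
    refine (integrable_div_one_add_sq C).mono' ?_ (Eventually.of_forall fun y => ?_)
    · refine Continuous.aestronglyMeasurable ?_
      rw [continuous_iff_continuousAt]
      intro y
      have h1 := (hd (s + y * Complex.I) (by simpa using hs)).continuousAt
      exact ContinuousAt.comp (f := fun y : ℝ => (s + y * Complex.I : ℂ)) h1 (by fun_prop)
    · simpa using hb (s + y * Complex.I) (by simpa using hs)
  have hlim : ∀ s : ℝ, |s| ≤ p →
      Tendsto (fun T : ℝ => ∫ y in (-T)..T, g (s + y * Complex.I)) atTop (𝓝 (∫ y : ℝ, g (s + y * Complex.I))) :=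
    fun s hs => intervalIntegral_tendsto_integral (hint s hs) tendsto_neg_atTop_atBot tendsto_id
  -- The sign ε = ±1 treats the top and bottom sides of the rectangle at once; both vanish in the
  -- limit by the quadratic decay.
  have hhor : ∀ ε : ℝ, |ε| = 1 →
      Tendsto (fun T : ℝ => ∫ x in (0 : ℝ)..σ, g (x + (ε * T : ℝ) * Complex.I)) atTop (𝓝 0) := by
    intro ε hε
    have hz : Tendsto (fun T : ℝ => C / (1 + T ^ 2) * |σ - 0|) atTop (𝓝 0) := by
      have : Tendsto (fun T : ℝ => 1 + T ^ 2) atTop atTop :=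
        tendsto_atTop_add_const_left _ _ (tendsto_pow_atTop two_ne_zero)
      simpa using (this.const_div_atTop C).mul_const |σ - 0|
    refine squeeze_zero_norm (fun T => ?_) hz
    refine intervalIntegral.norm_integral_le_of_norm_le_const fun x hx => ?_
    have hx' : |x| ≤ p := by
      rcases le_total 0 σ with h | h
      · rw [Set.uIoc_of_le h] at hx
        rw [abs_of_nonneg h] at hσ
        rw [abs_of_pos hx.1]
        exact hx.2.trans hσ
      · rw [Set.uIoc_of_ge h] at hx
        rw [abs_of_nonpos h] at hσ
        rw [abs_of_nonpos hx.2]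
        linarith [hx.1]
    have h2 := hb (x + (ε * T : ℝ) * Complex.I) (by simpa using hx')
    have h3 : (ε * T) ^ 2 = T ^ 2 := by
      rw [mul_pow, ← sq_abs ε, hε]
      ring
    simpa [h3] using h2
  have hrect : ∀ T : ℝ, (∫ x in (0 : ℝ)..σ, g (x + ((-1) * T : ℝ) * Complex.I))
      - (∫ x in (0 : ℝ)..σ, g (x + (1 * T : ℝ) * Complex.I))
      + Complex.I • (∫ y in (-T)..T, g (σ + y * Complex.I)) - Complex.I • (∫ y in (-T)..T, g ((0 : ℝ) + y * Complex.I)) = 0 := by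
    intro T
    have h := Complex.integral_boundary_rect_eq_zero_of_differentiableOn g (-T * Complex.I) (σ + T * Complex.I) ?_
    · simpa using h
    · intro z hz
      refine (hd z ?_).differentiableWithinAt
      have hz1 := hz.1
      simp only [neg_mul, Set.mem_preimage, neg_re, mul_re, ofReal_re, I_re, mul_zero, ofReal_im,
        I_im, mul_one, sub_self, neg_zero, add_re, add_zero] at hz1
      rw [Set.mem_uIcc] at hz1
      rcases hz1 with ⟨h1, h2⟩ | ⟨h1, h2⟩
      · rw [abs_of_nonneg h1]
        exact h2.trans ((le_abs_self _).trans hσ)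
      · rw [abs_of_nonpos h2]
        linarith [neg_abs_le σ]
  have hzero := (((hhor (-1) (by simp)).sub (hhor 1 (by simp))).add
    ((hlim σ hσ).const_smul Complex.I)).sub ((hlim 0 (by simpa using hp)).const_smul Complex.I)
  simp only [hrect] at hzero
  have h5 := tendsto_nhds_unique hzero tendsto_const_nhds
  simp only [sub_zero, zero_add, smul_eq_mul, ofReal_zero] at h5
  have h6 : Complex.I * ((∫ y : ℝ, g (σ + y * Complex.I)) - ∫ y : ℝ, g (y * Complex.I)) = 0 := by
    rw [mul_sub]
    exact h5
  rcases mul_eq_zero.1 h6 with h7 | h7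
  · exact absurd h7 I_ne_zero
  · exact sub_eq_zero.1 h7

/-- A continuous function that avoids a value on a closed strip and decays quadratically
along it stays away from that value. -/
theorem exists_pos_le_norm_one_sub {Θ : ℂ → ℂ} (hΘ : Continuous Θ) {p M : ℝ}
    (hb : ∀ z : ℂ, |z.re| ≤ p → ‖Θ z‖ ≤ M / (1 + z.im ^ 2))
    (hne : ∀ z : ℂ, |z.re| ≤ p → Θ z ≠ 1) :
    ∃ δ > 0, ∀ z : ℂ, |z.re| ≤ p → δ ≤ ‖1 - Θ z‖ := by
  rcases lt_or_ge p 0 with hp | hp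
  · exact ⟨1, one_pos, fun z hz => absurd ((abs_nonneg _).trans hz) (not_le.2 hp)⟩
  have hM : 0 ≤ M := by
    have := (norm_nonneg _).trans (hb 0 (by simpa using hp))
    simpa using this
  -- For |Im z| > R the decay gives |Θ| ≤ 1/2, since 1 + R² ≥ 2M; the remaining rectangle is
  -- compact.
  set R : ℝ := 2 * M + 1 with hR
  have hcomp : IsCompact (Set.Icc (-p) p ×ℂ Set.Icc (-R) R) := isCompact_Icc.reProdIm isCompact_Icc
  have hnon : (Set.Icc (-p) p ×ℂ Set.Icc (-R) R).Nonempty :=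
    ⟨0, by simp [Complex.mem_reProdIm, hp]; linarith⟩
  obtain ⟨z₀, hz₀, hmin⟩ := hcomp.exists_isMinOn hnon
    (f := fun z => ‖1 - Θ z‖) (by fun_prop)
  have hz₀' : |z₀.re| ≤ p := abs_le.2 hz₀.1
  refine ⟨min ‖1 - Θ z₀‖ (1 / 2), lt_min (norm_pos_iff.2 (sub_ne_zero.2 (hne z₀ hz₀').symm))
    (by norm_num), fun z hz => ?_⟩
  by_cases hzR : |z.im| ≤ R
  · exact (min_le_left _ _).trans (hmin ⟨abs_le.1 hz, abs_le.1 hzR⟩)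
  · refine (min_le_right _ _).trans ?_
    have h1 : ‖Θ z‖ ≤ 1 / 2 := by
      refine (hb z hz).trans ?_
      rw [div_le_iff₀ (by positivity)]
      have : R < |z.im| := not_le.1 hzR
      have h2 : R ^ 2 ≤ z.im ^ 2 := by
        rw [← sq_abs z.im]
        gcongr
      nlinarith
    have h2 := norm_sub_norm_le (1 : ℂ) (Θ z)
    rw [norm_one] at h2
    linarith

/-- The bilateral Laplace transform. -/
noncomputable def laplace (θ : ℝ → ℝ) (z : ℂ) : ℂ := ∫ s : ℝ, (θ s : ℂ) * cexp (-z * s)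

set_option maxHeartbeats 1000000 in
/-- A convolution kernel whose transform avoids `1` on a strip has a resolvent kernel that decays
exponentially. -/
theorem exists_resolvent_kernel {θ : ℝ → ℝ} (hθ : Continuous θ) (hθi : Integrable θ)
    (hΘ : Differentiable ℂ (laplace θ)) {p M : ℝ} (hp : 0 ≤ p)
    (hb : ∀ z : ℂ, |z.re| ≤ p → ‖laplace θ z‖ ≤ M / (1 + z.im ^ 2))
    (hne : ∀ z : ℂ, |z.re| ≤ p → laplace θ z ≠ 1) :
    ∃ (r : ℝ → ℝ) (C : ℝ), Continuous r ∧ (∀ t, |r t| ≤ C * Real.exp (-p * |t|)) ∧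
      ∀ t, r t = θ t + ∫ s, θ s * r (t - s) := by
  obtain ⟨δ, hδ, hδb⟩ := exists_pos_le_norm_one_sub hΘ.continuous hb hne
  -- The transform that r must have: r = θ + θ * r becomes R = Θ + ΘR.
  obtain ⟨f, hf⟩ : ∃ f : ℂ → ℂ, f = fun z => laplace θ z / (1 - laplace θ z) := ⟨_, rfl⟩
  have hfd : ∀ z : ℂ, |z.re| ≤ p → DifferentiableAt ℂ f z := fun z hz => by
    rw [hf]
    exact (hΘ z).div ((differentiableAt_const _).sub (hΘ z)) (sub_ne_zero.2 (hne z hz).symm)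
  have hfb : ∀ z : ℂ, |z.re| ≤ p → ‖f z‖ ≤ (M / δ) / (1 + z.im ^ 2) := by
    intro z hz
    have h1 := hb z hz
    have h2 := hδb z hz
    rw [hf]
    simp only [norm_div]
    calc ‖laplace θ z‖ / ‖1 - laplace θ z‖ ≤ (M / (1 + z.im ^ 2)) / δ := by
          apply div_le_div₀ ((norm_nonneg _).trans h1) h1 hδ h2
      _ = _ := by field_simp
  have hline : ∀ y : ℝ, |(y * Complex.I : ℂ).re| ≤ p := fun y => by simpa using hp
  have hfc : Continuous fun y : ℝ => f (y * Complex.I) := by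
    rw [continuous_iff_continuousAt]
    intro y
    exact ContinuousAt.comp (f := fun y : ℝ => (y * Complex.I : ℂ)) (hfd _ (hline y)).continuousAt
      (by fun_prop)
  have hfi : Integrable fun y : ℝ => f (y * Complex.I) := by
    refine (integrable_div_one_add_sq (M / δ)).mono' hfc.aestronglyMeasurable
      (Eventually.of_forall fun y => ?_)
    simpa using hfb (y * Complex.I) (hline y)
  have hΘi : Integrable fun y : ℝ => laplace θ (y * Complex.I) := by
    refine (integrable_div_one_add_sq M).mono' ?_ (Eventually.of_forall fun y => ?_)
    · have := hΘ.continuous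
      exact Continuous.aestronglyMeasurable (by fun_prop)
    · simpa using hb (y * Complex.I) (hline y)
  set rc : ℝ → ℂ := fun t => (1 / (2 * Real.pi) : ℂ) * ∫ y : ℝ, f (y * Complex.I) * cexp (y * Complex.I * t) with hrc
  have hexp1 : ∀ y t : ℝ, ‖cexp (y * Complex.I * t)‖ = 1 := by
    intro y t
    have : (y * Complex.I * t : ℂ) = (y * t : ℝ) * Complex.I := by push_cast; ring
    rw [this, norm_exp_ofReal_mul_I]
  have hrcc : Continuous rc := by
    refine continuous_const.mul (continuous_of_dominated (bound := fun y => ‖f (y * Complex.I)‖)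
      (fun t => ?_) (fun t => Eventually.of_forall fun y => ?_) hfi.norm
      (Eventually.of_forall fun y => by fun_prop))
    · exact Continuous.aestronglyMeasurable (hfc.mul (by fun_prop))
    · rw [norm_mul, hexp1, mul_one]
  have hshift : ∀ (t σ : ℝ), |σ| ≤ p →
      ∫ y : ℝ, f (σ + y * Complex.I) * cexp ((σ + y * Complex.I) * t) = ∫ y : ℝ, f (y * Complex.I) * cexp (y * Complex.I * t) := by
    intro t σ hσ
    refine integral_vertical_line_eq (g := fun z => f z * cexp (z * t)) (p := p)
      (C := M / δ * Real.exp (p * |t|)) (fun z hz => ?_) (fun z hz => ?_) hσ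
    · exact (hfd z hz).mul (by fun_prop)
    · rw [norm_mul, norm_exp]
      have h1 := hfb z hz
      have h2 : (z * t).re ≤ p * |t| := by
        simp only [mul_re, ofReal_re, ofReal_im, mul_zero, sub_zero]
        calc z.re * t ≤ |z.re * t| := le_abs_self _
          _ = |z.re| * |t| := abs_mul _ _
          _ ≤ p * |t| := by gcongr
      calc ‖f z‖ * Real.exp (z * t).re
          ≤ (M / δ) / (1 + z.im ^ 2) * Real.exp (p * |t|) := by
            apply mul_le_mul h1 (Real.exp_le_exp.2 h2) (Real.exp_nonneg _)
              ((norm_nonneg _).trans h1)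
        _ = _ := by ring
  -- The constant does not depend on the line Re z = σ, so σ can be chosen at the end according to
  -- the sign of t.
  have hrcb : ∀ t σ : ℝ, |σ| ≤ p → ‖rc t‖ ≤
      (1 / (2 * Real.pi) * ∫ y : ℝ, (M / δ) / (1 + y ^ 2)) * Real.exp (σ * t) := by
    intro t σ hσ
    rw [hrc]
    simp only
    rw [← hshift t σ hσ, norm_mul, mul_assoc, ← integral_mul_const]
    have h0 : ‖(1 / (2 * Real.pi) : ℂ)‖ = 1 / (2 * Real.pi) := by
      simp [abs_of_pos Real.pi_pos]
    rw [h0]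
    refine mul_le_mul_of_nonneg_left ?_ (by positivity)
    refine norm_integral_le_of_norm_le ((integrable_div_one_add_sq _).mul_const _)
      (Eventually.of_forall fun y => ?_)
    rw [norm_mul, norm_exp]
    have h1 := hfb (σ + y * Complex.I) (by simpa using hσ)
    have h2 : ((σ + y * Complex.I) * t : ℂ).re = σ * t := by simp
    rw [h2]
    have h3 : (σ + y * Complex.I : ℂ).im = y := by simp
    rw [h3] at h1
    gcongr
  -- Fourier inversion for θ, with the frequency rescaled by y = 2πξ.
  have hinv : ∀ t : ℝ, (θ t : ℂ) =
      (1 / (2 * Real.pi) : ℂ) * ∫ y : ℝ, laplace θ (y * Complex.I) * cexp (y * Complex.I * t) := by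
    intro t
    have hF : 𝓕 (fun s : ℝ => (θ s : ℂ)) = fun ξ : ℝ => laplace θ ((2 * Real.pi * ξ : ℝ) * Complex.I) := by
      funext ξ
      rw [Real.fourier_eq']
      unfold laplace
      refine integral_congr_ae (Eventually.of_forall fun s => ?_)
      simp only [smul_eq_mul]
      rw [mul_comm]
      congr 2
      simp only [RCLike.inner_apply, conj_trivial]
      push_cast
      ring
    have hFi : Integrable (𝓕 (fun s : ℝ => (θ s : ℂ))) := by
      rw [hF]
      exact hΘi.comp_mul_left' (by positivity)
    have h1 := (hθi.ofReal (𝕜 := ℂ)).fourierInv_fourier_eq hFi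
      (continuous_ofReal.comp hθ).continuousAt (v := t)
    have h2 : (θ t : ℂ) = ∫ ξ : ℝ, (fun y : ℝ => laplace θ (y * Complex.I) * cexp (y * Complex.I * t))
        (2 * Real.pi * ξ) := by
      refine h1.symm.trans ?_
      change 𝓕⁻ (𝓕 fun s : ℝ => (θ s : ℂ)) t = _
      rw [hF, Real.fourierInv_eq']
      refine integral_congr_ae (Eventually.of_forall fun s => ?_)
      simp only [smul_eq_mul]
      rw [mul_comm]
      congr 2
      simp only [RCLike.inner_apply, conj_trivial]
      push_cast
      ring
    rw [h2, Measure.integral_comp_mul_left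
      (fun y : ℝ => laplace θ (y * Complex.I) * cexp (y * Complex.I * t)), abs_of_pos (by positivity)]
    rw [Complex.real_smul]
    congr 1
    push_cast
    simp
  -- Fubini applies because θ is integrable, f is integrable on the imaginary axis and the
  -- exponential has modulus one there.
  have hconv : ∀ t : ℝ, ∫ s : ℝ, (θ s : ℂ) * rc (t - s) =
      (1 / (2 * Real.pi) : ℂ) * ∫ y : ℝ, laplace θ (y * Complex.I) * f (y * Complex.I) * cexp (y * Complex.I * t) := by
    intro t
    have hI : Integrable (Function.uncurry fun (s : ℝ) (y : ℝ) =>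
        (θ s : ℂ) * (f (y * Complex.I) * cexp (y * Complex.I * ((t - s : ℝ) : ℂ)))) (volume.prod volume) := by
      have h1 : Integrable (fun q : ℝ × ℝ => (θ q.1 : ℂ) * f (q.2 * Complex.I)) (volume.prod volume) :=
        (hθi.ofReal (𝕜 := ℂ)).mul_prod hfi
      refine (h1.norm).mono' (Continuous.aestronglyMeasurable ?_)
        (Eventually.of_forall fun q => ?_)
      · have : Continuous fun q : ℝ × ℝ => f (q.2 * Complex.I) := hfc.comp continuous_snd
        exact (show Continuous fun q : ℝ × ℝ => (θ q.1 : ℂ) by fun_prop).mul (this.mul (by fun_prop))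
      · simp only [Function.uncurry, norm_mul]
        rw [hexp1, mul_one]
    calc ∫ s : ℝ, (θ s : ℂ) * rc (t - s)
        = ∫ s : ℝ, (1 / (2 * Real.pi) : ℂ) *
            ∫ y : ℝ, (θ s : ℂ) * (f (y * Complex.I) * cexp (y * Complex.I * ((t - s : ℝ) : ℂ))) := by
          refine integral_congr_ae (Eventually.of_forall fun s => ?_)
          simp only [hrc]
          rw [integral_const_mul]
          ring
      _ = (1 / (2 * Real.pi) : ℂ) * ∫ y : ℝ, ∫ s : ℝ,
            (θ s : ℂ) * (f (y * Complex.I) * cexp (y * Complex.I * ((t - s : ℝ) : ℂ))) := by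
          rw [integral_const_mul, integral_integral_swap hI]
      _ = _ := by
          congr 1
          refine integral_congr_ae (Eventually.of_forall fun y => ?_)
          simp only [laplace]
          rw [mul_assoc, ← integral_mul_const]
          refine integral_congr_ae (Eventually.of_forall fun s => ?_)
          simp only
          have : cexp (y * Complex.I * ((t - s : ℝ) : ℂ)) = cexp (-(y * Complex.I) * s) * cexp (y * Complex.I * t) := by
            rw [← Complex.exp_add]
            congr 1
            push_cast
            ring
          rw [this]
          ring
  have hres : ∀ t : ℝ, rc t = θ t + ∫ s : ℝ, (θ s : ℂ) * rc (t - s) := by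
    intro t
    rw [hinv t, hconv t, ← mul_add, ← integral_add]
    · simp only [hrc]
      congr 1
      refine integral_congr_ae (Eventually.of_forall fun y => ?_)
      simp only [hf]
      have := sub_ne_zero.2 (hne _ (hline y)).symm
      field_simp
      ring
    · refine hΘi.norm.mono' ?_ (Eventually.of_forall fun y => ?_)
      · have := hΘ.continuous
        exact Continuous.aestronglyMeasurable (by fun_prop)
      · rw [norm_mul, hexp1, mul_one]
    · have h1 : Integrable fun y : ℝ => laplace θ (y * Complex.I) * f (y * Complex.I) := by
        -- Writing the bound M for |Θ| on the axis as M / 1 lets it be compared with M / (1 + y²) by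
        -- monotonicity in the denominator.
        refine (hfi.norm.const_mul (M / 1)).mono' ?_ (Eventually.of_forall fun y => ?_)
        · have := hΘ.continuous
          exact Continuous.aestronglyMeasurable ((show Continuous fun y : ℝ =>
            laplace θ (y * Complex.I) by fun_prop).mul hfc)
        · rw [norm_mul]
          gcongr
          refine (hb _ (hline y)).trans ?_
          have hM : 0 ≤ M := by
            have := (norm_nonneg _).trans (hb 0 (by simpa using hp))
            simpa using this
          gcongr
          nlinarith [sq_nonneg (y * Complex.I : ℂ).im]
      refine h1.norm.mono' ?_ (Eventually.of_forall fun y => ?_)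
      · have := hΘ.continuous
        exact Continuous.aestronglyMeasurable (((show Continuous fun y : ℝ =>
          laplace θ (y * Complex.I) by fun_prop).mul hfc).mul (by fun_prop))
      · rw [norm_mul, hexp1, mul_one]
  refine ⟨fun t => (rc t).re, 1 / (2 * Real.pi) * ∫ y : ℝ, (M / δ) / (1 + y ^ 2),
    by fun_prop, fun t => ?_, fun t => ?_⟩
  · refine (abs_re_le_norm _).trans ?_
    -- Decay in both directions: the line Re z = -p is used for t ≥ 0 and Re z = p for t ≤ 0.
    rcases le_total 0 t with ht | ht
    · have := hrcb t (-p) (by rw [abs_neg, abs_of_nonneg hp])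
      rwa [abs_of_nonneg ht]
    · have := hrcb t p (by rw [abs_of_nonneg hp])
      rwa [abs_of_nonpos ht, neg_mul_neg]
  · have hconvI : Integrable fun s : ℝ => (θ s : ℂ) * rc (t - s) := by
      refine (hθi.norm.mul_const
        (1 / (2 * Real.pi) * ∫ y : ℝ, (M / δ) / (1 + y ^ 2))).mono'
        (Continuous.aestronglyMeasurable (by fun_prop)) (Eventually.of_forall fun s => ?_)
      rw [norm_mul, norm_real]
      have := hrcb (t - s) 0 (by simpa using hp)
      gcongr
      simpa using this
    have h := congrArg Complex.re (hres t)
    simp only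
    rw [h, add_re, ofReal_re]
    congr 1
    have := (Complex.reCLM.integral_comp_comm hconvI).symm
    simp only [reCLM_apply] at this
    rw [this]
    refine integral_congr_ae (Eventually.of_forall fun s => ?_)
    simp

end Resolvent

/-! ### Convolution with exponentially decaying kernels on weighted spaces -/

section Convolution

open MeasureTheory Filter Topology

theorem integrable_exp_neg_mul_abs {a : ℝ} (ha : 0 < a) :
    Integrable fun x : ℝ => Real.exp (-a * |x|) := by
  rw [← integrableOn_univ, ← Set.Iic_union_Ioi (a := (0 : ℝ))]
  refine IntegrableOn.union ?_ ?_
  · refine (integrableOn_exp_mul_Iic ha 0).congr_fun (fun x hx => ?_) measurableSet_Iic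
    simp [abs_of_nonpos (Set.mem_Iic.1 hx)]
  · refine (integrableOn_exp_mul_Ioi (neg_lt_zero.2 ha) 0).congr_fun (fun x hx => ?_)
      measurableSet_Ioi
    simp [abs_of_pos (Set.mem_Ioi.1 hx)]

/-- Translation changes |t| by at most |x|. With |ν| on the right, the bound covers growing and
decaying weights alike. -/
theorem exp_mul_abs_add_le (ν t x : ℝ) :
    Real.exp (ν * |t + x|) ≤ Real.exp (ν * |t|) * Real.exp (|ν| * |x|) := by
  rw [← Real.exp_add, Real.exp_le_exp]
  have h1 : |(|t + x| - |t|)| ≤ |x| := by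
    simpa using abs_abs_sub_abs_le_abs_sub (t + x) t
  have h2 : ν * (|t + x| - |t|) ≤ |ν| * |x| :=
    (le_abs_self _).trans (by rw [abs_mul]; gcongr)
  linarith

/-- Convolution of a kernel with a function. -/
noncomputable def conv (a F : ℝ → ℝ) (t : ℝ) : ℝ := ∫ x, a x * F (t - x)

variable {a b F : ℝ → ℝ} {A B M p ν : ℝ}

theorem abs_mul_comp_sub_le (hA : ∀ t, |a t| ≤ A * Real.exp (-p * |t|))
    (hM : ∀ t, |F t| ≤ M * Real.exp (ν * |t|)) (t x : ℝ) :
    |a x * F (t - x)| ≤ A * M * Real.exp (ν * |t|) * Real.exp (-(p - |ν|) * |x|) := by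
  have hA0 : 0 ≤ A := by simpa using (abs_nonneg _).trans (hA 0)
  have hM0 : 0 ≤ M := by simpa using (abs_nonneg _).trans (hM 0)
  rw [abs_mul]
  calc |a x| * |F (t - x)|
      ≤ (A * Real.exp (-p * |x|)) * (M * (Real.exp (ν * |t|) * Real.exp (|ν| * |x|))) := by
        refine mul_le_mul (hA x) ((hM _).trans ?_) (abs_nonneg _) (by positivity)
        gcongr
        have := exp_mul_abs_add_le ν t (-x)
        rwa [abs_neg, ← sub_eq_add_neg] at this
    _ = A * M * Real.exp (ν * |t|) * (Real.exp (-p * |x|) * Real.exp (|ν| * |x|)) := by ring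
    _ = _ := by
        rw [← Real.exp_add]
        congr 2
        ring

theorem integrable_mul_comp_sub (ha : Continuous a) (hF : Continuous F)
    (hA : ∀ t, |a t| ≤ A * Real.exp (-p * |t|))
    (hM : ∀ t, |F t| ≤ M * Real.exp (ν * |t|)) (hν : |ν| < p) (t : ℝ) :
    Integrable fun x => a x * F (t - x) :=
  ((integrable_exp_neg_mul_abs (sub_pos.2 hν)).const_mul _).mono'
    (Continuous.aestronglyMeasurable (by fun_prop))
    (Eventually.of_forall fun x => abs_mul_comp_sub_le hA hM t x)

/-- Convolution costs only the surplus of the decay of the kernel over the growth of the function.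
The integral involves q rather than |ν|, so that the constant is uniform in |ν| ≤ q. -/
theorem abs_conv_le (hA : ∀ t, |a t| ≤ A * Real.exp (-p * |t|))
    (hM : ∀ t, |F t| ≤ M * Real.exp (ν * |t|)) {q : ℝ} (hν : |ν| ≤ q) (hq : q < p) (t : ℝ) :
    |conv a F t| ≤ A * M * (∫ x, Real.exp (-(p - q) * |x|)) * Real.exp (ν * |t|) := by
  have hA0 : 0 ≤ A := by simpa using (abs_nonneg _).trans (hA 0)
  have hM0 : 0 ≤ M := by simpa using (abs_nonneg _).trans (hM 0)
  have h := norm_integral_le_of_norm_le (f := fun x => a x * F (t - x))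
    ((integrable_exp_neg_mul_abs (sub_pos.2 hq)).const_mul (A * M * Real.exp (ν * |t|)))
    (Eventually.of_forall fun x => (abs_mul_comp_sub_le hA hM t x).trans (by gcongr))
  rw [integral_const_mul] at h
  refine h.trans (le_of_eq ?_)
  ring

theorem continuous_conv (ha : Continuous a) (hF : Continuous F)
    (hA : ∀ t, |a t| ≤ A * Real.exp (-p * |t|))
    (hM : ∀ t, |F t| ≤ M * Real.exp (ν * |t|)) (hν : |ν| < p) : Continuous (conv a F) := by
  have hA0 : 0 ≤ A := by simpa using (abs_nonneg _).trans (hA 0)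
  have hM0 : 0 ≤ M := by simpa using (abs_nonneg _).trans (hM 0)
  rw [continuous_iff_continuousAt]
  intro t₀
  refine continuousAt_of_dominated
    (bound := fun x => A * M * Real.exp (|ν| * (|t₀| + 1)) * Real.exp (-(p - |ν|) * |x|))
    (Eventually.of_forall fun t => Continuous.aestronglyMeasurable (by fun_prop)) ?_
    ((integrable_exp_neg_mul_abs (sub_pos.2 hν)).const_mul _)
    (Eventually.of_forall fun x => by fun_prop)
  have hev : ∀ᶠ t in 𝓝 t₀, |t| < |t₀| + 1 :=
    continuous_abs.continuousAt.eventually_lt continuousAt_const (by simp)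
  filter_upwards [hev] with t ht
  refine Eventually.of_forall fun x => (abs_mul_comp_sub_le hA hM t x).trans ?_
  gcongr
  · exact le_abs_self ν

theorem conv_conv_comm (ha : Continuous a) (hb : Continuous b) (hF : Continuous F)
    (hA : ∀ t, |a t| ≤ A * Real.exp (-p * |t|)) (hB : ∀ t, |b t| ≤ B * Real.exp (-p * |t|))
    (hM : ∀ t, |F t| ≤ M * Real.exp (ν * |t|)) (hν : |ν| < p) :
    conv a (conv b F) = conv b (conv a F) := by
  have hA0 : 0 ≤ A := by simpa using (abs_nonneg _).trans (hA 0)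
  have hB0 : 0 ≤ B := by simpa using (abs_nonneg _).trans (hB 0)
  funext t
  have hI : Integrable (Function.uncurry fun x y => a x * (b y * F (t - x - y)))
      (volume.prod volume) := by
    have h0 := integrable_exp_neg_mul_abs (sub_pos.2 hν)
    refine ((h0.mul_prod h0).const_mul (A * B * M * Real.exp (ν * |t|))).mono'
      (Continuous.aestronglyMeasurable ?_) (Eventually.of_forall fun q => ?_)
    · unfold Function.uncurry
      fun_prop
    · obtain ⟨x, y⟩ := q
      have h1 := abs_mul_comp_sub_le hB hM (t - x) y
      -- The pointwise bound is used a second time, on the weight itself, which satisfies the growth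
      -- hypothesis with constant 1.
      have h2 : |a x * Real.exp (ν * |t - x|)| ≤
          A * 1 * Real.exp (ν * |t|) * Real.exp (-(p - |ν|) * |x|) :=
        abs_mul_comp_sub_le (F := fun t => Real.exp (ν * |t|)) hA
          (fun t => by rw [abs_of_pos (Real.exp_pos _), one_mul]) t x
      have hM0 : 0 ≤ M := by simpa using (abs_nonneg _).trans (hM 0)
      rw [abs_mul, abs_of_pos (Real.exp_pos _)] at h2
      simp only [Function.uncurry, Real.norm_eq_abs]
      rw [abs_mul]
      calc |a x| * |b y * F (t - x - y)|
          ≤ |a x| * (B * M * Real.exp (ν * |t - x|) * Real.exp (-(p - |ν|) * |y|)) := by gcongr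
        _ = (|a x| * Real.exp (ν * |t - x|)) * (B * M * Real.exp (-(p - |ν|) * |y|)) := by ring
        _ ≤ (A * 1 * Real.exp (ν * |t|) * Real.exp (-(p - |ν|) * |x|)) *
            (B * M * Real.exp (-(p - |ν|) * |y|)) := by gcongr
        _ = _ := by ring
  unfold conv
  simp only [← integral_const_mul]
  rw [integral_integral_swap hI]
  refine integral_congr_ae (Eventually.of_forall fun y => ?_)
  refine integral_congr_ae (Eventually.of_forall fun x => ?_)
  simp only
  rw [sub_right_comm]
  ring

theorem conv_conv_assoc (ha : Continuous a) (hb : Continuous b) (hF : Continuous F)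
    (hA : ∀ t, |a t| ≤ A * Real.exp (-p * |t|)) (hB : ∀ t, |b t| ≤ B * Real.exp (-p * |t|))
    (hM : ∀ t, |F t| ≤ M * Real.exp (ν * |t|)) (hν : |ν| < p) :
    conv a (conv b F) = conv (conv a b) F := by
  have hA0 : 0 ≤ A := by simpa using (abs_nonneg _).trans (hA 0)
  have hB0 : 0 ≤ B := by simpa using (abs_nonneg _).trans (hB 0)
  have hM0 : 0 ≤ M := by simpa using (abs_nonneg _).trans (hM 0)
  -- After the shift, b is evaluated at x - y and its decay must be split between both variables.
  -- The rate p' goes to x, leaving p' - |ν| > 0 there and p - p' > 0 in y.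
  obtain ⟨p', hp'1, hp'2⟩ := exists_between hν
  funext t
  have hI : Integrable (Function.uncurry fun y x => a y * (b (x - y) * F (t - x)))
      (volume.prod volume) := by
    have h0 := integrable_exp_neg_mul_abs (sub_pos.2 hp'2)
    have h1 := integrable_exp_neg_mul_abs (sub_pos.2 hp'1)
    refine ((h0.mul_prod h1).const_mul (A * B * M * Real.exp (ν * |t|))).mono'
      (Continuous.aestronglyMeasurable ?_) (Eventually.of_forall fun q => ?_)
    · unfold Function.uncurry
      fun_prop
    · obtain ⟨y, x⟩ := q
      have hp0 : 0 ≤ p' := (abs_nonneg ν).trans hp'1.le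
      have h2 : |b (x - y)| ≤ B * Real.exp (-p' * |x|) * Real.exp (p' * |y|) := by
        refine (hB _).trans ?_
        rw [mul_assoc, ← Real.exp_add]
        gcongr
        have h3 : |x| ≤ |x - y| + |y| := by simpa using abs_add_le (x - y) y
        nlinarith [abs_nonneg (x - y)]
      have h4 : |Real.exp (-p' * |x|) * F (t - x)| ≤
          1 * M * Real.exp (ν * |t|) * Real.exp (-(p' - |ν|) * |x|) :=
        abs_mul_comp_sub_le (a := fun x => Real.exp (-p' * |x|))
          (fun t => by rw [abs_of_pos (Real.exp_pos _), one_mul]) hM t x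
      rw [abs_mul, abs_of_pos (Real.exp_pos _)] at h4
      simp only [Function.uncurry, Real.norm_eq_abs, abs_mul]
      calc |a y| * (|b (x - y)| * |F (t - x)|)
          ≤ (A * Real.exp (-p * |y|)) *
            ((B * Real.exp (-p' * |x|) * Real.exp (p' * |y|)) * |F (t - x)|) := by
            gcongr
            exact hA y
        _ = A * B * (Real.exp (-p * |y|) * Real.exp (p' * |y|)) *
            (Real.exp (-p' * |x|) * |F (t - x)|) := by ring
        _ ≤ A * B * (Real.exp (-p * |y|) * Real.exp (p' * |y|)) *
            (1 * M * Real.exp (ν * |t|) * Real.exp (-(p' - |ν|) * |x|)) := by gcongr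
        _ = A * B * M * Real.exp (ν * |t|) *
            (Real.exp (-(p - p') * |y|) * Real.exp (-(p' - |ν|) * |x|)) := by
            rw [← Real.exp_add (-p * |y|), show -p * |y| + p' * |y| = -(p - p') * |y| by ring]
            ring
  unfold conv
  calc ∫ y, a y * ∫ x, b x * F (t - y - x)
      = ∫ y, ∫ x, a y * (b (x - y) * F (t - x)) := by
        refine integral_congr_ae (Eventually.of_forall fun y => ?_)
        simp only
        rw [integral_const_mul,
          ← integral_sub_right_eq_self (fun x => b x * F (t - y - x)) y]
        simp only [sub_sub, add_sub_cancel]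
    _ = ∫ x, ∫ y, a y * (b (x - y) * F (t - x)) := integral_integral_swap hI
    _ = _ := by
        refine integral_congr_ae (Eventually.of_forall fun x => ?_)
        simp only
        rw [← integral_mul_const]
        simp only [mul_assoc]

/-- Associativity together with θ * r = r - θ, the resolvent equation read backwards. Existence and
uniqueness for u = θ * u - F both reduce to this identity. -/
theorem conv_conv_resolvent {θ r : ℝ → ℝ} (hθ : Continuous θ) (hr : Continuous r)
    (hA : ∀ t, |θ t| ≤ A * Real.exp (-p * |t|)) (hB : ∀ t, |r t| ≤ B * Real.exp (-p * |t|))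
    (hres : ∀ t, r t = θ t + conv θ r t) (hF : Continuous F)
    (hM : ∀ t, |F t| ≤ M * Real.exp (ν * |t|)) (hν : |ν| < p) (t : ℝ) :
    conv θ (conv r F) t = conv r F t - conv θ F t := by
  rw [conv_conv_assoc hθ hr hF hA hB hM hν]
  have h2 : conv θ r = fun t => r t - θ t := funext fun t => by rw [hres t]; ring
  rw [h2]
  unfold conv
  rw [← integral_sub (integrable_mul_comp_sub hr hF hB hM hν t)
    (integrable_mul_comp_sub hθ hF hA hM hν t)]
  simp only [sub_mul]

/-- With a resolvent kernel `r` for `θ`, the function `-(F + r * F)` solves `u = θ * u - F`. -/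
theorem conv_resolvent_solves {θ r : ℝ → ℝ} (hθ : Continuous θ) (hr : Continuous r)
    (hA : ∀ t, |θ t| ≤ A * Real.exp (-p * |t|)) (hB : ∀ t, |r t| ≤ B * Real.exp (-p * |t|))
    (hres : ∀ t, r t = θ t + conv θ r t) (hF : Continuous F)
    (hM : ∀ t, |F t| ≤ M * Real.exp (ν * |t|)) (hν : |ν| < p) (t : ℝ) :
    conv θ (fun t => -(F t + conv r F t)) t = -conv r F t := by
  have h1 := conv_conv_resolvent hθ hr hA hB hres hF hM hν t
  have hc := abs_conv_le hB hM le_rfl hν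
  have h3 := integral_add (integrable_mul_comp_sub hθ hF hA hM hν t)
    (integrable_mul_comp_sub hθ (continuous_conv hr hF hB hM hν) hA hc hν t)
  have h4 : conv θ (fun t => -(F t + conv r F t)) t = -(conv θ F t + conv θ (conv r F) t) := by
    unfold conv at h3 ⊢
    rw [← h3, ← integral_neg]
    simp only [mul_add, mul_neg]
  rw [h4, h1]
  ring

/-- The equation `u = θ * u` has only the trivial solution of exponential growth below the rate of
decay of the resolvent kernel. -/
theorem eq_zero_of_conv_eq_self {θ r u : ℝ → ℝ} (hθ : Continuous θ) (hr : Continuous r)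
    (hA : ∀ t, |θ t| ≤ A * Real.exp (-p * |t|)) (hB : ∀ t, |r t| ≤ B * Real.exp (-p * |t|))
    (hres : ∀ t, r t = θ t + conv θ r t) (hu : Continuous u)
    (hM : ∀ t, |u t| ≤ M * Real.exp (ν * |t|)) (hν : |ν| < p)
    (heq : conv θ u = u) : u = 0 := by
  funext t
  have h1 := conv_conv_resolvent hθ hr hA hB hres hu hM hν t
  -- Now r * u = θ * (r * u) = r * u - θ * u = r * u - u.
  rw [conv_conv_comm hθ hr hu hA hB hM hν, heq] at h1
  simp only [Pi.zero_apply]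
  linarith

end Convolution

/-! ### The spaces C¹[-1,1] and 𝔻 -/

section C1Basics

open MeasureTheory Filter Topology

theorem neg_one_mem_I : (-1 : ℝ) ∈ Set.Icc (-1 : ℝ) 1 := by norm_num

theorem zero_mem_I : (0 : ℝ) ∈ Set.Icc (-1 : ℝ) 1 := by norm_num

theorem one_mem_I : (1 : ℝ) ∈ Set.Icc (-1 : ℝ) 1 := by norm_num

theorem ext_of_mem {Z : Type*} (f : I → Z) {s : ℝ} (hs : s ∈ Set.Icc (-1 : ℝ) 1) :
    ext f s = f ⟨s, hs⟩ := Set.IccExtend_of_mem _ f hs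

theorem continuous_ext {Z : Type*} [TopologicalSpace Z] (f : C(I, Z)) : Continuous (ext f) :=
  f.continuous.Icc_extend'

theorem norm_ext_le {𝕜 : Type*} [RCLike 𝕜] (f : C(I, 𝕜)) (s : ℝ) : ‖ext f s‖ ≤ ‖f‖ :=
  f.norm_coe_le_norm _

section

variable {𝕜 : Type*} [RCLike 𝕜]

/-- The restriction to `[-1,1]` of a `C¹` function on the line. -/
def mkC1 (w w' : ℝ → 𝕜) (hw : ∀ s, HasDerivAt w (w' s) s) (hw' : Continuous w') : C1 𝕜 :=
  ⟨(⟨fun s : I => w s, by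
      have : Continuous w := continuous_iff_continuousAt.2 fun s => (hw s).continuousAt
      fun_prop⟩, ⟨fun s : I => w' s, by fun_prop⟩), fun s => by
    refine (hw s).hasDerivWithinAt.congr (fun x hx => ?_) ?_
    · exact ext_of_mem _ hx
    · exact ext_of_mem _ s.2⟩

variable {w w' : ℝ → 𝕜} (hw : ∀ s, HasDerivAt w (w' s) s) (hw' : Continuous w')

theorem toC0_mkC1 (s : I) : toC0 (mkC1 w w' hw hw') s = w s := rfl

theorem derivC1_mkC1 (s : I) : derivC1 (mkC1 w w' hw hw') s = w' s := rfl

theorem evalC1_mkC1 {s : ℝ} (hs : s ∈ Set.Icc (-1 : ℝ) 1) :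
    evalC1 (mkC1 w w' hw hw') s = w s := ext_of_mem _ hs

/-- One-sided derivatives on a nondegenerate interval are unique, so the stored derivative carries
no extra information. -/
theorem C1_ext {W Z : C1 𝕜} (h : ∀ s : I, toC0 W s = toC0 Z s) : W = Z := by
  refine Subtype.ext (Prod.ext (ContinuousMap.ext h) (ContinuousMap.ext fun s => ?_))
  have h0 : toC0 W = toC0 Z := ContinuousMap.ext h
  have h1 : HasDerivWithinAt (ext (toC0 W)) (W.1.2 s) (Set.Icc (-1 : ℝ) 1) s := W.2 s
  have h2 : HasDerivWithinAt (ext (toC0 Z)) (Z.1.2 s) (Set.Icc (-1 : ℝ) 1) s := Z.2 s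
  rw [h0] at h1
  exact (uniqueDiffOn_Icc (by norm_num : (-1 : ℝ) < 1) s s.2).eq_deriv _ h1 h2

/-- The element `(u, v, W)` of `𝔻`. -/
def mkDD (u v : 𝕜) (W : C1 𝕜) (h : evalC1 W 0 = u) : DD 𝕜 := ⟨(u, v, W), h⟩

theorem incl_mkDD (u v : 𝕜) (W : C1 𝕜) (h : evalC1 W 0 = u) :
    incl 𝕜 (mkDD u v W h) = (u, v, toC0 W) := rfl

theorem DD_evalC1_zero (U : DD 𝕜) : evalC1 U.1.2.2 0 = U.1.1 := U.2

theorem incl_injective : Function.Injective (incl 𝕜) := by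
  intro U V h
  have h1 : U.1.1 = V.1.1 := congrArg (fun x : HH 𝕜 => x.1) h
  have h2 : U.1.2.1 = V.1.2.1 := congrArg (fun x : HH 𝕜 => x.2.1) h
  have h3 : toC0 U.1.2.2 = toC0 V.1.2.2 := congrArg (fun x : HH 𝕜 => x.2.2) h
  exact Subtype.ext (Prod.ext h1 (Prod.ext h2 (C1_ext fun s => by rw [h3])))

end

/-- The derivative of `W ∈ C¹[-1,1]` as a function on the line (constant outside `[-1,1]`). -/
noncomputable def evalD (W : C1 ℝ) : ℝ → ℝ := ext (derivC1 W)

theorem continuous_evalD (W : C1 ℝ) : Continuous (evalD W) := continuous_ext _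

/-- The extension of `W ∈ C¹[-1,1]` to a `C¹` function on the line with derivative `evalD W`. -/
noncomputable def extC1 (W : C1 ℝ) (s : ℝ) : ℝ := evalC1 W 0 + ∫ r in (0 : ℝ)..s, evalD W r

theorem hasDerivAt_extC1 (W : C1 ℝ) (s : ℝ) : HasDerivAt (extC1 W) (evalD W s) s :=
  (((continuous_evalD W).integral_hasStrictDerivAt 0 s).hasDerivAt).const_add _

/-- The difference is continuous with zero right derivative. Since `evalC1` need not be
differentiable at ±1, calculus is done with `extC1` and transferred back by this identity. -/
theorem extC1_eq (W : C1 ℝ) {s : ℝ} (hs : s ∈ Set.Icc (-1 : ℝ) 1) : extC1 W s = evalC1 W s := by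
  have h : ∀ x ∈ Set.Icc (-1 : ℝ) 1,
      (extC1 W - evalC1 W) x = (extC1 W - evalC1 W) (-1) := by
    refine constant_of_has_deriv_right_zero ?_ fun x hx => ?_
    · refine ContinuousOn.sub (fun x _ => ?_) (evalC1_continuous W).continuousOn
      exact (hasDerivAt_extC1 W x).continuousAt.continuousWithinAt
    · have hx' : x ∈ Set.Icc (-1 : ℝ) 1 := ⟨hx.1, hx.2.le⟩
      have h1 : HasDerivWithinAt (evalC1 W) (evalD W x) (Set.Icc (-1 : ℝ) 1) x := by
        have := W.2 ⟨x, hx'⟩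
        rw [evalD, ext_of_mem _ hx']
        exact this
      have h2 := ((hasDerivAt_extC1 W x).hasDerivWithinAt (s := Set.Icc (-1 : ℝ) 1)).sub h1
      rw [sub_self] at h2
      exact h2.mono_of_mem_nhdsWithin (Icc_mem_nhdsGE_of_mem hx)
  have h0 := h 0 zero_mem_I
  have h1 := h s hs
  rw [← h0] at h1
  simp only [Pi.sub_apply] at h1
  have h2 : extC1 W 0 = evalC1 W 0 := by simp [extC1]
  rw [h2, sub_self] at h1
  linarith

end C1Basics

/-! ### The functionals that define the centre projection -/

section Functionals

open MeasureTheory Filter Topology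

variable (γ τ k₀ : ℝ)

theorem abs_intervalIntegral_kernel_le {c f : ℝ → ℝ} (hc : ∀ s, |c s| ≤ 1) {M : ℝ}
    (hf : ∀ s, |f s| ≤ M) : |∫ s in (0 : ℝ)..1, c s * f s| ≤ M := by
  have := intervalIntegral.norm_integral_le_of_norm_le_const (a := (0 : ℝ)) (b := 1)
    (f := fun s => c s * f s) (C := M) fun s _ => by
      rw [Real.norm_eq_abs, abs_mul]
      calc |c s| * |f s| ≤ 1 * M := mul_le_mul (hc s) (hf s) (abs_nonneg _) zero_le_one
        _ = M := one_mul _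
  simpa using this

/-- `W ↦ γτ² ∫_0^1 sin(k₀(1-s)) (W(s) + W(-s)) ds` as a bounded functional on `C[-1,1]`. -/
noncomputable def sinF : C(I, ℝ) →L[ℝ] ℝ :=
  LinearMap.mkContinuous
    { toFun := fun W => γ * τ ^ 2 *
        ∫ s in (0 : ℝ)..1, Real.sin (k₀ * (1 - s)) * (ext W s + ext W (-s))
      map_add' := fun W Z => by
        have hW := continuous_ext W
        have hZ := continuous_ext Z
        rw [← mul_add, ← intervalIntegral.integral_add
          (Continuous.intervalIntegrable (by fun_prop) _ _)
          (Continuous.intervalIntegrable (by fun_prop) _ _)]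
        congr 2
        funext s
        change _ * ((ext W s + ext Z s) + (ext W (-s) + ext Z (-s))) = _
        ring
      map_smul' := fun a W => by
        simp only [RingHom.id_apply, smul_eq_mul]
        rw [mul_left_comm a, ← intervalIntegral.integral_const_mul a]
        congr 2
        funext s
        change _ * (a * ext W s + a * ext W (-s)) = _
        ring }
    (|γ * τ ^ 2| * 2) fun W => by
      simp only [LinearMap.coe_mk, AddHom.coe_mk, Real.norm_eq_abs]
      rw [abs_mul, mul_assoc]
      refine mul_le_mul_of_nonneg_left ?_ (abs_nonneg _)
      refine abs_intervalIntegral_kernel_le (c := fun s => Real.sin (k₀ * (1 - s)))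
        (fun s => Real.abs_sin_le_one _) fun s => ?_
      have h1 := norm_ext_le W s
      have h2 := norm_ext_le W (-s)
      rw [Real.norm_eq_abs] at h1 h2
      exact (abs_add_le _ _).trans (by linarith)

/-- `W ↦ γτ² ∫_0^1 cos(k₀(1-s)) (W(s) - W(-s)) ds` as a bounded functional on `C[-1,1]`. -/
noncomputable def cosF : C(I, ℝ) →L[ℝ] ℝ :=
  LinearMap.mkContinuous
    { toFun := fun W => γ * τ ^ 2 *
        ∫ s in (0 : ℝ)..1, Real.cos (k₀ * (1 - s)) * (ext W s - ext W (-s))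
      map_add' := fun W Z => by
        have hW := continuous_ext W
        have hZ := continuous_ext Z
        rw [← mul_add, ← intervalIntegral.integral_add
          (Continuous.intervalIntegrable (by fun_prop) _ _)
          (Continuous.intervalIntegrable (by fun_prop) _ _)]
        congr 2
        funext s
        change _ * ((ext W s + ext Z s) - (ext W (-s) + ext Z (-s))) = _
        ring
      map_smul' := fun a W => by
        simp only [RingHom.id_apply, smul_eq_mul]
        rw [mul_left_comm a, ← intervalIntegral.integral_const_mul a]
        congr 2
        funext s
        change _ * (a * ext W s - a * ext W (-s)) = _
        ring }
    (|γ * τ ^ 2| * 2) fun W => by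
      simp only [LinearMap.coe_mk, AddHom.coe_mk, Real.norm_eq_abs]
      rw [abs_mul, mul_assoc]
      refine mul_le_mul_of_nonneg_left ?_ (abs_nonneg _)
      refine abs_intervalIntegral_kernel_le (c := fun s => Real.cos (k₀ * (1 - s)))
        (fun s => Real.abs_cos_le_one _) fun s => ?_
      have h1 := norm_ext_le W s
      have h2 := norm_ext_le W (-s)
      rw [Real.norm_eq_abs] at h1 h2
      exact (abs_sub _ _).trans (by linarith)

theorem abs_sinF_le (W : C(I, ℝ)) : |sinF γ τ k₀ W| ≤ |γ * τ ^ 2| * 2 * ‖W‖ :=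
  (sinF γ τ k₀).le_of_opNorm_le (LinearMap.mkContinuous_norm_le _ (by positivity) _) W

theorem abs_cosF_le (W : C(I, ℝ)) : |cosF γ τ k₀ W| ≤ |γ * τ ^ 2| * 2 * ‖W‖ :=
  (cosF γ τ k₀).le_of_opNorm_le (LinearMap.mkContinuous_norm_le _ (by positivity) _) W

theorem sinF_apply (W : C(I, ℝ)) : sinF γ τ k₀ W = γ * τ ^ 2 *
    ∫ s in (0 : ℝ)..1, Real.sin (k₀ * (1 - s)) * (ext W s + ext W (-s)) := rfl

theorem cosF_apply (W : C(I, ℝ)) : cosF γ τ k₀ W = γ * τ ^ 2 *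
    ∫ s in (0 : ℝ)..1, Real.cos (k₀ * (1 - s)) * (ext W s - ext W (-s)) := rfl

theorem mem_I_of_mem_uIcc {s : ℝ} (hs : s ∈ Set.uIcc (0 : ℝ) 1) :
    s ∈ Set.Icc (-1 : ℝ) 1 ∧ -s ∈ Set.Icc (-1 : ℝ) 1 := by
  rw [Set.uIcc_of_le zero_le_one] at hs
  constructor <;> constructor <;> linarith [hs.1, hs.2]

theorem sinF_congr {W : C(I, ℝ)} {w : ℝ → ℝ} (h : ∀ s : I, W s = w s) :
    sinF γ τ k₀ W = γ * τ ^ 2 *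
      ∫ s in (0 : ℝ)..1, Real.sin (k₀ * (1 - s)) * (w s + w (-s)) := by
  rw [sinF_apply]
  congr 1
  refine intervalIntegral.integral_congr fun s hs => ?_
  obtain ⟨h1, h2⟩ := mem_I_of_mem_uIcc hs
  simp only [ext_of_mem _ h1, ext_of_mem _ h2, h]

theorem cosF_congr {W : C(I, ℝ)} {w : ℝ → ℝ} (h : ∀ s : I, W s = w s) :
    cosF γ τ k₀ W = γ * τ ^ 2 *
      ∫ s in (0 : ℝ)..1, Real.cos (k₀ * (1 - s)) * (w s - w (-s)) := by
  rw [cosF_apply]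
  congr 1
  refine intervalIntegral.integral_congr fun s hs => ?_
  obtain ⟨h1, h2⟩ := mem_I_of_mem_uIcc hs
  simp only [ext_of_mem _ h1, ext_of_mem _ h2, h]

theorem toC0_eq_extC1 (W : C1 ℝ) (s : I) : toC0 W s = extC1 W s := by
  rw [extC1_eq W s.2]
  exact (ext_of_mem _ s.2).symm

theorem derivC1_eq_evalD (W : C1 ℝ) (s : I) : derivC1 W s = evalD W s :=
  (ext_of_mem _ s.2).symm

/-- Integration by parts. The boundary terms vanish: the sine at s = 1, and W(s) - W(-s) at s = 0.
-/
theorem sinF_derivC1 (W : C1 ℝ) :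
    sinF γ τ k₀ (derivC1 W) = k₀ * cosF γ τ k₀ (toC0 W) := by
  rw [sinF_congr γ τ k₀ (derivC1_eq_evalD W), cosF_congr γ τ k₀ (toC0_eq_extC1 W)]
  have hW := continuous_evalD W
  have hX : Continuous (extC1 W) :=
    continuous_iff_continuousAt.2 fun s => (hasDerivAt_extC1 W s).continuousAt
  have h := intervalIntegral.integral_eq_sub_of_hasDerivAt (a := (0 : ℝ)) (b := 1)
    (f := fun s => Real.sin (k₀ * (1 - s)) * (extC1 W s - extC1 W (-s)))
    (f' := fun s => Real.sin (k₀ * (1 - s)) * (evalD W s + evalD W (-s))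
      - k₀ * (Real.cos (k₀ * (1 - s)) * (extC1 W s - extC1 W (-s)))) (fun s _ => by
        have h1 : HasDerivAt (fun s : ℝ => k₀ * (1 - s)) (-k₀) s := by
          simpa using ((hasDerivAt_id s).const_sub 1).const_mul k₀
        have h2 : HasDerivAt (fun s => extC1 W (-s)) (-evalD W (-s)) s := by
          exact ((hasDerivAt_extC1 W (-s)).comp s (hasDerivAt_neg s)).congr_deriv (by ring)
        refine (h1.sin.mul ((hasDerivAt_extC1 W s).sub h2)).congr_deriv ?_
        simp only [Pi.sub_apply]
        ring) (Continuous.intervalIntegrable (by fun_prop) _ _)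
  rw [intervalIntegral.integral_sub (Continuous.intervalIntegrable (by fun_prop) _ _)
    (Continuous.intervalIntegrable (by fun_prop) _ _), intervalIntegral.integral_const_mul] at h
  simp only [sub_self, mul_zero, Real.sin_zero, zero_mul, neg_zero] at h
  linear_combination (γ * τ ^ 2) * h

/-- Integration by parts. The boundary term at s = 1 is exactly the coupling W(1) + W(-1) of L; the
one at s = 0 is combined later with the relation between τ²(1+2γ) and k₀. -/
theorem cosF_derivC1 (W : C1 ℝ) :
    cosF γ τ k₀ (derivC1 W) = γ * τ ^ 2 * (evalC1 W 1 + evalC1 W (-1))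
      - 2 * (γ * τ ^ 2) * Real.cos k₀ * evalC1 W 0 - k₀ * sinF γ τ k₀ (toC0 W) := by
  rw [cosF_congr γ τ k₀ (derivC1_eq_evalD W), sinF_congr γ τ k₀ (toC0_eq_extC1 W)]
  have hW := continuous_evalD W
  have hX : Continuous (extC1 W) :=
    continuous_iff_continuousAt.2 fun s => (hasDerivAt_extC1 W s).continuousAt
  have h := intervalIntegral.integral_eq_sub_of_hasDerivAt (a := (0 : ℝ)) (b := 1)
    (f := fun s => Real.cos (k₀ * (1 - s)) * (extC1 W s + extC1 W (-s)))
    (f' := fun s => Real.cos (k₀ * (1 - s)) * (evalD W s - evalD W (-s))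
      + k₀ * (Real.sin (k₀ * (1 - s)) * (extC1 W s + extC1 W (-s)))) (fun s _ => by
        have h1 : HasDerivAt (fun s : ℝ => k₀ * (1 - s)) (-k₀) s := by
          simpa using ((hasDerivAt_id s).const_sub 1).const_mul k₀
        have h2 : HasDerivAt (fun s => extC1 W (-s)) (-evalD W (-s)) s := by
          exact ((hasDerivAt_extC1 W (-s)).comp s (hasDerivAt_neg s)).congr_deriv (by ring)
        refine (h1.cos.mul ((hasDerivAt_extC1 W s).add h2)).congr_deriv ?_
        simp only [Pi.add_apply]
        ring) (Continuous.intervalIntegrable (by fun_prop) _ _)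
  rw [intervalIntegral.integral_add (Continuous.intervalIntegrable (by fun_prop) _ _)
    (Continuous.intervalIntegrable (by fun_prop) _ _), intervalIntegral.integral_const_mul,
    extC1_eq W one_mem_I, extC1_eq W neg_one_mem_I] at h
  simp only [sub_self, mul_zero, Real.cos_zero, one_mul, neg_zero, sub_zero, mul_one,
    extC1_eq W zero_mem_I] at h
  linear_combination (γ * τ ^ 2) * h

/-- The mean values that determine the spectral projection on the centre modes. -/
theorem integral_sin_mul_cos (hk : k₀ ≠ 0) :
    ∫ s in (0 : ℝ)..1, Real.sin (k₀ * (1 - s)) * (2 * Real.cos (k₀ * s)) = Real.sin k₀ := by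
  -- The primitive comes from 2 sin(k₀(1-s)) cos(k₀s) = sin k₀ + sin(k₀(1-2s)).
  have h := intervalIntegral.integral_eq_sub_of_hasDerivAt (a := (0 : ℝ)) (b := 1)
    (f := fun s => s * Real.sin k₀ + Real.cos (k₀ * (1 - 2 * s)) / (2 * k₀))
    (f' := fun s => Real.sin (k₀ * (1 - s)) * (2 * Real.cos (k₀ * s))) (fun s _ => by
        have h1 : HasDerivAt (fun s : ℝ => k₀ * (1 - 2 * s)) (-2 * k₀) s := by
          exact ((((hasDerivAt_id s).const_mul 2).const_sub 1).const_mul k₀).congr_deriv (by ring)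
        refine (((hasDerivAt_id s).mul_const (Real.sin k₀)).add
          (h1.cos.div_const (2 * k₀))).congr_deriv ?_
        have e1 : k₀ * (1 - 2 * s) = k₀ * (1 - s) - k₀ * s := by ring
        have e2 : Real.sin k₀ = Real.sin (k₀ * (1 - s) + k₀ * s) := by congr 1; ring
        rw [e2, e1, Real.sin_add, Real.sin_sub]
        field_simp
        ring) (Continuous.intervalIntegrable (by fun_prop) _ _)
  rw [h]
  have e1 : k₀ * (1 - 2 * 1) = -k₀ := by ring
  rw [e1, Real.cos_neg]
  simp

end Functionals

/-! ### Eigenvectors, the characteristic function and simplicity -/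

section Characteristic

open MeasureTheory Filter Topology

variable (γ τ : ℝ)

/-- The characteristic function of `L_{γ,τ}`, whose zeros are the eigenvalues. -/
noncomputable def charFn (z : ℂ) : ℂ :=
  z ^ 2 + ((τ ^ 2 * (1 + 2 * γ) : ℝ) : ℂ) - 2 * ((γ * τ ^ 2 : ℝ) : ℂ) * Complex.cosh z

theorem hasDerivAt_cexp_mul_ofReal (z : ℂ) (s : ℝ) :
    HasDerivAt (fun s : ℝ => Complex.exp (z * s)) (z * Complex.exp (z * s)) s := by
  have h : HasDerivAt (fun s : ℝ => z * (s : ℂ)) z s := by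
    simpa using (Complex.ofRealCLM.hasDerivAt (x := s)).const_mul z
  exact h.cexp.congr_deriv (by ring)

/-- The function `s ↦ e^{zs}` in `C¹[-1,1]`. -/
noncomputable def expC1 (z : ℂ) : C1 ℂ :=
  mkC1 (fun s => Complex.exp (z * s)) (fun s => z * Complex.exp (z * s))
    (hasDerivAt_cexp_mul_ofReal z) (by fun_prop)

theorem hasDerivAt_ofReal_mul_cexp (z : ℂ) (s : ℝ) :
    HasDerivAt (fun s : ℝ => (s : ℂ) * Complex.exp (z * s))
      (Complex.exp (z * s) + s * (z * Complex.exp (z * s))) s := by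
  have h := (Complex.ofRealCLM.hasDerivAt (x := s)).mul (hasDerivAt_cexp_mul_ofReal z s)
  exact h.congr_deriv (by simp)

/-- The function `s ↦ s e^{zs}` in `C¹[-1,1]`. -/
noncomputable def mulExpC1 (z : ℂ) : C1 ℂ :=
  mkC1 (fun s => s * Complex.exp (z * s))
    (fun s => Complex.exp (z * s) + s * (z * Complex.exp (z * s)))
    (hasDerivAt_ofReal_mul_cexp z) (by fun_prop)

/-- The eigenvector `(1, z, e^{zs})`. -/
noncomputable def eigvec (z : ℂ) : DD ℂ :=
  mkDD 1 z (expC1 z) (by rw [expC1, evalC1_mkC1 _ _ zero_mem_I]; simp)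

/-- The derivative `(0, 1, s e^{zs})` of the eigenvector in the spectral parameter. -/
noncomputable def genvec (z : ℂ) : DD ℂ :=
  mkDD 0 1 (mulExpC1 z) (by rw [mulExpC1, evalC1_mkC1 _ _ zero_mem_I]; simp)

theorem shifted_apply (z : ℂ) (U : DD ℂ) :
    shifted γ τ z U = LL ℂ γ τ U - z • incl ℂ U := rfl

theorem LL_mkDD_complex (u v : ℂ) (W : C1 ℂ) (h : evalC1 W 0 = u) :
    LL ℂ γ τ (mkDD u v W h) = (v, -((τ ^ 2 * (1 + 2 * γ) : ℝ) : ℂ) * u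
      + ((γ * τ ^ 2 : ℝ) : ℂ) * (evalC1 W 1 + evalC1 W (-1)), derivC1 W) := rfl

theorem shifted_eigvec (z : ℂ) : shifted γ τ z (eigvec z) = (0, -charFn γ τ z, 0) := by
  rw [shifted_apply, eigvec, LL_mkDD_complex, incl_mkDD]
  refine Prod.ext ?_ (Prod.ext ?_ ?_)
  · simp
  · simp only [Prod.snd_sub, Prod.fst_sub, Prod.smul_snd, Prod.smul_fst, smul_eq_mul]
    rw [expC1, evalC1_mkC1 _ _ one_mem_I, evalC1_mkC1 _ _ neg_one_mem_I, charFn, Complex.cosh]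
    push_cast
    simp only [mul_one, mul_neg]
    ring
  · ext s
    simp only [Prod.snd_sub, Prod.smul_snd, ContinuousMap.sub_apply, ContinuousMap.smul_apply,
      expC1, derivC1_mkC1, toC0_mkC1]
    simp

/-- This is the z-derivative of (L - z) e(z) = (0, -χ(z), 0), namely (L - z) e'(z) = e(z) + (0,
-χ'(z), 0). -/
theorem shifted_genvec (z : ℂ) : shifted γ τ z (genvec z) =
    (1, 2 * ((γ * τ ^ 2 : ℝ) : ℂ) * Complex.sinh z - z, toC0 (expC1 z)) := by
  rw [shifted_apply, genvec, LL_mkDD_complex, incl_mkDD]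
  refine Prod.ext ?_ (Prod.ext ?_ ?_)
  · simp
  · simp only [Prod.snd_sub, Prod.fst_sub, Prod.smul_snd, Prod.smul_fst, smul_eq_mul]
    rw [mulExpC1, evalC1_mkC1 _ _ one_mem_I, evalC1_mkC1 _ _ neg_one_mem_I, Complex.sinh]
    push_cast
    simp only [mul_one, mul_neg]
    ring
  · ext s
    simp only [Prod.snd_sub, Prod.smul_snd, ContinuousMap.sub_apply, ContinuousMap.smul_apply,
      expC1, mulExpC1, derivC1_mkC1, toC0_mkC1, smul_eq_mul]
    ring

theorem evalC1_eq_exp_of_derivC1_eq {z : ℂ} {W : C1 ℂ} (h : derivC1 W = z • toC0 W) {s : ℝ}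
    (hs : s ∈ Set.Icc (-1 : ℝ) 1) : evalC1 W s = evalC1 W 0 * Complex.exp (z * s) := by
  have hc : ∀ x ∈ Set.Icc (-1 : ℝ) 1, (fun x : ℝ => evalC1 W x * Complex.exp (-z * x)) x =
      (fun x : ℝ => evalC1 W x * Complex.exp (-z * x)) (-1) := by
    refine constant_of_has_deriv_right_zero ?_ fun x hx => ?_
    · have : Continuous (evalC1 W) := continuous_ext (toC0 W)
      exact Continuous.continuousOn (by fun_prop)
    · have hx' : x ∈ Set.Icc (-1 : ℝ) 1 := ⟨hx.1, hx.2.le⟩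
      have h1 : HasDerivWithinAt (evalC1 W) (z * evalC1 W x) (Set.Icc (-1 : ℝ) 1) x := by
        have h2 : HasDerivWithinAt (evalC1 W) (derivC1 W ⟨x, hx'⟩) (Set.Icc (-1 : ℝ) 1) x :=
          W.2 ⟨x, hx'⟩
        rw [h] at h2
        rw [evalC1, ext_of_mem _ hx']
        exact h2
      have h3 := h1.mul (hasDerivAt_cexp_mul_ofReal (-z) x).hasDerivWithinAt
      refine (h3.congr_deriv ?_).mono_of_mem_nhdsWithin (Icc_mem_nhdsGE_of_mem hx)
      ring
  have h0 := hc 0 zero_mem_I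
  have h1 := hc s hs
  rw [← h0] at h1
  simp only [Complex.ofReal_zero, mul_zero, Complex.exp_zero, mul_one] at h1
  rw [← h1, mul_assoc, ← Complex.exp_add]
  simp

/-- The third component solves W' = zW, hence is an exponential with W(0) = u; the first component
gives v = zu. -/
theorem eq_smul_eigvec_of_shifted_eq_zero {z : ℂ} {U : DD ℂ} (h : shifted γ τ z U = 0) :
    U = U.1.1 • eigvec z := by
  rw [shifted_apply, sub_eq_zero] at h
  have h1 : U.1.2.1 = z * U.1.1 := congrArg (fun x : HH ℂ => x.1) h
  have h2 : derivC1 U.1.2.2 = z • toC0 U.1.2.2 := congrArg (fun x : HH ℂ => x.2.2) h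
  refine Subtype.ext (Prod.ext ?_ (Prod.ext ?_ (C1_ext fun s => ?_)))
  · exact (mul_one _).symm
  · exact h1.trans (mul_comm _ _)
  · have h3 := evalC1_eq_exp_of_derivC1_eq h2 s.2
    rw [DD_evalC1_zero, evalC1, ext_of_mem _ s.2] at h3
    exact h3

theorem charFn_mul_eq_zero_of_shifted_eq_zero {z : ℂ} {U : DD ℂ} (h : shifted γ τ z U = 0) :
    charFn γ τ z * U.1.1 = 0 := by
  rw [eq_smul_eigvec_of_shifted_eq_zero γ τ h, map_smul, shifted_eigvec] at h
  have h1 : U.1.1 * -charFn γ τ z = 0 := congrArg (fun x : HH ℂ => x.2.1) h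
  linear_combination -h1

theorem mem_spec_of_charFn_eq_zero {z : ℂ} (h : charFn γ τ z = 0) : z ∈ spec γ τ := by
  rintro ⟨e, he⟩
  have h1 : shifted γ τ z (eigvec z) = 0 := by
    rw [shifted_eigvec, h, neg_zero]
    rfl
  rw [← he] at h1
  have h2 : eigvec z = 0 := e.injective (h1.trans (map_zero e).symm)
  have h3 : (1 : ℂ) = 0 := congrArg (fun U : DD ℂ => U.1.1) h2
  exact one_ne_zero h3

/-- An eigenvector is a multiple of `eigvec z`. A nonzero one has nonzero first entry, and the
second component of the eigenvalue equation then forces χ(z) = 0. -/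
theorem charFn_eq_zero_of_finrank {z : ℂ} (h : Module.finrank ℂ (eigenspace γ τ z) = 1) :
    charFn γ τ z = 0 := by
  have hne : eigenspace γ τ z ≠ ⊥ := by
    intro hb
    rw [hb, finrank_bot] at h
    exact zero_ne_one h
  obtain ⟨X, ⟨U, hU, rfl⟩, hX⟩ := Submodule.exists_mem_ne_zero_of_ne_bot hne
  have hU' : shifted γ τ z U = 0 := hU
  rcases mul_eq_zero.1 (charFn_mul_eq_zero_of_shifted_eq_zero γ τ hU') with h1 | h1
  · exact h1
  · refine absurd ?_ hX
    rw [eq_smul_eigvec_of_shifted_eq_zero γ τ hU', h1, zero_smul, map_zero]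

theorem mem_eigenspace_iff {z : ℂ} (h : charFn γ τ z = 0) {X : HH ℂ} :
    X ∈ eigenspace γ τ z ↔ ∃ c : ℂ, X = c • incl ℂ (eigvec z) := by
  constructor
  · rintro ⟨U, hU, rfl⟩
    refine ⟨U.1.1, ?_⟩
    have hU' : shifted γ τ z U = 0 := hU
    conv_lhs => rw [eq_smul_eigvec_of_shifted_eq_zero γ τ hU']
    exact map_smul _ _ _
  · rintro ⟨c, rfl⟩
    refine ⟨c • eigvec z, ?_, map_smul _ _ _⟩
    have h1 : shifted γ τ z (c • eigvec z) = 0 := by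
      rw [map_smul, shifted_eigvec, h, neg_zero]
      exact smul_zero (A := HH ℂ) c
    exact h1

variable {γ τ} {k₀ : ℝ}

theorem InDelta0.charFn_eq_zero (h : InDelta0 γ τ k₀) : charFn γ τ (Complex.I * k₀) = 0 :=
  charFn_eq_zero_of_finrank γ τ h.simple_pos.1

theorem InDelta0.charFn_neg_eq_zero (h : InDelta0 γ τ k₀) :
    charFn γ τ (-(Complex.I * k₀)) = 0 :=
  charFn_eq_zero_of_finrank γ τ h.simple_neg.1

/-- This is χ(ik₀) = 0 in real form. It eliminates τ²(1+2γ) wherever L meets the functionals. -/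
theorem InDelta0.relation (h : InDelta0 γ τ k₀) :
    τ ^ 2 * (1 + 2 * γ) = k₀ ^ 2 + 2 * (γ * τ ^ 2) * Real.cos k₀ := by
  have h1 := h.charFn_eq_zero
  rw [charFn, mul_comm Complex.I, Complex.cosh_mul_I, mul_pow, Complex.I_sq,
    ← Complex.ofReal_cos] at h1
  have h2 : (((τ ^ 2 * (1 + 2 * γ) : ℝ)) : ℂ) =
      ((k₀ ^ 2 + 2 * (γ * τ ^ 2) * Real.cos k₀ : ℝ) : ℂ) := by
    push_cast at h1 ⊢
    linear_combination h1
  exact_mod_cast h2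

/-- The quantity is χ'(ik₀)/(2i). If it vanished, `genvec` would be a generalised eigenvector above
`eigvec`, against algebraic simplicity. -/
theorem InDelta0.sub_ne_zero (h : InDelta0 γ τ k₀) : k₀ - γ * τ ^ 2 * Real.sin k₀ ≠ 0 := by
  intro h0
  set z : ℂ := Complex.I * k₀ with hz
  have h1 : shifted γ τ z (genvec z) = incl ℂ (eigvec z) := by
    rw [shifted_genvec, eigvec, incl_mkDD]
    refine Prod.ext rfl (Prod.ext ?_ rfl)
    simp only
    rw [hz, mul_comm Complex.I, Complex.sinh_mul_I, ← Complex.ofReal_sin]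
    have h2 : (γ * τ ^ 2 * Real.sin k₀ : ℝ) = k₀ := by linarith
    have h3 : ((γ * τ ^ 2 : ℝ) : ℂ) * (Real.sin k₀ : ℂ) = (k₀ : ℂ) := by exact_mod_cast h2
    linear_combination 2 * Complex.I * h3
  have h2 : shifted γ τ z (eigvec z) = 0 := by
    rw [shifted_eigvec, h.charFn_eq_zero, neg_zero]
    rfl
  have h3 := h.simple_pos.2 _ _ h1 h2
  rw [h1] at h3
  have h4 : (1 : ℂ) = 0 := congrArg (fun U : HH ℂ => U.1) h3
  exact one_ne_zero h4

theorem InDelta0.eq_of_charFn_eq_zero (h : InDelta0 γ τ k₀) {z : ℂ} (hz : charFn γ τ z = 0)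
    (hre : z.re = 0) : z = Complex.I * k₀ ∨ z = -(Complex.I * k₀) := by
  have h1 : z ∈ spec γ τ ∩ {z | z.re = 0} := ⟨mem_spec_of_charFn_eq_zero γ τ hz, hre⟩
  rw [h.spec_eq] at h1
  simpa using h1

end Characteristic

/-! ### The convolution kernel, its transform, and the strip where the transform avoids 1 -/

section Kernel

open MeasureTheory Filter Topology

variable (γ τ k₀ : ℝ)

/-- The convolution kernel `(γτ²/k₀) sin(k₀(1-|s|))` on `[-1,1]`, zero elsewhere. -/
noncomputable def kern (s : ℝ) : ℝ := γ * τ ^ 2 / k₀ * Real.sin (k₀ * max 0 (1 - |s|))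

theorem continuous_kern : Continuous (kern γ τ k₀) := by
  unfold kern
  fun_prop

theorem kern_eq_zero {s : ℝ} (hs : 1 ≤ |s|) : kern γ τ k₀ s = 0 := by
  rw [kern, max_eq_left (by linarith)]
  simp

theorem kern_eq {s : ℝ} (hs : |s| ≤ 1) :
    kern γ τ k₀ s = γ * τ ^ 2 / k₀ * Real.sin (k₀ * (1 - |s|)) := by
  rw [kern, max_eq_right (by linarith)]

/-- Folding the negative half of the support onto [0,1]. Vector values serve both real convolutions
and the complex Laplace transform. -/
theorem integral_kern_smul {E : Type*} [NormedAddCommGroup E] [NormedSpace ℝ E] {f : ℝ → E}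
    (hf : Continuous f) : ∫ s, kern γ τ k₀ s • f s =
      (γ * τ ^ 2 / k₀) • ∫ s in (0 : ℝ)..1, Real.sin (k₀ * (1 - s)) • (f s + f (-s)) := by
  have hk := continuous_kern γ τ k₀
  have hsupp : Function.support (fun s => kern γ τ k₀ s • f s) ⊆ Set.Ioc (-1) 1 := by
    intro s hs
    by_contra hcon
    refine hs ?_
    have : 1 ≤ |s| := by
      by_contra h1
      have := abs_lt.1 (not_le.1 h1)
      exact hcon ⟨this.1, this.2.le⟩
    simp [kern_eq_zero γ τ k₀ this]
  rw [← intervalIntegral.integral_eq_integral_of_support_subset hsupp,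
    ← intervalIntegral.integral_add_adjacent_intervals (b := 0)
      (Continuous.intervalIntegrable (by fun_prop) _ _)
      (Continuous.intervalIntegrable (by fun_prop) _ _)]
  have h1 : ∫ s in (-1 : ℝ)..0, kern γ τ k₀ s • f s =
      ∫ s in (0 : ℝ)..1, kern γ τ k₀ s • f (-s) := by
    have := intervalIntegral.integral_comp_neg (a := (0 : ℝ)) (b := 1)
      (fun s => kern γ τ k₀ s • f s)
    rw [neg_zero] at this
    rw [← this]
    simp [kern]
  rw [h1, add_comm, ← intervalIntegral.integral_add
    (Continuous.intervalIntegrable (by fun_prop) _ _)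
    (Continuous.intervalIntegrable (by fun_prop) _ _), ← intervalIntegral.integral_smul]
  refine intervalIntegral.integral_congr fun s hs => ?_
  rw [Set.uIcc_of_le zero_le_one] at hs
  have h2 : |s| = s := abs_of_nonneg hs.1
  rw [← smul_add, kern_eq γ τ k₀ (by rw [h2]; exact hs.2), h2, mul_smul]

theorem conv_kern {u : ℝ → ℝ} (hu : Continuous u) (t : ℝ) : conv (kern γ τ k₀) u t =
    γ * τ ^ 2 / k₀ * ∫ s in (0 : ℝ)..1, Real.sin (k₀ * (1 - s)) * (u (t + s) + u (t - s)) := by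
  have h := integral_kern_smul γ τ k₀ (f := fun s => u (t - s)) (by fun_prop)
  simp only [smul_eq_mul, sub_neg_eq_add] at h
  rw [conv, h]
  simp only [add_comm]

theorem integrable_kern : Integrable (kern γ τ k₀) :=
  (continuous_kern γ τ k₀).integrable_of_hasCompactSupport
    (HasCompactSupport.of_support_subset_isCompact (isCompact_Icc (a := (-1 : ℝ)) (b := 1))
      fun s hs => by
        by_contra hcon
        refine hs (kern_eq_zero γ τ k₀ ?_)
        by_contra h1
        exact hcon (abs_le.1 (not_le.1 h1).le))

/-- Compact support gives any rate of decay: on |t| ≤ 1 the factor e^{p(1-|t|)} is at least 1. -/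
theorem abs_kern_le {p : ℝ} (hp : 0 ≤ p) (t : ℝ) :
    |kern γ τ k₀ t| ≤ |γ * τ ^ 2 / k₀| * Real.exp p * Real.exp (-p * |t|) := by
  rcases le_total 1 |t| with h | h
  · rw [kern_eq_zero γ τ k₀ h, abs_zero]
    positivity
  · rw [kern_eq γ τ k₀ h, abs_mul, mul_assoc, ← Real.exp_add]
    refine mul_le_mul_of_nonneg_left ((Real.abs_sin_le_one _).trans ?_) (abs_nonneg _)
    refine Real.one_le_exp ?_
    nlinarith

theorem laplace_kern (z : ℂ) : laplace (kern γ τ k₀) z =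
    ((γ * τ ^ 2 / k₀ : ℝ) : ℂ) * ∫ s in (0 : ℝ)..1,
      ((Real.sin (k₀ * (1 - s)) : ℝ) : ℂ) * (2 * Complex.cosh (z * s)) := by
  have h := integral_kern_smul γ τ k₀ (f := fun s : ℝ => Complex.exp (-z * s)) (by fun_prop)
  simp only [Complex.real_smul] at h
  rw [laplace, h]
  congr 1
  refine intervalIntegral.integral_congr fun s _ => ?_
  rw [Complex.cosh]
  push_cast
  ring_nf

theorem differentiable_laplace_kern : Differentiable ℂ (laplace (kern γ τ k₀)) := by
  have h : laplace (kern γ τ k₀) = fun z => ((γ * τ ^ 2 / k₀ : ℝ) : ℂ) * ∫ s in (0 : ℝ)..1,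
      ((Real.sin (k₀ * (1 - s)) : ℝ) : ℂ) * (2 * Complex.cosh (z * s)) :=
    funext fun z => laplace_kern γ τ k₀ z
  rw [h]
  intro z
  refine DifferentiableAt.const_mul (HasDerivAt.differentiableAt
    (hasDerivAt_intervalIntegral_of_continuous (𝕜 := ℂ)
      (F' := fun z s => ((Real.sin (k₀ * (1 - s)) : ℝ) : ℂ) * (2 * (Complex.sinh (z * s) * s)))
      ?_ ?_ (fun z s => ?_) 0 1 z)) _
  · unfold Function.uncurry
    fun_prop
  · unfold Function.uncurry
    fun_prop
  · have h1 : HasDerivAt (fun z : ℂ => z * (s : ℂ)) s z := by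
      simpa using (hasDerivAt_id z).mul_const (s : ℂ)
    exact (h1.ccosh.const_mul 2).const_mul _

/-- In the sense of distributions, θ'' + k₀²θ = γτ²(δ₁ + δ₋₁ - 2 cos k₀ δ₀), and this is its
transform. The proof exhibits a primitive of z² + k₀² times the integrand. -/
theorem sq_add_sq_mul_laplace_kern (hk : k₀ ≠ 0) (z : ℂ) :
    (z ^ 2 + k₀ ^ 2) * laplace (kern γ τ k₀) z =
      2 * ((γ * τ ^ 2 : ℝ) : ℂ) * (Complex.cosh z - Real.cos k₀) := by
  have hkc : (k₀ : ℂ) ≠ 0 := Complex.ofReal_ne_zero.2 hk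
  have h := intervalIntegral.integral_eq_sub_of_hasDerivAt (a := (0 : ℝ)) (b := 1)
    (f := fun s : ℝ => (k₀ : ℂ) * ((Real.cos (k₀ * (1 - s)) : ℝ) : ℂ) * Complex.cosh (z * s)
      + z * ((Real.sin (k₀ * (1 - s)) : ℝ) : ℂ) * Complex.sinh (z * s))
    (f' := fun s : ℝ => (z ^ 2 + k₀ ^ 2) *
      (((Real.sin (k₀ * (1 - s)) : ℝ) : ℂ) * Complex.cosh (z * s))) (fun s _ => by
        have h1 : HasDerivAt (fun s : ℝ => k₀ * (1 - s)) (-k₀) s := by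
          simpa using ((hasDerivAt_id s).const_sub 1).const_mul k₀
        have h2 : HasDerivAt (fun s : ℝ => z * (s : ℂ)) z s := by
          simpa using (Complex.ofRealCLM.hasDerivAt (x := s)).const_mul z
        have h3 : HasDerivAt (fun s : ℝ => Complex.cosh (z * s)) (Complex.sinh (z * s) * z) s :=
          HasDerivAt.comp (h₂ := Complex.cosh) s (Complex.hasDerivAt_cosh (z * s)) h2
        have h4 : HasDerivAt (fun s : ℝ => Complex.sinh (z * s)) (Complex.cosh (z * s) * z) s :=
          HasDerivAt.comp (h₂ := Complex.sinh) s (Complex.hasDerivAt_sinh (z * s)) h2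
        refine (((h1.cos.ofReal_comp.const_mul (k₀ : ℂ)).mul h3).add
          ((h1.sin.ofReal_comp.const_mul z).mul h4)).congr_deriv ?_
        push_cast
        ring) (Continuous.intervalIntegrable (by fun_prop) _ _)
  rw [intervalIntegral.integral_const_mul] at h
  have h5 : laplace (kern γ τ k₀) z = ((γ * τ ^ 2 / k₀ : ℝ) : ℂ) * (2 * ∫ s in (0 : ℝ)..1,
      ((Real.sin (k₀ * (1 - s)) : ℝ) : ℂ) * Complex.cosh (z * s)) := by
    rw [laplace_kern, ← intervalIntegral.integral_const_mul 2]
    congr 2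
    funext s
    ring
  have h6 : ((γ * τ ^ 2 / k₀ : ℝ) : ℂ) * k₀ = ((γ * τ ^ 2 : ℝ) : ℂ) := by
    push_cast
    field_simp
  simp only [sub_self, mul_zero, Real.sin_zero, Real.cos_zero, sub_zero, Complex.ofReal_zero,
    Complex.ofReal_one, mul_one, zero_mul, add_zero, Complex.cosh_zero, Complex.sinh_zero] at h
  rw [h5]
  linear_combination 2 * ((γ * τ ^ 2 / k₀ : ℝ) : ℂ) * h + 2 * (Complex.cosh z - Real.cos k₀) * h6

/-- At z = ik₀ the factor z² + k₀² vanishes, so the value has to be read off the integral directly.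
-/
theorem laplace_kern_I_mul (hk : k₀ ≠ 0) :
    laplace (kern γ τ k₀) (Complex.I * k₀) = ((γ * τ ^ 2 / k₀ * Real.sin k₀ : ℝ) : ℂ) := by
  rw [laplace_kern, Complex.ofReal_mul, ← integral_sin_mul_cos k₀ hk,
    ← intervalIntegral.integral_ofReal]
  congr 1
  refine intervalIntegral.integral_congr fun s _ => ?_
  rw [show Complex.I * k₀ * (s : ℂ) = ((k₀ * s : ℝ) : ℂ) * Complex.I by push_cast; ring,
    Complex.cosh_mul_I, ← Complex.ofReal_cos]
  push_cast
  ring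

theorem laplace_kern_neg (z : ℂ) :
    laplace (kern γ τ k₀) (-z) = laplace (kern γ τ k₀) z := by
  rw [laplace_kern, laplace_kern]
  simp only [neg_mul, Complex.cosh_neg]

variable {γ τ k₀}

theorem InDelta0.charFn_eq (h : InDelta0 γ τ k₀) (z : ℂ) :
    charFn γ τ z = (z ^ 2 + k₀ ^ 2) * (1 - laplace (kern γ τ k₀) z) := by
  rw [mul_sub, sq_add_sq_mul_laplace_kern γ τ k₀ h.pos.ne', charFn, h.relation]
  push_cast
  ring

theorem InDelta0.charFn_eq_zero_of_laplace (h : InDelta0 γ τ k₀) {z : ℂ}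
    (hz : laplace (kern γ τ k₀) z = 1) : charFn γ τ z = 0 := by
  rw [h.charFn_eq, hz, sub_self, mul_zero]

/-- A solution of Θ = 1 is a root of χ, so on the axis only ±ik₀ are possible; there simplicity
excludes it, and evenness of Θ covers both signs. -/
theorem InDelta0.laplace_kern_ne_one_of_re_eq_zero (h : InDelta0 γ τ k₀) {z : ℂ}
    (hre : z.re = 0) : laplace (kern γ τ k₀) z ≠ 1 := by
  intro hz
  have h1 : laplace (kern γ τ k₀) (Complex.I * k₀) ≠ 1 := by
    rw [laplace_kern_I_mul γ τ k₀ h.pos.ne']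
    intro h2
    have h3 : γ * τ ^ 2 / k₀ * Real.sin k₀ = 1 := by exact_mod_cast h2
    refine h.sub_ne_zero ?_
    have := h.pos.ne'
    field_simp at h3
    linarith
  rcases h.eq_of_charFn_eq_zero (h.charFn_eq_zero_of_laplace hz) hre with h2 | h2
  · rw [h2] at hz
    exact h1 hz
  · rw [h2, laplace_kern_neg] at hz
    exact h1 hz

theorem charFn_I_mul (hγ : 0 < γ) (hτ : 0 < τ) (k : ℂ) :
    charFn γ τ (Complex.I * k) = ((γ * τ ^ 2 : ℝ) : ℂ) * dispersion γ τ k := by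
  have h1 : (γ : ℂ) ≠ 0 := Complex.ofReal_ne_zero.2 hγ.ne'
  have h2 : (τ : ℂ) ≠ 0 := Complex.ofReal_ne_zero.2 hτ.ne'
  rw [charFn, dispersion, mul_comm Complex.I, Complex.cosh_mul_I, mul_pow, Complex.I_sq]
  push_cast
  field_simp
  ring

theorem InDelta0.laplace_kern_ne_one (h : InDelta0 γ τ k₀) (hγ : 0 < γ) (hτ : 0 < τ) {z : ℂ}
    (hz : ((|z.re| : ℝ) : EReal) < p0 γ τ) : laplace (kern γ τ k₀) z ≠ 1 := by
  intro h1
  have h2 := h.charFn_eq_zero_of_laplace h1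
  by_cases hre : z.re = 0
  · exact h.laplace_kern_ne_one_of_re_eq_zero hre h1
  · have h3 : Complex.I * (-Complex.I * z) = z := by
      rw [← mul_assoc]
      simp
    rw [← h3, charFn_I_mul hγ hτ] at h2
    have h4 : ((γ * τ ^ 2 : ℝ) : ℂ) ≠ 0 := Complex.ofReal_ne_zero.2 (by positivity)
    have h5 := (mul_eq_zero.1 h2).resolve_left h4
    have him : (-Complex.I * z).im = -z.re := by simp
    refine absurd hz (not_lt.2 (sInf_le ⟨-Complex.I * z, h5, ?_, ?_⟩))
    · rw [him]
      simpa using hre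
    · rw [him, abs_neg]

/-- On the strip both Θ and (z² + k₀²)Θ are bounded, the latter because cosh is; and (Im z)² is at
most |z² + k₀²| plus a constant. -/
theorem exists_norm_laplace_kern_le (hk : k₀ ≠ 0) (p : ℝ) :
    ∃ M, ∀ z : ℂ, |z.re| ≤ p → ‖laplace (kern γ τ k₀) z‖ ≤ M / (1 + z.im ^ 2) := by
  set κ : ℝ := |γ * τ ^ 2| with hκ
  set B : ℝ := |γ * τ ^ 2 / k₀| * (2 * Real.exp p) with hB
  have hcosh : ∀ z : ℂ, |z.re| ≤ p → ‖Complex.cosh z‖ ≤ Real.exp p := by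
    intro z hz
    rw [Complex.cosh, norm_div, Complex.norm_ofNat, div_le_iff₀ two_pos]
    refine (norm_add_le _ _).trans ?_
    rw [Complex.norm_exp, Complex.norm_exp, Complex.neg_re]
    have h1 := Real.exp_le_exp.2 ((le_abs_self _).trans hz)
    have h2 := Real.exp_le_exp.2 ((neg_le_abs _).trans hz)
    linarith
  have hbdd : ∀ z : ℂ, |z.re| ≤ p → ‖laplace (kern γ τ k₀) z‖ ≤ B := by
    intro z hz
    rw [laplace_kern, norm_mul, Complex.norm_real, Real.norm_eq_abs]
    refine mul_le_mul_of_nonneg_left ?_ (abs_nonneg _)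
    have := intervalIntegral.norm_integral_le_of_norm_le_const (a := (0 : ℝ)) (b := 1)
      (f := fun s : ℝ => ((Real.sin (k₀ * (1 - s)) : ℝ) : ℂ) * (2 * Complex.cosh (z * s)))
      (C := 2 * Real.exp p) fun s hs => by
        rw [Set.uIoc_of_le zero_le_one] at hs
        rw [norm_mul, Complex.norm_real, Real.norm_eq_abs, norm_mul, Complex.norm_ofNat]
        have h1 : ‖Complex.cosh (z * s)‖ ≤ Real.exp p := by
          refine hcosh _ ?_
          rw [Complex.re_mul_ofReal, abs_mul, abs_of_pos hs.1]
          nlinarith [abs_nonneg z.re, hs.2]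
        calc |Real.sin (k₀ * (1 - s))| * (2 * ‖Complex.cosh (z * s)‖)
            ≤ 1 * (2 * Real.exp p) := by
              gcongr
              exact Real.abs_sin_le_one _
          _ = _ := one_mul _
    simpa using this
  refine ⟨B * (1 + p ^ 2 + k₀ ^ 2) + 2 * κ * (Real.exp p + 1), fun z hz => ?_⟩
  rw [le_div_iff₀ (by positivity)]
  have h1 := hbdd z hz
  have h2 := congrArg norm (sq_add_sq_mul_laplace_kern γ τ k₀ hk z)
  rw [norm_mul, norm_mul, norm_mul, Complex.norm_ofNat, Complex.norm_real, Real.norm_eq_abs] at h2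
  have h3 : ‖Complex.cosh z - Real.cos k₀‖ ≤ Real.exp p + 1 := by
    refine (norm_sub_le _ _).trans (add_le_add (hcosh z hz) ?_)
    rw [Complex.norm_real]
    exact Real.abs_cos_le_one _
  have h4 : z.im ^ 2 ≤ ‖z ^ 2 + (k₀ : ℂ) ^ 2‖ + p ^ 2 + k₀ ^ 2 := by
    have h5 : z.im ^ 2 ≤ ‖z‖ ^ 2 := by
      rw [← sq_abs z.im]
      gcongr
      exact Complex.abs_im_le_norm z
    have h6 := norm_sub_norm_le (z ^ 2) (-(k₀ : ℂ) ^ 2)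
    rw [sub_neg_eq_add, norm_neg, norm_pow, norm_pow, Complex.norm_real, Real.norm_eq_abs,
      sq_abs] at h6
    nlinarith [sq_nonneg p]
  have h7 : 0 ≤ ‖laplace (kern γ τ k₀) z‖ := norm_nonneg _
  have h8 : 0 ≤ κ := abs_nonneg _
  calc ‖laplace (kern γ τ k₀) z‖ * (1 + z.im ^ 2)
      ≤ ‖laplace (kern γ τ k₀) z‖ * (1 + (‖z ^ 2 + (k₀ : ℂ) ^ 2‖ + p ^ 2 + k₀ ^ 2)) := by gcongr
    _ = ‖laplace (kern γ τ k₀) z‖ * (1 + p ^ 2 + k₀ ^ 2) +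
        ‖z ^ 2 + (k₀ : ℂ) ^ 2‖ * ‖laplace (kern γ τ k₀) z‖ := by ring
    _ ≤ B * (1 + p ^ 2 + k₀ ^ 2) + 2 * κ * (Real.exp p + 1) := by
        rw [h2]
        gcongr

/-- Decay confines solutions of Θ = 1 with |Re z| ≤ 1 to bounded |Im z|, and compactness keeps them
away from the axis. The other roots of χ, ±ik₀, correspond to real k and do not enter p₀. -/
theorem InDelta0.p0_pos (h : InDelta0 γ τ k₀) (hγ : 0 < γ) (hτ : 0 < τ) : 0 < p0 γ τ := by
  obtain ⟨M, hM⟩ := exists_norm_laplace_kern_le (γ := γ) (τ := τ) h.pos.ne' 1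
  have hM0 : 0 ≤ M := by simpa using (norm_nonneg _).trans (hM 0 (by simp))
  have hcont := (differentiable_laplace_kern γ τ k₀).continuous
  -- The tube lemma thickens the segment |Im z| ≤ M + 1 of the imaginary axis inside the open set Θ
  -- ≠ 1.
  obtain ⟨δ, hδ, hδ1⟩ : ∃ δ > 0, ∀ z : ℂ, z.re ∈ Set.Icc (-δ) δ → |z.im| ≤ M + 1 →
      laplace (kern γ τ k₀) z ≠ 1 := by
    have hopen : IsOpen {q : ℝ × ℝ | laplace (kern γ τ k₀) (q.1 + q.2 * Complex.I) ≠ 1} :=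
      isOpen_ne.preimage (by fun_prop)
    have hsub : ({0} : Set ℝ) ×ˢ Set.Icc (-(M + 1)) (M + 1) ⊆
        {q : ℝ × ℝ | laplace (kern γ τ k₀) (q.1 + q.2 * Complex.I) ≠ 1} := by
      rintro ⟨x, y⟩ ⟨hx, -⟩
      refine h.laplace_kern_ne_one_of_re_eq_zero ?_
      have hx' : x = 0 := hx
      simp [hx']
    obtain ⟨u, v, hu, -, h0u, hv, huv⟩ :=
      generalized_tube_lemma isCompact_singleton isCompact_Icc hopen hsub
    obtain ⟨ε, hε, hεu⟩ := Metric.isOpen_iff.1 hu 0 (h0u rfl)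
    refine ⟨ε / 2, by positivity, fun z hz hz' => ?_⟩
    have h1 : (z.re, z.im) ∈ u ×ˢ v := by
      refine ⟨hεu ?_, hv (abs_le.1 hz')⟩
      rw [Metric.mem_ball, Real.dist_eq, sub_zero]
      exact lt_of_le_of_lt (abs_le.2 hz) (by linarith)
    have h2 := huv h1
    simpa using h2
  refine lt_of_lt_of_le (b := ((min δ 1 : ℝ) : EReal)) ?_ (le_sInf ?_)
  · exact_mod_cast lt_min hδ one_pos
  · rintro _ ⟨k, hk, him, rfl⟩
    rw [EReal.coe_le_coe_iff]
    by_contra hcon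
    rw [not_le, lt_min_iff] at hcon
    have hre : (Complex.I * k).re = -k.im := by simp
    have hre1 : |(Complex.I * k).re| = |k.im| := by rw [hre, abs_neg]
    have h1 : charFn γ τ (Complex.I * k) = 0 := by
      rw [charFn_I_mul hγ hτ, hk, mul_zero]
    rw [h.charFn_eq] at h1
    rcases mul_eq_zero.1 h1 with h2 | h2
    · have h3 : (Complex.I * k - Complex.I * k₀) * (Complex.I * k + Complex.I * k₀) = 0 := by
        have : (Complex.I * (k₀ : ℂ)) ^ 2 = -(k₀ : ℂ) ^ 2 := by
          rw [mul_pow, Complex.I_sq]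
          ring
        linear_combination h2 - this
      rcases mul_eq_zero.1 h3 with h4 | h4
      · have := congrArg Complex.re h4
        simp at this
        exact him this
      · have := congrArg Complex.re h4
        simp at this
        exact him this
    · have h3 : laplace (kern γ τ k₀) (Complex.I * k) = 1 := (sub_eq_zero.1 h2).symm
      have h4 := hM (Complex.I * k) (by rw [hre1]; exact hcon.2.le)
      rw [h3, norm_one, le_div_iff₀ (by positivity), one_mul] at h4
      refine hδ1 (Complex.I * k) (abs_le.1 (by rw [hre1]; exact hcon.1.le)) ?_ h3
      refine abs_le_of_sq_le_sq ?_ (by positivity)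
      nlinarith

end Kernel

/-! ### The centre projection: formula, uniqueness, and the constraints describing Q_h 𝔻 -/

section Projection

open MeasureTheory Filter Topology

variable (γ τ k₀ : ℝ)

theorem hasDerivAt_cos_mul (s : ℝ) :
    HasDerivAt (fun s => Real.cos (k₀ * s)) (-(k₀ * Real.sin (k₀ * s))) s := by
  have h : HasDerivAt (fun s : ℝ => k₀ * s) k₀ s := by
    simpa using (hasDerivAt_id s).const_mul k₀
  exact h.cos.congr_deriv (by ring)

theorem hasDerivAt_sin_mul (s : ℝ) :
    HasDerivAt (fun s => Real.sin (k₀ * s)) (k₀ * Real.cos (k₀ * s)) s := by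
  have h : HasDerivAt (fun s : ℝ => k₀ * s) k₀ s := by
    simpa using (hasDerivAt_id s).const_mul k₀
  exact h.sin.congr_deriv (by ring)

/-- The function `cos(k₀ s)` in `C¹[-1,1]`. -/
noncomputable def cosC1 : C1 ℝ :=
  mkC1 (fun s => Real.cos (k₀ * s)) (fun s => -(k₀ * Real.sin (k₀ * s)))
    (hasDerivAt_cos_mul k₀) (by fun_prop)

/-- The function `sin(k₀ s)` in `C¹[-1,1]`. -/
noncomputable def sinC1 : C1 ℝ :=
  mkC1 (fun s => Real.sin (k₀ * s)) (fun s => k₀ * Real.cos (k₀ * s))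
    (hasDerivAt_sin_mul k₀) (by fun_prop)

/-- The real part `(1, 0, cos(k₀ s))` of the centre eigenvector. -/
noncomputable def centreRe : DD ℝ :=
  mkDD 1 0 (cosC1 k₀) (by rw [cosC1, evalC1_mkC1 _ _ zero_mem_I]; simp)

/-- The imaginary part `(0, k₀, sin(k₀ s))` of the centre eigenvector. -/
noncomputable def centreIm : DD ℝ :=
  mkDD 0 k₀ (sinC1 k₀) (by rw [sinC1, evalC1_mkC1 _ _ zero_mem_I]; simp)

/-- The real part of the functional that annihilates the range of `L_{γ,τ} - i k₀`. -/
noncomputable def phiRe : HH ℝ →L[ℝ] ℝ :=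
  -(ContinuousLinearMap.fst ℝ ℝ C(I, ℝ)).comp (ContinuousLinearMap.snd ℝ ℝ (ℝ × C(I, ℝ)))
    + (cosF γ τ k₀).comp ((ContinuousLinearMap.snd ℝ ℝ C(I, ℝ)).comp
      (ContinuousLinearMap.snd ℝ ℝ (ℝ × C(I, ℝ))))

/-- The imaginary part of the functional that annihilates the range of `L_{γ,τ} - i k₀`. -/
noncomputable def phiIm : HH ℝ →L[ℝ] ℝ :=
  -(k₀ • ContinuousLinearMap.fst ℝ ℝ (ℝ × C(I, ℝ)))
    + (sinF γ τ k₀).comp ((ContinuousLinearMap.snd ℝ ℝ C(I, ℝ)).comp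
      (ContinuousLinearMap.snd ℝ ℝ (ℝ × C(I, ℝ))))

theorem phiRe_apply (F : HH ℝ) : phiRe γ τ k₀ F = -F.2.1 + cosF γ τ k₀ F.2.2 := rfl

theorem phiIm_apply (F : HH ℝ) : phiIm γ τ k₀ F = -(k₀ * F.1) + sinF γ τ k₀ F.2.2 := rfl

theorem sinF_toC0_cosC1 (hk : k₀ ≠ 0) :
    sinF γ τ k₀ (toC0 (cosC1 k₀)) = γ * τ ^ 2 * Real.sin k₀ := by
  rw [sinF_congr γ τ k₀ (w := fun s => Real.cos (k₀ * s)) fun s => rfl,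
    ← integral_sin_mul_cos k₀ hk]
  congr 2
  funext s
  rw [mul_neg, Real.cos_neg]
  ring

theorem derivC1_cosC1 : derivC1 (cosC1 k₀) = -(k₀ • toC0 (sinC1 k₀)) := by
  ext s
  rfl

theorem derivC1_sinC1 : derivC1 (sinC1 k₀) = k₀ • toC0 (cosC1 k₀) := by
  ext s
  rfl

theorem cosF_toC0_sinC1 (hk : k₀ ≠ 0) :
    cosF γ τ k₀ (toC0 (sinC1 k₀)) = γ * τ ^ 2 * Real.sin k₀ := by
  have h := sinF_derivC1 γ τ k₀ (sinC1 k₀)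
  rw [derivC1_sinC1, map_smul, sinF_toC0_cosC1 γ τ k₀ hk, smul_eq_mul] at h
  exact (mul_left_cancel₀ hk h).symm

theorem sinF_toC0_sinC1 : sinF γ τ k₀ (toC0 (sinC1 k₀)) = 0 := by
  rw [sinF_congr γ τ k₀ (w := fun s => Real.sin (k₀ * s)) fun s => rfl]
  simp

theorem cosF_toC0_cosC1 : cosF γ τ k₀ (toC0 (cosC1 k₀)) = 0 := by
  rw [cosF_congr γ τ k₀ (w := fun s => Real.cos (k₀ * s)) fun s => rfl]
  simp

theorem phiRe_centreRe : phiRe γ τ k₀ (incl ℝ (centreRe k₀)) = 0 := by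
  rw [phiRe_apply, centreRe, incl_mkDD]
  simp [cosF_toC0_cosC1]

theorem phiIm_centreRe (hk : k₀ ≠ 0) :
    phiIm γ τ k₀ (incl ℝ (centreRe k₀)) = -(k₀ - γ * τ ^ 2 * Real.sin k₀) := by
  rw [phiIm_apply, centreRe, incl_mkDD]
  simp only [sinF_toC0_cosC1 γ τ k₀ hk]
  ring

theorem phiRe_centreIm (hk : k₀ ≠ 0) :
    phiRe γ τ k₀ (incl ℝ (centreIm k₀)) = -(k₀ - γ * τ ^ 2 * Real.sin k₀) := by
  rw [phiRe_apply, centreIm, incl_mkDD]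
  simp only [cosF_toC0_sinC1 γ τ k₀ hk]
  ring

theorem phiIm_centreIm : phiIm γ τ k₀ (incl ℝ (centreIm k₀)) = 0 := by
  rw [phiIm_apply, centreIm, incl_mkDD]
  simp [sinF_toC0_sinC1]

theorem LL_real_apply (U : DD ℝ) : LL ℝ γ τ U = (U.1.2.1, -(τ ^ 2 * (1 + 2 * γ)) * U.1.1
    + γ * τ ^ 2 * (evalC1 U.1.2.2 1 + evalC1 U.1.2.2 (-1)), derivC1 U.1.2.2) := rfl

variable {γ τ k₀}

/-- With `phiIm_LL`, this says that L rotates the pair of functionals at rate k₀: they are the real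
and imaginary parts of a left eigenfunctional. -/
theorem InDelta0.phiRe_LL (h : InDelta0 γ τ k₀) (U : DD ℝ) :
    phiRe γ τ k₀ (LL ℝ γ τ U) = -(k₀ * phiIm γ τ k₀ (incl ℝ U)) := by
  rw [phiRe_apply, phiIm_apply, LL_real_apply]
  change _ = -(k₀ * (-(k₀ * U.1.1) + sinF γ τ k₀ (toC0 U.1.2.2)))
  simp only
  rw [cosF_derivC1, h.relation, DD_evalC1_zero]
  ring

theorem phiIm_LL (U : DD ℝ) :
    phiIm γ τ k₀ (LL ℝ γ τ U) = k₀ * phiRe γ τ k₀ (incl ℝ U) := by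
  rw [phiRe_apply, phiIm_apply, LL_real_apply]
  change _ = k₀ * (-U.1.2.1 + cosF γ τ k₀ (toC0 U.1.2.2))
  simp only
  rw [sinF_derivC1]
  ring

theorem InDelta0.LL_centreRe (h : InDelta0 γ τ k₀) :
    LL ℝ γ τ (centreRe k₀) = -(k₀ • incl ℝ (centreIm k₀)) := by
  rw [LL_real_apply]
  refine Prod.ext ?_ (Prod.ext ?_ (derivC1_cosC1 k₀))
  · change (0 : ℝ) = -(k₀ * 0)
    simp
  · change -(τ ^ 2 * (1 + 2 * γ)) * 1 + γ * τ ^ 2 * (evalC1 (cosC1 k₀) 1 + evalC1 (cosC1 k₀) (-1))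
      = -(k₀ * k₀)
    rw [cosC1, evalC1_mkC1 _ _ one_mem_I, evalC1_mkC1 _ _ neg_one_mem_I, h.relation]
    simp only [mul_one, mul_neg, Real.cos_neg]
    ring

theorem LL_centreIm : LL ℝ γ τ (centreIm k₀) = k₀ • incl ℝ (centreRe k₀) := by
  rw [LL_real_apply]
  refine Prod.ext ?_ (Prod.ext ?_ (derivC1_sinC1 k₀))
  · change k₀ = k₀ * 1
    simp
  · change -(τ ^ 2 * (1 + 2 * γ)) * 0 + γ * τ ^ 2 * (evalC1 (sinC1 k₀) 1 + evalC1 (sinC1 k₀) (-1))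
      = k₀ * 0
    rw [sinC1, evalC1_mkC1 _ _ one_mem_I, evalC1_mkC1 _ _ neg_one_mem_I]
    simp

theorem InDelta0.mem_centreSpace_iff (h : InDelta0 γ τ k₀) {F : HH ℝ} :
    F ∈ centreSpace γ τ k₀ ↔
      ∃ α β : ℝ, F = α • incl ℝ (centreRe k₀) + β • incl ℝ (centreIm k₀) := by
  have hmem : F ∈ centreSpace γ τ k₀ ↔ ∃ c d : ℂ, complexify F =
      c • incl ℂ (eigvec (Complex.I * k₀)) + d • incl ℂ (eigvec (-(Complex.I * k₀))) := by
    change complexify F ∈ eigenspace γ τ (Complex.I * k₀) ⊔ eigenspace γ τ (-(Complex.I * k₀)) ↔ _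
    rw [Submodule.mem_sup]
    constructor
    · rintro ⟨X, hX, Y, hY, hXY⟩
      obtain ⟨c, rfl⟩ := (mem_eigenspace_iff γ τ h.charFn_eq_zero).1 hX
      obtain ⟨d, rfl⟩ := (mem_eigenspace_iff γ τ h.charFn_neg_eq_zero).1 hY
      exact ⟨c, d, hXY.symm⟩
    · rintro ⟨c, d, hcd⟩
      exact ⟨_, (mem_eigenspace_iff γ τ h.charFn_eq_zero).2 ⟨c, rfl⟩, _,
        (mem_eigenspace_iff γ τ h.charFn_neg_eq_zero).2 ⟨d, rfl⟩, hcd.symm⟩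
  rw [hmem]
  have hexp : ∀ s : ℝ, Complex.exp (Complex.I * k₀ * s) =
      (Real.cos (k₀ * s) : ℂ) + (Real.sin (k₀ * s) : ℂ) * Complex.I := by
    intro s
    rw [show Complex.I * k₀ * (s : ℂ) = ((k₀ * s : ℝ) : ℂ) * Complex.I by push_cast; ring,
      Complex.exp_mul_I, Complex.ofReal_cos, Complex.ofReal_sin]
  have hexp' : ∀ s : ℝ, Complex.exp (-(Complex.I * k₀) * s) =
      (Real.cos (k₀ * s) : ℂ) - (Real.sin (k₀ * s) : ℂ) * Complex.I := by
    intro s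
    rw [show -(Complex.I * k₀) * (s : ℂ) = (-(k₀ * s : ℝ) : ℂ) * Complex.I by push_cast; ring,
      Complex.exp_mul_I, Complex.cos_neg, Complex.sin_neg, Complex.ofReal_cos, Complex.ofReal_sin]
    ring
  constructor
  · rintro ⟨c, d, hcd⟩
    -- The coefficients of cosine and sine in the real part of c e^{ik₀s} + d e^{-ik₀s}; conversely
    -- a conjugate pair of coefficients gives a real vector.
    refine ⟨c.re + d.re, d.im - c.im, Prod.ext ?_ (Prod.ext ?_ ?_)⟩
    · have h1 : (F.1 : ℂ) = c * 1 + d * 1 := congrArg (fun x : HH ℂ => x.1) hcd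
      have h2 := congrArg Complex.re h1
      change F.1 = (c.re + d.re) * 1 + (d.im - c.im) * 0
      simpa using h2
    · have h1 : (F.2.1 : ℂ) = c * (Complex.I * k₀) + d * (-(Complex.I * k₀)) :=
        congrArg (fun x : HH ℂ => x.2.1) hcd
      have h2 := congrArg Complex.re h1
      change F.2.1 = (c.re + d.re) * 0 + (d.im - c.im) * k₀
      simp at h2
      linarith
    · ext s
      have h1 : (F.2.2 s : ℂ) = c * Complex.exp (Complex.I * k₀ * (s : ℝ))
          + d * Complex.exp (-(Complex.I * k₀) * (s : ℝ)) :=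
        congrArg (fun x : HH ℂ => x.2.2 s) hcd
      rw [hexp, hexp'] at h1
      have h2 := congrArg Complex.re h1
      change F.2.2 s = (c.re + d.re) * Real.cos (k₀ * (s : ℝ))
        + (d.im - c.im) * Real.sin (k₀ * (s : ℝ))
      simp only [Complex.ofReal_re, Complex.add_re, Complex.mul_re, Complex.add_im,
        Complex.ofReal_im, Complex.mul_im, Complex.I_re, Complex.I_im, Complex.sub_re,
        Complex.sub_im] at h2
      rw [h2]
      ring
  · rintro ⟨α, β, rfl⟩
    refine ⟨(α - β * Complex.I) / 2, (α + β * Complex.I) / 2, Prod.ext ?_ (Prod.ext ?_ ?_)⟩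
    · change ((α * 1 + β * 0 : ℝ) : ℂ) =
        (α - β * Complex.I) / 2 * 1 + (α + β * Complex.I) / 2 * 1
      push_cast
      ring
    · change ((α * 0 + β * k₀ : ℝ) : ℂ) = (α - β * Complex.I) / 2 * (Complex.I * k₀)
        + (α + β * Complex.I) / 2 * (-(Complex.I * k₀))
      push_cast
      linear_combination (β * k₀ : ℂ) * Complex.I_mul_I
    · ext s
      change ((α * Real.cos (k₀ * (s : ℝ)) + β * Real.sin (k₀ * (s : ℝ)) : ℝ) : ℂ) =
        (α - β * Complex.I) / 2 * Complex.exp (Complex.I * k₀ * (s : ℝ))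
          + (α + β * Complex.I) / 2 * Complex.exp (-(Complex.I * k₀) * (s : ℝ))
      rw [hexp, hexp']
      push_cast
      linear_combination (β * Complex.sin (k₀ * (s : ℝ)) : ℂ) * Complex.I_mul_I

variable (γ τ k₀) in
/-- The spectral projection on the centre modes. -/
noncomputable def centreProj : HH ℝ →L[ℝ] HH ℝ :=
  (-(k₀ - γ * τ ^ 2 * Real.sin k₀)⁻¹) • ((phiIm γ τ k₀).smulRight (incl ℝ (centreRe k₀))
    + (phiRe γ τ k₀).smulRight (incl ℝ (centreIm k₀)))

theorem centreProj_apply (F : HH ℝ) : centreProj γ τ k₀ F =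
    (-(k₀ - γ * τ ^ 2 * Real.sin k₀)⁻¹) • (phiIm γ τ k₀ F • incl ℝ (centreRe k₀)
      + phiRe γ τ k₀ F • incl ℝ (centreIm k₀)) := rfl

theorem InDelta0.centreProj_centreRe (h : InDelta0 γ τ k₀) :
    centreProj γ τ k₀ (incl ℝ (centreRe k₀)) = incl ℝ (centreRe k₀) := by
  rw [centreProj_apply, phiRe_centreRe, phiIm_centreRe γ τ k₀ h.pos.ne', zero_smul, add_zero,
    smul_smul, neg_mul_neg, inv_mul_cancel₀ h.sub_ne_zero, one_smul]

theorem InDelta0.centreProj_centreIm (h : InDelta0 γ τ k₀) :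
    centreProj γ τ k₀ (incl ℝ (centreIm k₀)) = incl ℝ (centreIm k₀) := by
  rw [centreProj_apply, phiRe_centreIm γ τ k₀ h.pos.ne', phiIm_centreIm, zero_smul, zero_add,
    smul_smul, neg_mul_neg, inv_mul_cancel₀ h.sub_ne_zero, one_smul]

theorem InDelta0.isCentreProjection (h : InDelta0 γ τ k₀) :
    IsCentreProjection γ τ k₀ (centreProj γ τ k₀) := by
  refine ⟨fun F => ?_, ?_, fun U => ?_⟩
  · conv_lhs => rw [centreProj_apply F]
    rw [map_smul, map_add, map_smul, map_smul, h.centreProj_centreRe, h.centreProj_centreIm]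
    rfl
  · ext F
    rw [h.mem_centreSpace_iff]
    constructor
    · rintro ⟨G, rfl⟩
      refine ⟨-(k₀ - γ * τ ^ 2 * Real.sin k₀)⁻¹ * phiIm γ τ k₀ G,
        -(k₀ - γ * τ ^ 2 * Real.sin k₀)⁻¹ * phiRe γ τ k₀ G, ?_⟩
      rw [mul_smul, mul_smul, ← smul_add]
      rfl
    · rintro ⟨α, β, rfl⟩
      refine ⟨α • incl ℝ (centreRe k₀) + β • incl ℝ (centreIm k₀), ?_⟩
      change centreProj γ τ k₀ _ = _
      rw [map_add, map_smul, map_smul, h.centreProj_centreRe, h.centreProj_centreIm]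
  · refine ⟨(-(k₀ - γ * τ ^ 2 * Real.sin k₀)⁻¹) • (phiIm γ τ k₀ (incl ℝ U) • centreRe k₀
      + phiRe γ τ k₀ (incl ℝ U) • centreIm k₀), ?_, ?_⟩
    · rw [map_smul, map_add, map_smul, map_smul, centreProj_apply]
    -- L rotates the centre vectors and the functionals compatibly, so the two rotations match.
    · rw [map_smul, map_add, map_smul, map_smul, centreProj_apply, h.LL_centreRe, LL_centreIm,
        h.phiRe_LL, phiIm_LL]
      module

/-- The derivatives of `∫_0^s cos(k₀(s-r)) f(r) dr` and `∫_0^s sin(k₀(s-r)) f(r) dr`. -/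
theorem hasDerivAt_duhamel {f : ℝ → ℝ} (hf : Continuous f) (s : ℝ) :
    HasDerivAt (fun s => ∫ r in (0 : ℝ)..s, Real.cos (k₀ * (s - r)) * f r)
      (f s - k₀ * ∫ r in (0 : ℝ)..s, Real.sin (k₀ * (s - r)) * f r) s ∧
    HasDerivAt (fun s => ∫ r in (0 : ℝ)..s, Real.sin (k₀ * (s - r)) * f r)
      (k₀ * ∫ r in (0 : ℝ)..s, Real.cos (k₀ * (s - r)) * f r) s := by
  have hc := ((show Continuous fun r => Real.cos (k₀ * r) * f r by
    fun_prop).integral_hasStrictDerivAt 0 s).hasDerivAt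
  have hs := ((show Continuous fun r => Real.sin (k₀ * r) * f r by
    fun_prop).integral_hasStrictDerivAt 0 s).hasDerivAt
  have e1 : ∀ s, ∫ r in (0 : ℝ)..s, Real.cos (k₀ * (s - r)) * f r =
      Real.cos (k₀ * s) * (∫ r in (0 : ℝ)..s, Real.cos (k₀ * r) * f r)
        + Real.sin (k₀ * s) * (∫ r in (0 : ℝ)..s, Real.sin (k₀ * r) * f r) := by
    intro s
    rw [← intervalIntegral.integral_const_mul, ← intervalIntegral.integral_const_mul,
      ← intervalIntegral.integral_add (Continuous.intervalIntegrable (by fun_prop) _ _)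
        (Continuous.intervalIntegrable (by fun_prop) _ _)]
    congr 1
    funext r
    rw [mul_sub, Real.cos_sub]
    ring
  have e2 : ∀ s, ∫ r in (0 : ℝ)..s, Real.sin (k₀ * (s - r)) * f r =
      Real.sin (k₀ * s) * (∫ r in (0 : ℝ)..s, Real.cos (k₀ * r) * f r)
        - Real.cos (k₀ * s) * (∫ r in (0 : ℝ)..s, Real.sin (k₀ * r) * f r) := by
    intro s
    rw [← intervalIntegral.integral_const_mul, ← intervalIntegral.integral_const_mul,
      ← intervalIntegral.integral_sub (Continuous.intervalIntegrable (by fun_prop) _ _)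
        (Continuous.intervalIntegrable (by fun_prop) _ _)]
    congr 1
    funext r
    rw [mul_sub, Real.sin_sub]
    ring
  simp only [e1, e2]
  constructor
  · refine (((hasDerivAt_cos_mul k₀ s).mul hc).add ((hasDerivAt_sin_mul k₀ s).mul hs)).congr_deriv ?_
    linear_combination f s * Real.sin_sq_add_cos_sq (k₀ * s)
  · refine (((hasDerivAt_sin_mul k₀ s).mul hc).sub ((hasDerivAt_cos_mul k₀ s).mul hs)).congr_deriv ?_
    ring

/-- On the kernel of both functionals, `L_{γ,τ} - i k₀` has a preimage, given by its real and
imaginary parts. -/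
theorem exists_preimage_of_phi_eq_zero {F : HH ℝ} (hRe : phiRe γ τ k₀ F = 0)
    (hIm : phiIm γ τ k₀ F = 0) :
    ∃ X Y : DD ℝ, LL ℝ γ τ X + k₀ • incl ℝ Y = F ∧ LL ℝ γ τ Y = k₀ • incl ℝ X := by
  have hF := continuous_ext F.2.2
  have hx := fun s => (hasDerivAt_duhamel (k₀ := k₀) hF s).1
  have hy := fun s => (hasDerivAt_duhamel (k₀ := k₀) hF s).2
  -- x and y solve x' = f - k₀y, y' = k₀x with zero initial values. Their boundary sums at ±1 are
  -- the integrals in `cosF` and `sinF`, so the two hypotheses are precisely the second components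
  -- of the equations.
  set x : ℝ → ℝ := fun s => ∫ r in (0 : ℝ)..s, Real.cos (k₀ * (s - r)) * ext F.2.2 r with hxdef
  set y : ℝ → ℝ := fun s => ∫ r in (0 : ℝ)..s, Real.sin (k₀ * (s - r)) * ext F.2.2 r with hydef
  have hxc : Continuous x := continuous_iff_continuousAt.2 fun s => (hx s).continuousAt
  have hyc : Continuous y := continuous_iff_continuousAt.2 fun s => (hy s).continuousAt
  have hx0 : x 0 = 0 := by simp [hxdef]
  have hy0 : y 0 = 0 := by simp [hydef]
  have hx1 : x 1 + x (-1) = ∫ s in (0 : ℝ)..1, Real.cos (k₀ * (1 - s)) *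
      (ext F.2.2 s - ext F.2.2 (-s)) := by
    have h1 : x (-1) = -∫ s in (0 : ℝ)..1, Real.cos (k₀ * (1 - s)) * ext F.2.2 (-s) := by
      rw [hxdef]
      simp only
      rw [intervalIntegral.integral_symm, neg_inj]
      have := intervalIntegral.integral_comp_neg (a := (0 : ℝ)) (b := 1)
        (fun r => Real.cos (k₀ * (-1 - r)) * ext F.2.2 r)
      rw [neg_zero] at this
      rw [← this]
      congr 1
      funext s
      rw [show k₀ * (-1 - -s) = -(k₀ * (1 - s)) by ring, Real.cos_neg]
    rw [h1, hxdef, ← sub_eq_add_neg, ← intervalIntegral.integral_sub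
      (Continuous.intervalIntegrable (by fun_prop) _ _)
      (Continuous.intervalIntegrable (by fun_prop) _ _)]
    simp only [mul_sub]
  have hy1 : y 1 + y (-1) = ∫ s in (0 : ℝ)..1, Real.sin (k₀ * (1 - s)) *
      (ext F.2.2 s + ext F.2.2 (-s)) := by
    have h1 : y (-1) = ∫ s in (0 : ℝ)..1, Real.sin (k₀ * (1 - s)) * ext F.2.2 (-s) := by
      rw [hydef]
      simp only
      rw [intervalIntegral.integral_symm, neg_eq_iff_eq_neg, ← intervalIntegral.integral_neg]
      have := intervalIntegral.integral_comp_neg (a := (0 : ℝ)) (b := 1)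
        (fun r => Real.sin (k₀ * (-1 - r)) * ext F.2.2 r)
      rw [neg_zero] at this
      rw [← this]
      congr 1
      funext s
      rw [show k₀ * (-1 - -s) = -(k₀ * (1 - s)) by ring, Real.sin_neg]
      ring
    rw [h1, hydef, ← intervalIntegral.integral_add
      (Continuous.intervalIntegrable (by fun_prop) _ _)
      (Continuous.intervalIntegrable (by fun_prop) _ _)]
    simp only [mul_add]
  have hx' : ∀ s, HasDerivAt x (ext F.2.2 s - k₀ * y s) s := hx
  have hy' : ∀ s, HasDerivAt y (k₀ * x s) s := hy
  have hxc' : Continuous fun s => ext F.2.2 s - k₀ * y s := by fun_prop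
  have hyc' : Continuous fun s => k₀ * x s := by fun_prop
  refine ⟨mkDD 0 F.1 (mkC1 x _ hx' hxc')
      (by rw [evalC1_mkC1 _ _ zero_mem_I]; exact hx0),
    mkDD 0 0 (mkC1 y _ hy' hyc')
      (by rw [evalC1_mkC1 _ _ zero_mem_I]; exact hy0), ?_, ?_⟩
  · rw [LL_real_apply]
    refine Prod.ext ?_ (Prod.ext ?_ ?_)
    · change F.1 + k₀ * 0 = F.1
      ring
    · change (-(τ ^ 2 * (1 + 2 * γ)) * 0 + γ * τ ^ 2 * (evalC1 (mkC1 x _ hx' hxc') 1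
        + evalC1 (mkC1 x _ hx' hxc') (-1))) + k₀ * 0 = F.2.1
      rw [evalC1_mkC1 _ _ one_mem_I, evalC1_mkC1 _ _ neg_one_mem_I, hx1]
      rw [phiRe_apply, cosF_apply] at hRe
      linarith
    · ext s
      change (ext F.2.2 s - k₀ * y s) + k₀ * y s = F.2.2 s
      rw [ext_of_mem _ s.2]
      ring
  · rw [LL_real_apply]
    refine Prod.ext ?_ (Prod.ext ?_ ?_)
    · change (0 : ℝ) = k₀ * 0
      ring
    · change -(τ ^ 2 * (1 + 2 * γ)) * 0 + γ * τ ^ 2 * (evalC1 (mkC1 y _ hy' hyc') 1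
        + evalC1 (mkC1 y _ hy' hyc') (-1)) = k₀ * F.1
      rw [evalC1_mkC1 _ _ one_mem_I, evalC1_mkC1 _ _ neg_one_mem_I, hy1]
      rw [phiIm_apply, sinF_apply] at hIm
      linarith
    · ext s
      rfl

theorem InDelta0.phi_sub_centreProj (h : InDelta0 γ τ k₀) (F : HH ℝ) :
    phiRe γ τ k₀ (F - centreProj γ τ k₀ F) = 0 ∧ phiIm γ τ k₀ (F - centreProj γ τ k₀ F) = 0 := by
  have hn := h.sub_ne_zero
  constructor
  · rw [map_sub, centreProj_apply, map_smul, map_add, map_smul, map_smul, phiRe_centreRe,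
      phiRe_centreIm γ τ k₀ h.pos.ne']
    simp only [smul_eq_mul]
    field_simp
    ring
  · rw [map_sub, centreProj_apply, map_smul, map_add, map_smul, map_smul,
      phiIm_centreRe γ τ k₀ h.pos.ne', phiIm_centreIm]
    simp only [smul_eq_mul]
    field_simp
    ring

/-- P is the identity on the centre space, so only its kernel matters. If both functionals vanish at
F, then F = (L - ik₀)Z with Z = X + iY, and PF = (L - ik₀)PZ is a multiple of the eigenvector for
-ik₀. As PF is real, it is zero. -/
theorem InDelta0.eq_centreProj (h : InDelta0 γ τ k₀) {P : HH ℝ →L[ℝ] HH ℝ}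
    (hP : IsCentreProjection γ τ k₀ P) : P = centreProj γ τ k₀ := by
  have hfix : ∀ F, F ∈ centreSpace γ τ k₀ → P F = F := by
    intro F hF
    rw [← hP.range_eq] at hF
    obtain ⟨G, rfl⟩ := hF
    exact hP.idem G
  have hker : ∀ F, phiRe γ τ k₀ F = 0 → phiIm γ τ k₀ F = 0 → P F = 0 := by
    intro F h1 h2
    obtain ⟨X, Y, hXY, hY⟩ := exists_preimage_of_phi_eq_zero h1 h2
    obtain ⟨VX, hVX, hLX⟩ := hP.comm X
    obtain ⟨VY, hVY, hLY⟩ := hP.comm Y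
    have hmem : P (incl ℝ Y) ∈ centreSpace γ τ k₀ := by
      rw [← hP.range_eq]
      exact ⟨incl ℝ Y, rfl⟩
    obtain ⟨α, β, hαβ⟩ := h.mem_centreSpace_iff.1 hmem
    have hVY' : VY = α • centreRe k₀ + β • centreIm k₀ := by
      refine incl_injective ?_
      rw [hVY, hαβ, map_add, map_smul, map_smul]
    -- The equation LY = k₀X, after applying P, determines PX from PY.
    have h3 : P (incl ℝ X) = -(α • incl ℝ (centreIm k₀)) + β • incl ℝ (centreRe k₀) := by
      have h4 : k₀ • P (incl ℝ X) =
          k₀ • (-(α • incl ℝ (centreIm k₀)) + β • incl ℝ (centreRe k₀)) := by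
        rw [← map_smul, ← hY, ← hLY, hVY', map_add, map_smul, map_smul, h.LL_centreRe, LL_centreIm]
        module
      exact smul_right_injective _ h.pos.ne' h4
    have hVX' : VX = -(α • centreIm k₀) + β • centreRe k₀ := by
      refine incl_injective ?_
      rw [hVX, h3, map_add, map_neg, map_smul, map_smul]
    rw [← hXY, map_add, map_smul, ← hLX, hVX', hαβ, map_add, map_neg, map_smul, map_smul,
      h.LL_centreRe, LL_centreIm]
    module
  refine ContinuousLinearMap.ext fun F => ?_
  have h1 := h.phi_sub_centreProj F
  have h2 := hker _ h1.1 h1.2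
  rw [map_sub, sub_eq_zero] at h2
  rw [h2]
  refine hfix _ ?_
  rw [← h.isCentreProjection.range_eq]
  exact ⟨F, rfl⟩

theorem InDelta0.centreProj_eq_zero_iff (h : InDelta0 γ τ k₀) {F : HH ℝ} :
    centreProj γ τ k₀ F = 0 ↔ phiRe γ τ k₀ F = 0 ∧ phiIm γ τ k₀ F = 0 := by
  constructor
  · intro h0
    have := h.phi_sub_centreProj F
    rwa [h0, sub_zero] at this
  · rintro ⟨h1, h2⟩
    rw [centreProj_apply, h1, h2]
    simp

theorem IsCentreProjection.mem_QhD_iff {P : HH ℝ →L[ℝ] HH ℝ} (hP : IsCentreProjection γ τ k₀ P)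
    {U : DD ℝ} : U ∈ QhD P ↔ P (incl ℝ U) = 0 := by
  constructor
  · rintro ⟨V, -, hV⟩
    have hV' : V - P V = incl ℝ U := hV
    rw [← hV', map_sub, hP.idem, sub_self]
  · intro h0
    refine ⟨incl ℝ U, ⟨U, rfl⟩, ?_⟩
    change incl ℝ U - P (incl ℝ U) = incl ℝ U
    rw [h0, sub_zero]

/-- Having no centre part amounts to two scalar constraints that express u and v through W. All
later arguments use Q_h 𝔻 in this form. -/
theorem InDelta0.mem_QhD_iff (h : InDelta0 γ τ k₀) {P : HH ℝ →L[ℝ] HH ℝ}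
    (hP : IsCentreProjection γ τ k₀ P) {U : DD ℝ} : U ∈ QhD P ↔
      U.1.2.1 = cosF γ τ k₀ (toC0 U.1.2.2) ∧ k₀ * U.1.1 = sinF γ τ k₀ (toC0 U.1.2.2) := by
  rw [hP.mem_QhD_iff, h.eq_centreProj hP, h.centreProj_eq_zero_iff]
  change -U.1.2.1 + cosF γ τ k₀ (toC0 U.1.2.2) = 0 ∧
    -(k₀ * U.1.1) + sinF γ τ k₀ (toC0 U.1.2.2) = 0 ↔ _
  rw [neg_add_eq_zero, neg_add_eq_zero]

end Projection

/-! ### Transport along characteristics with values in C[-1,1] -/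

section Transport

open MeasureTheory Filter Topology

/-- The restriction to `[-1,1]` of a continuous function on the line. -/
def restr (w : ℝ → ℝ) (hw : Continuous w) : C(I, ℝ) := ⟨fun s : I => w s, by fun_prop⟩

theorem continuous_restr {w : ℝ → ℝ → ℝ} (hw : Continuous (Function.uncurry w)) :
    Continuous fun t => restr (w t) (hw.comp (Continuous.prodMk_right t)) := by
  have h : Continuous fun q : ℝ × I => w q.1 q.2 :=
    hw.comp (continuous_fst.prodMk (continuous_subtype_val.comp continuous_snd))
  exact (ContinuousMap.curry ⟨_, h⟩).continuous

theorem norm_restr_le {w : ℝ → ℝ} {hw : Continuous w} {M : ℝ} (hM : 0 ≤ M)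
    (h : ∀ s ∈ Set.Icc (-1 : ℝ) 1, |w s| ≤ M) : ‖restr w hw‖ ≤ M :=
  (ContinuousMap.norm_le _ hM).2 fun s => h s s.2

/-- A function of two variables with a jointly continuous derivative in the first variable is
differentiable as a map into `C[-1,1]`. -/
theorem hasDerivAt_restr {w w' : ℝ → ℝ → ℝ} (hw : Continuous (Function.uncurry w))
    (hw' : Continuous (Function.uncurry w'))
    (h : ∀ t s, HasDerivAt (fun t => w t s) (w' t s) t) (t : ℝ) :
    HasDerivAt (fun t => restr (w t) (hw.comp (Continuous.prodMk_right t)))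
      (restr (w' t) (hw'.comp (Continuous.prodMk_right t))) t := by
  have hc := continuous_restr hw'
  set c' : ℝ → C(I, ℝ) := fun t => restr (w' t) (hw'.comp (Continuous.prodMk_right t)) with hc'
  -- The curve is the integral of its candidate derivative in the Banach space C[-1,1]; point
  -- evaluations reduce this to the scalar fundamental theorem.
  have heq : ∀ t, restr (w t) (hw.comp (Continuous.prodMk_right t)) =
      restr (w 0) (hw.comp (Continuous.prodMk_right 0)) + ∫ x in (0 : ℝ)..t, c' x := by
    intro t
    ext s
    have h1 : (∫ x in (0 : ℝ)..t, c' x) s = ∫ x in (0 : ℝ)..t, w' x s :=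
      ((ContinuousMap.evalCLM ℝ s).intervalIntegral_comp_comm
        (hc.intervalIntegrable (μ := volume) 0 t)).symm
    have h2 : ∫ x in (0 : ℝ)..t, w' x s = w t s - w 0 s := by
      refine intervalIntegral.integral_eq_sub_of_hasDerivAt (fun x _ => h x s) ?_
      exact (hw'.comp (Continuous.prodMk_left (s : ℝ))).intervalIntegrable _ _
    rw [ContinuousMap.add_apply, h1, h2]
    change w t s = w 0 s + (w t s - w 0 s)
    ring
  have h3 := (hc.integral_hasStrictDerivAt 0 t).hasDerivAt.const_add
    (restr (w 0) (hw.comp (Continuous.prodMk_right 0)))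
  exact h3.congr_of_eventuallyEq (Eventually.of_forall heq)

/-- The chain rule for a function of two real variables with continuous partial derivatives. -/
theorem hasDerivAt_comp_two {Φ Φ₁ Φ₂ : ℝ → ℝ → ℝ} {α β : ℝ → ℝ} {α' β' x : ℝ}
    (h₁ : ∀ᶠ v : ℝ × ℝ in 𝓝 (α x, β x), HasDerivAt (fun x => Φ x v.2) (Φ₁ v.1 v.2) v.1)
    (h₂ : ∀ᶠ v : ℝ × ℝ in 𝓝 (α x, β x), HasDerivAt (fun y => Φ v.1 y) (Φ₂ v.1 v.2) v.2)
    (hc₁ : Continuous (Function.uncurry Φ₁)) (hc₂ : Continuous (Function.uncurry Φ₂))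
    (hα : HasDerivAt α α' x) (hβ : HasDerivAt β β' x) :
    HasDerivAt (fun x => Φ (α x) (β x)) (α' * Φ₁ (α x) (β x) + β' * Φ₂ (α x) (β x)) x := by
  have hΦ := hasStrictFDerivAt_uncurry_coprod (𝕜 := ℝ) (u := (α x, β x)) (f := Φ)
    (f₁ := fun x y => ContinuousLinearMap.toSpanSingleton ℝ (Φ₁ x y))
    (f₂ := fun x y => ContinuousLinearMap.toSpanSingleton ℝ (Φ₂ x y))
    (h₁.mono fun v hv => hv.hasFDerivAt) (h₂.mono fun v hv => hv.hasFDerivAt)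
    (((ContinuousLinearMap.toSpanSingletonCLE (𝕜 := ℝ) (E := ℝ)).continuous.comp
      hc₁).continuousAt)
    (((ContinuousLinearMap.toSpanSingletonCLE (𝕜 := ℝ) (E := ℝ)).continuous.comp
      hc₂).continuousAt)
  have h := hΦ.hasFDerivAt.comp_hasDerivAt x (hα.prodMk hβ)
  refine h.congr_deriv ?_
  simp [Function.HasUncurry.uncurry]

variable {G : ℝ → C1 ℝ}

theorem continuous_uncurry_evalD (hG : Continuous G) :
    Continuous (Function.uncurry fun t s => evalD (G t) s) := by
  have h := (continuous_derivC1 ℝ).comp hG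
  exact (h.comp continuous_fst).eval (continuous_projIcc.comp continuous_snd)

theorem continuous_evalC1_const (hG : Continuous G) (s : ℝ) :
    Continuous fun t => evalC1 (G t) s := by
  have h := (continuous_toC0 ℝ).comp hG
  exact h.eval continuous_const

theorem continuous_uncurry_extC1 (hG : Continuous G) :
    Continuous (Function.uncurry fun t s => extC1 (G t) s) := by
  have h1 := (continuous_evalC1_const hG 0).comp (continuous_fst (X := ℝ) (Y := ℝ))
  refine h1.add ?_
  refine intervalIntegral.continuous_parametric_intervalIntegral_of_continuous
    (f := fun (q : ℝ × ℝ) r => evalD (G q.1) r) ?_ continuous_snd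
  exact (continuous_uncurry_evalD hG).comp
    ((continuous_fst.comp continuous_fst).prodMk continuous_snd)

theorem abs_evalD_le (W : C1 ℝ) (s : ℝ) : |evalD W s| ≤ ‖W‖ :=
  (norm_ext_le (derivC1 W) s).trans (le_max_right _ _)

theorem abs_evalC1_le (W : C1 ℝ) (s : ℝ) : |evalC1 W s| ≤ ‖W‖ :=
  (norm_ext_le (toC0 W) s).trans (le_max_left _ _)

theorem abs_extC1_le (W : C1 ℝ) {s : ℝ} (hs : s ∈ Set.Icc (-1 : ℝ) 1) : |extC1 W s| ≤ ‖W‖ := by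
  rw [extC1_eq W hs]
  exact abs_evalC1_le W s

/-- The integral of the forcing along the characteristics `t + s = const`. -/
noncomputable def charInt (G : ℝ → C1 ℝ) (t s : ℝ) : ℝ :=
  ∫ ρ in t..(t + s), extC1 (G ρ) (t + s - ρ)

/-- The derivative of `charInt` in its second variable. -/
noncomputable def charIntD (G : ℝ → C1 ℝ) (t s : ℝ) : ℝ :=
  evalC1 (G (t + s)) 0 + ∫ ρ in t..(t + s), evalD (G ρ) (t + s - ρ)

theorem continuous_integral_diagonal {g : ℝ → ℝ → ℝ} (hg : Continuous (Function.uncurry g)) :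
    Continuous (Function.uncurry fun a c => ∫ ρ in (0 : ℝ)..a, g ρ (c - ρ)) := by
  refine intervalIntegral.continuous_parametric_intervalIntegral_of_continuous
    (f := fun (q : ℝ × ℝ) ρ => g ρ (q.2 - ρ)) ?_ continuous_fst
  exact hg.comp (continuous_snd.prodMk
    ((continuous_snd.comp continuous_fst).sub continuous_snd))

/-- Moving the lower limit to 0 leaves functions of the endpoint a and of the characteristic
coordinate c = t + s, which can be differentiated separately. -/
theorem integral_diagonal_eq_sub {g : ℝ → ℝ → ℝ} (hg : Continuous (Function.uncurry g))
    (t c : ℝ) : ∫ ρ in t..c, g ρ (c - ρ) =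
      (∫ ρ in (0 : ℝ)..c, g ρ (c - ρ)) - ∫ ρ in (0 : ℝ)..t, g ρ (c - ρ) := by
  have h : Continuous fun ρ => g ρ (c - ρ) := by
    have : Continuous fun ρ : ℝ => Function.uncurry g (ρ, c - ρ) := by fun_prop
    exact this
  rw [intervalIntegral.integral_interval_sub_left (h.intervalIntegrable _ _)
    (h.intervalIntegrable _ _)]

theorem continuous_charInt (hG : Continuous G) :
    Continuous (Function.uncurry (charInt G)) := by
  have h := continuous_integral_diagonal (continuous_uncurry_extC1 hG)
  have h1 : Function.uncurry (charInt G) = fun q : ℝ × ℝ =>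
      Function.uncurry (fun a c => ∫ ρ in (0 : ℝ)..a, extC1 (G ρ) (c - ρ)) (q.1 + q.2, q.1 + q.2)
      - Function.uncurry (fun a c => ∫ ρ in (0 : ℝ)..a, extC1 (G ρ) (c - ρ)) (q.1, q.1 + q.2) :=
    funext fun q => integral_diagonal_eq_sub (continuous_uncurry_extC1 hG) _ _
  rw [h1]
  have h2 : Continuous fun q : ℝ × ℝ => q.1 + q.2 := by fun_prop
  exact (h.comp (h2.prodMk h2)).sub (h.comp (continuous_fst.prodMk h2))

theorem continuous_charIntD (hG : Continuous G) :
    Continuous (Function.uncurry (charIntD G)) := by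
  have h := continuous_integral_diagonal (continuous_uncurry_evalD hG)
  have h0 := continuous_evalC1_const hG 0
  have h1 : Function.uncurry (charIntD G) = fun q : ℝ × ℝ => evalC1 (G (q.1 + q.2)) 0 +
      (Function.uncurry (fun a c => ∫ ρ in (0 : ℝ)..a, evalD (G ρ) (c - ρ)) (q.1 + q.2, q.1 + q.2)
      - Function.uncurry (fun a c => ∫ ρ in (0 : ℝ)..a, evalD (G ρ) (c - ρ)) (q.1, q.1 + q.2)) :=
    funext fun q => congrArg _ (integral_diagonal_eq_sub (continuous_uncurry_evalD hG) _ _)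
  rw [h1]
  have h2 : Continuous fun q : ℝ × ℝ => q.1 + q.2 := by fun_prop
  exact (h0.comp h2).add ((h.comp (h2.prodMk h2)).sub (h.comp (continuous_fst.prodMk h2)))

/-- The chain rule in the upper limit α and the characteristic coordinate β. Both partial
derivatives of `charInt` are special cases. -/
theorem hasDerivAt_integral_diagonal (hG : Continuous G) {α β : ℝ → ℝ} {α' β' x : ℝ}
    (hα : HasDerivAt α α' x) (hβ : HasDerivAt β β' x) :
    HasDerivAt (fun x => ∫ ρ in (0 : ℝ)..(α x), extC1 (G ρ) (β x - ρ))
      (α' * extC1 (G (α x)) (β x - α x)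
        + β' * ∫ ρ in (0 : ℝ)..(α x), evalD (G ρ) (β x - ρ)) x := by
  have he := continuous_uncurry_extC1 hG
  have hd := continuous_uncurry_evalD hG
  refine hasDerivAt_comp_two (Φ := fun a c => ∫ ρ in (0 : ℝ)..a, extC1 (G ρ) (c - ρ))
    (Φ₁ := fun a c => extC1 (G a) (c - a))
    (Φ₂ := fun a c => ∫ ρ in (0 : ℝ)..a, evalD (G ρ) (c - ρ)) (Eventually.of_forall ?_)
    (Eventually.of_forall ?_) ?_ (continuous_integral_diagonal hd) hα hβ
  · rintro ⟨a, c⟩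
    have h : Continuous fun ρ : ℝ => Function.uncurry (fun t s => extC1 (G t) s) (ρ, c - ρ) :=
      he.comp (continuous_id.prodMk (continuous_const.sub continuous_id))
    exact (h.integral_hasStrictDerivAt 0 a).hasDerivAt
  · rintro ⟨a, c⟩
    refine hasDerivAt_intervalIntegral_of_continuous (𝕜 := ℝ)
      (F := fun c ρ => extC1 (G ρ) (c - ρ)) (F' := fun c ρ => evalD (G ρ) (c - ρ))
      (he.comp (continuous_snd.prodMk (continuous_fst.sub continuous_snd)))
      (hd.comp (continuous_snd.prodMk (continuous_fst.sub continuous_snd))) (fun c ρ => ?_) 0 a c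
    exact ((hasDerivAt_extC1 (G ρ) (c - ρ)).comp_sub_const c ρ)
  · exact he.comp (continuous_fst.prodMk (continuous_snd.sub continuous_fst))

theorem hasDerivAt_charInt_snd (hG : Continuous G) (t s : ℝ) :
    HasDerivAt (fun s => charInt G t s) (charIntD G t s) s := by
  have he := continuous_uncurry_extC1 hG
  have hd := continuous_uncurry_evalD hG
  have h1 : HasDerivAt (fun s : ℝ => t + s) 1 s := (hasDerivAt_id s).const_add t
  have h := (hasDerivAt_integral_diagonal hG h1 h1).sub
    (hasDerivAt_integral_diagonal hG (hasDerivAt_const s t) h1)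
  refine (h.congr_deriv ?_).congr_of_eventuallyEq
    (Eventually.of_forall fun s => integral_diagonal_eq_sub he _ _)
  rw [charIntD, integral_diagonal_eq_sub hd t (t + s), sub_self, extC1_eq _ zero_mem_I]
  ring

/-- Together with `hasDerivAt_charInt_snd` this shows that -`charInt` solves ∂_tW = ∂_sW + G with
W(t,0) = 0. -/
theorem hasDerivAt_charInt_fst (hG : Continuous G) (t s : ℝ) :
    HasDerivAt (fun t => charInt G t s) (charIntD G t s - extC1 (G t) s) t := by
  have he := continuous_uncurry_extC1 hG
  have hd := continuous_uncurry_evalD hG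
  have h1 : HasDerivAt (fun t : ℝ => t + s) 1 t := (hasDerivAt_id t).add_const s
  have h := (hasDerivAt_integral_diagonal hG h1 h1).sub
    (hasDerivAt_integral_diagonal hG (hasDerivAt_id t) h1)
  refine (h.congr_deriv ?_).congr_of_eventuallyEq
    (Eventually.of_forall fun t => integral_diagonal_eq_sub he _ _)
  rw [charIntD, integral_diagonal_eq_sub hd t (t + s), sub_self, extC1_eq _ zero_mem_I]
  simp only [id_eq, add_sub_cancel_left]
  ring

theorem charInt_zero (t : ℝ) : charInt G t 0 = 0 := by simp [charInt]

theorem exp_mul_abs_add_le_of_abs_le_one {ν q t x : ℝ} (hν : |ν| ≤ q) (hx : |x| ≤ 1) :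
    Real.exp (ν * |t + x|) ≤ Real.exp q * Real.exp (ν * |t|) := by
  refine (exp_mul_abs_add_le ν t x).trans ?_
  rw [mul_comm]
  gcongr
  nlinarith [abs_nonneg ν]

theorem abs_integral_characteristic_le {g : ℝ → ℝ → ℝ} {M ν q : ℝ} (hM : 0 ≤ M) (hν : |ν| ≤ q)
    (hg : ∀ t, ∀ s ∈ Set.Icc (-1 : ℝ) 1, |g t s| ≤ M * Real.exp (ν * |t|)) (t : ℝ) {s : ℝ}
    (hs : s ∈ Set.Icc (-1 : ℝ) 1) :
    |∫ ρ in t..(t + s), g ρ (t + s - ρ)| ≤ M * Real.exp q * Real.exp (ν * |t|) := by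
  have h := intervalIntegral.norm_integral_le_of_norm_le_const (a := t) (b := t + s)
    (f := fun ρ => g ρ (t + s - ρ)) (C := M * Real.exp q * Real.exp (ν * |t|)) fun ρ hρ => by
      -- Along the characteristic neither the time shift nor the space variable leaves [-1,1], so
      -- the weight changes by at most e^q.
      have h1 : ρ - t ∈ Set.Icc (-1 : ℝ) 1 ∧ t + s - ρ ∈ Set.Icc (-1 : ℝ) 1 := by
        rcases le_total 0 s with h0 | h0
        · rw [Set.uIoc_of_le (by linarith)] at hρ
          constructor <;> constructor <;> linarith [hρ.1, hρ.2, hs.1, hs.2]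
        · rw [Set.uIoc_of_ge (by linarith)] at hρ
          constructor <;> constructor <;> linarith [hρ.1, hρ.2, hs.1, hs.2]
      refine (hg ρ _ h1.2).trans ?_
      rw [mul_assoc]
      refine mul_le_mul_of_nonneg_left ?_ hM
      have := exp_mul_abs_add_le_of_abs_le_one (t := t) (x := ρ - t) hν (abs_le.2 h1.1)
      rwa [add_sub_cancel] at this
  refine h.trans ?_
  rw [add_sub_cancel_left]
  have h2 : |s| ≤ 1 := abs_le.2 hs
  exact mul_le_of_le_one_right (by positivity) h2

variable {M ν q : ℝ}

theorem abs_charInt_le (hM : 0 ≤ M) (hν : |ν| ≤ q)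
    (hG : ∀ t, ‖G t‖ ≤ M * Real.exp (ν * |t|)) (t : ℝ) {s : ℝ} (hs : s ∈ Set.Icc (-1 : ℝ) 1) :
    |charInt G t s| ≤ M * Real.exp q * Real.exp (ν * |t|) :=
  abs_integral_characteristic_le hM hν (fun t _ hs => (abs_extC1_le (G t) hs).trans (hG t)) t hs

theorem abs_charIntD_le (hM : 0 ≤ M) (hν : |ν| ≤ q)
    (hG : ∀ t, ‖G t‖ ≤ M * Real.exp (ν * |t|)) (t : ℝ) {s : ℝ} (hs : s ∈ Set.Icc (-1 : ℝ) 1) :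
    |charIntD G t s| ≤ 2 * M * Real.exp q * Real.exp (ν * |t|) := by
  have h1 := abs_integral_characteristic_le hM hν
    (fun t s _ => (abs_evalD_le (G t) s).trans (hG t)) t hs
  have h2 := (abs_evalC1_le (G (t + s)) 0).trans (hG (t + s))
  have h3 := mul_le_mul_of_nonneg_left
    (exp_mul_abs_add_le_of_abs_le_one (t := t) hν (abs_le.2 hs)) hM
  refine (abs_add_le _ _).trans ?_
  linarith

end Transport

/-! ### Smoothing by the kernel -/

section KernelSmoothing

open MeasureTheory Filter Topology

variable (γ τ k₀ : ℝ)

/-- Convolution with the kernel in terms of the Duhamel integral. -/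
theorem conv_kern_eq_duhamel {u : ℝ → ℝ} (hu : Continuous u) (t : ℝ) :
    conv (kern γ τ k₀) u t = γ * τ ^ 2 / k₀ *
      ((∫ x in (0 : ℝ)..(t + 1), Real.sin (k₀ * (t + 1 - x)) * u x)
        + (∫ x in (0 : ℝ)..(t - 1), Real.sin (k₀ * (t - 1 - x)) * u x)
        - 2 * Real.cos k₀ * ∫ x in (0 : ℝ)..t, Real.sin (k₀ * (t - x)) * u x) := by
  rw [conv_kern γ τ k₀ hu]
  congr 1
  have hi : ∀ (c a b : ℝ), IntervalIntegrable (fun x => Real.sin (k₀ * (c - x)) * u x)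
      volume a b := fun c a b => Continuous.intervalIntegrable (by fun_prop) _ _
  have h1 : ∫ s in (0 : ℝ)..1, Real.sin (k₀ * (1 - s)) * u (t + s) =
      ∫ x in t..(t + 1), Real.sin (k₀ * (t + 1 - x)) * u x := by
    have := intervalIntegral.integral_comp_add_left (a := (0 : ℝ)) (b := 1)
      (fun x => Real.sin (k₀ * (t + 1 - x)) * u x) t
    rw [add_zero] at this
    rw [← this]
    congr 1
    funext s
    rw [add_sub_add_left_eq_sub]
  have h2 : ∫ s in (0 : ℝ)..1, Real.sin (k₀ * (1 - s)) * u (t - s) =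
      -∫ x in (t - 1)..t, Real.sin (k₀ * (t - 1 - x)) * u x := by
    have := intervalIntegral.integral_comp_sub_left (a := (0 : ℝ)) (b := 1)
      (fun x => Real.sin (k₀ * (t - 1 - x)) * u x) t
    rw [sub_zero] at this
    rw [← this, ← intervalIntegral.integral_neg]
    congr 1
    funext s
    rw [show k₀ * (t - 1 - (t - s)) = -(k₀ * (1 - s)) by ring, Real.sin_neg]
    ring
  have h3 : ∫ s in (0 : ℝ)..1, Real.sin (k₀ * (1 - s)) * (u (t + s) + u (t - s)) =
      (∫ s in (0 : ℝ)..1, Real.sin (k₀ * (1 - s)) * u (t + s))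
        + ∫ s in (0 : ℝ)..1, Real.sin (k₀ * (1 - s)) * u (t - s) := by
    rw [← intervalIntegral.integral_add (Continuous.intervalIntegrable (by fun_prop) _ _)
      (Continuous.intervalIntegrable (by fun_prop) _ _)]
    simp only [mul_add]
  have h4 : (∫ x in (0 : ℝ)..t, Real.sin (k₀ * (t + 1 - x)) * u x)
      + (∫ x in (0 : ℝ)..t, Real.sin (k₀ * (t - 1 - x)) * u x) =
      2 * Real.cos k₀ * ∫ x in (0 : ℝ)..t, Real.sin (k₀ * (t - x)) * u x := by
    rw [← intervalIntegral.integral_add (hi _ _ _) (hi _ _ _),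
      ← intervalIntegral.integral_const_mul]
    congr 1
    funext x
    rw [show k₀ * (t + 1 - x) = k₀ * (t - x) + k₀ by ring,
      show k₀ * (t - 1 - x) = k₀ * (t - x) - k₀ by ring, Real.sin_add, Real.sin_sub]
    ring
  have h5 := intervalIntegral.integral_interval_sub_left (hi (t + 1) 0 (t + 1)) (hi (t + 1) 0 t)
  have h6 := intervalIntegral.integral_interval_sub_left (hi (t - 1) 0 t) (hi (t - 1) 0 (t - 1))
  rw [h3, h1, h2]
  linarith

/-- The sine Duhamel integral of a continuous function is C¹. This upgrades a continuous solution of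
u = θ * u - F to a C¹ one when F is C¹. -/
theorem exists_hasDerivAt_conv_kern {u : ℝ → ℝ} (hu : Continuous u) :
    ∃ d : ℝ → ℝ, Continuous d ∧ ∀ t, HasDerivAt (conv (kern γ τ k₀) u) (d t) t := by
  have hD := fun s => (hasDerivAt_duhamel (k₀ := k₀) hu s).2
  have hC : Continuous fun s => ∫ r in (0 : ℝ)..s, Real.cos (k₀ * (s - r)) * u r :=
    continuous_iff_continuousAt.2 fun s =>
      (hasDerivAt_duhamel (k₀ := k₀) hu s).1.continuousAt
  set C : ℝ → ℝ := fun s => ∫ r in (0 : ℝ)..s, Real.cos (k₀ * (s - r)) * u r with hCdef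
  have hD' : ∀ s, HasDerivAt (fun s => ∫ r in (0 : ℝ)..s, Real.sin (k₀ * (s - r)) * u r)
    (k₀ * C s) s := hD
  refine ⟨fun t => γ * τ ^ 2 / k₀ * (k₀ * C (t + 1) + k₀ * C (t - 1)
    - 2 * Real.cos k₀ * (k₀ * C t)), by fun_prop, fun t => ?_⟩
  have h := ((((hD' (t + 1)).comp_add_const t 1).add ((hD' (t - 1)).comp_sub_const t 1)).sub
    ((hD' t).const_mul (2 * Real.cos k₀))).const_mul (γ * τ ^ 2 / k₀)
  exact h.congr_of_eventuallyEq
    (Eventually.of_forall fun t => conv_kern_eq_duhamel γ τ k₀ hu t)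

/-- For W(t,s) = u(t+s) the constraint k₀u = sinF(W) is therefore the convolution equation u = θ *
u. -/
theorem conv_kern_eq_sinF {u : ℝ → ℝ} (hu : Continuous u) (t : ℝ) :
    conv (kern γ τ k₀) u t =
      k₀⁻¹ * sinF γ τ k₀ (restr (fun s => u (t + s)) (by fun_prop)) := by
  rw [conv_kern γ τ k₀ hu, sinF_congr γ τ k₀ (w := fun s => u (t + s)) fun s => rfl]
  simp only [← sub_eq_add_neg]
  ring

end KernelSmoothing

/-! ### Pointwise use of the weighted norm -/

section WeightedNorm

variable {ν : ℝ} {X : Type*} [NormedAddCommGroup X] [NormedSpace ℝ X]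

theorem E0.exp_mul_norm_le (f : E0 ν X) (t : ℝ) : Real.exp (-ν * |t|) * ‖f t‖ ≤ ‖f‖ := by
  have h := (E0.weight ν X f).norm_coe_le_norm t
  change ‖Real.exp (-ν * |t|) • f t‖ ≤ _ at h
  rwa [norm_smul, Real.norm_eq_abs, abs_of_pos (Real.exp_pos _)] at h

theorem exp_neg_mul_le_iff {a C t : ℝ} :
    Real.exp (-ν * |t|) * a ≤ C ↔ a ≤ C * Real.exp (ν * |t|) := by
  rw [neg_mul, Real.exp_neg, inv_mul_le_iff₀ (Real.exp_pos _), mul_comm]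

theorem E0.norm_apply_le (f : E0 ν X) (t : ℝ) : ‖f t‖ ≤ ‖f‖ * Real.exp (ν * |t|) :=
  exp_neg_mul_le_iff.1 (f.exp_mul_norm_le t)

theorem E0.norm_le {f : E0 ν X} {C : ℝ} (hC : 0 ≤ C)
    (h : ∀ t, ‖f t‖ ≤ C * Real.exp (ν * |t|)) : ‖f‖ ≤ C := by
  refine (BoundedContinuousFunction.norm_le hC (f := E0.weight ν X f)).2 fun t => ?_
  change ‖Real.exp (-ν * |t|) • f t‖ ≤ _
  rw [norm_smul, Real.norm_eq_abs, abs_of_pos (Real.exp_pos _)]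
  exact exp_neg_mul_le_iff.2 (h t)

/-- The element of `E^ν_0(X)` given by a continuous function of controlled growth. -/
def E0.mk (f : ℝ → X) (hf : Continuous f) {C : ℝ} (h : ∀ t, ‖f t‖ ≤ C * Real.exp (ν * |t|)) :
    E0 ν X :=
  ⟨f, hf, C, fun t => exp_neg_mul_le_iff.2 (h t)⟩

theorem E0.ext_apply {f g : E0 ν X} (h : ∀ t, f t = g t) : f = g := Subtype.ext (funext h)

theorem E0.continuous (f : E0 ν X) : Continuous f.1 := f.2.1

end WeightedNorm

/-! ### Existence and uniqueness for the evolution equation -/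

section Solution

open MeasureTheory Filter Topology

variable {γ τ k₀ : ℝ}

theorem InDelta0.exists_resolvent (h : InDelta0 γ τ k₀) (hγ : 0 < γ) (hτ : 0 < τ) {p : ℝ}
    (hp0 : 0 ≤ p) (hp : ((p : ℝ) : EReal) < p0 γ τ) :
    ∃ (r : ℝ → ℝ) (B : ℝ), Continuous r ∧ (∀ t, |r t| ≤ B * Real.exp (-p * |t|)) ∧
      ∀ t, r t = kern γ τ k₀ t + conv (kern γ τ k₀) r t := by
  obtain ⟨M, hM⟩ := exists_norm_laplace_kern_le (γ := γ) (τ := τ) h.pos.ne' p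
  exact exists_resolvent_kernel (continuous_kern γ τ k₀) (integrable_kern γ τ k₀)
    (differentiable_laplace_kern γ τ k₀) hp0 hM fun z hz =>
      h.laplace_kern_ne_one hγ hτ (lt_of_le_of_lt (EReal.coe_le_coe_iff.2 hz) hp)

/-- The first component of the solution: it solves the convolution equation that expresses that
the solution has no centre part. -/
theorem exists_profile (hk : 0 < k₀) {p q ν M B : ℝ} {r : ℝ → ℝ} {G : ℝ → C1 ℝ}
    (hp : 0 ≤ p) (hr : Continuous r) (hB : ∀ t, |r t| ≤ B * Real.exp (-p * |t|))
    (hres : ∀ t, r t = kern γ τ k₀ t + conv (kern γ τ k₀) r t) (hν : |ν| ≤ q) (hq : q < p)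
    (hG : Continuous G) (hM : 0 ≤ M) (hGM : ∀ t, ‖G t‖ ≤ M * Real.exp (ν * |t|)) :
    ∃ u u' : ℝ → ℝ, Continuous u' ∧ (∀ t, HasDerivAt u (u' t) t) ∧
      (∀ t, |u t| ≤ k₀⁻¹ * (|γ * τ ^ 2| * 2 * Real.exp q) *
        (1 + B * ∫ x, Real.exp (-(p - q) * |x|)) * M * Real.exp (ν * |t|)) ∧
      ∀ t (hc : Continuous fun s => u (t + s) - charInt G t s),
        k₀ * u t = sinF γ τ k₀ (restr (fun s => u (t + s) - charInt G t s) hc) := by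
  have hch := continuous_charInt hG
  have hchD : Continuous (Function.uncurry fun t s => charIntD G t s - extC1 (G t) s) :=
    (continuous_charIntD hG).sub (continuous_uncurry_extC1 hG)
  have hch1 : ∀ t, Continuous (charInt G t) := fun t => hch.comp (Continuous.prodMk_right t)
  -- The contribution of the forcing to k₀u = sinF(W), which becomes u = θ * u - F.
  set F : ℝ → ℝ := fun t => k₀⁻¹ * sinF γ τ k₀ (restr (charInt G t) (hch1 t)) with hF
  set F' : ℝ → ℝ := fun t => k₀⁻¹ * sinF γ τ k₀ (restr (fun s => charIntD G t s - extC1 (G t) s)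
    (hchD.comp (Continuous.prodMk_right t))) with hF'
  have hFd : ∀ t, HasDerivAt F (F' t) t := fun t =>
    ((sinF γ τ k₀).hasFDerivAt.comp_hasDerivAt t (hasDerivAt_restr hch hchD
      (hasDerivAt_charInt_fst hG) t)).const_mul k₀⁻¹
  have hF'c : Continuous F' :=
    continuous_const.mul ((sinF γ τ k₀).continuous.comp (continuous_restr hchD))
  have hFc : Continuous F := continuous_iff_continuousAt.2 fun t => (hFd t).continuousAt
  have hFM : ∀ t, |F t| ≤ k₀⁻¹ * (|γ * τ ^ 2| * 2 * Real.exp q) * M * Real.exp (ν * |t|) := by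
    intro t
    rw [hF]
    simp only
    rw [abs_mul, abs_of_pos (inv_pos.2 hk), mul_assoc, mul_assoc]
    refine mul_le_mul_of_nonneg_left ?_ (inv_pos.2 hk).le
    refine (abs_sinF_le _ _ _ _).trans ?_
    have h1 : ‖restr (charInt G t) (hch1 t)‖ ≤ M * Real.exp q * Real.exp (ν * |t|) :=
      norm_restr_le (by positivity) fun s hs => abs_charInt_le hM hν hGM t hs
    calc |γ * τ ^ 2| * 2 * ‖restr (charInt G t) (hch1 t)‖
        ≤ |γ * τ ^ 2| * 2 * (M * Real.exp q * Real.exp (ν * |t|)) := by gcongr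
      _ = _ := by ring
  have hνp : |ν| < p := lt_of_le_of_lt hν hq
  have hcr := continuous_conv hr hFc hB hFM hνp
  set u : ℝ → ℝ := fun t => -(F t + conv r F t) with hu
  have huc : Continuous u := (hFc.add hcr).neg
  have hueq : ∀ t, u t = conv (kern γ τ k₀) u t - F t := by
    intro t
    rw [hu, conv_resolvent_solves (continuous_kern γ τ k₀) hr (abs_kern_le γ τ k₀ hp) hB hres hFc
      hFM hνp t]
    ring
  -- So far u is only continuous; its equation now shows that it is C¹.
  obtain ⟨d, hdc, hd⟩ := exists_hasDerivAt_conv_kern γ τ k₀ huc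
  refine ⟨u, fun t => d t - F' t, hdc.sub hF'c, fun t => ?_, fun t => ?_, fun t hc => ?_⟩
  · exact ((hd t).sub (hFd t)).congr_of_eventuallyEq (Eventually.of_forall hueq)
  · have h1 := hFM t
    have h2 := abs_conv_le hB hFM hν hq t
    rw [hu]
    simp only
    rw [abs_neg]
    refine (abs_add_le _ _).trans ((add_le_add h1 h2).trans (le_of_eq ?_))
    ring
  · have h1 := hueq t
    rw [conv_kern_eq_sinF γ τ k₀ huc, hF] at h1
    simp only at h1
    have h2 : restr (fun s => u (t + s) - charInt G t s) hc =
        restr (fun s => u (t + s)) (by fun_prop) - restr (charInt G t) (hch1 t) := by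
      ext s
      rfl
    rw [h2, map_sub, h1]
    field_simp

theorem norm_C1_le {W : C1 ℝ} {a : ℝ} (h1 : ‖toC0 W‖ ≤ a) (h2 : ‖derivC1 W‖ ≤ a) : ‖W‖ ≤ a :=
  max_le h1 h2

theorem norm_DD_le {U : DD ℝ} {a : ℝ} (h1 : |U.1.1| ≤ a) (h2 : |U.1.2.1| ≤ a)
    (h3 : ‖U.1.2.2‖ ≤ a) : ‖U‖ ≤ a :=
  max_le h1 (max_le h2 h3)

theorem norm_C1_le_norm_DD (U : DD ℝ) : ‖U.1.2.2‖ ≤ ‖U‖ :=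
  (le_max_right _ _).trans (le_max_right _ _)

theorem abs_fst_le_norm_DD (U : DD ℝ) : |U.1.1| ≤ ‖U‖ := le_max_left _ _

/-- The constant in the estimate of the solution operator. -/
noncomputable def solBound (κ k q c : ℝ) : ℝ :=
  k⁻¹ * (κ * 2 * Real.exp q) * c
    + κ * 2 * ((k⁻¹ * (κ * 2 * Real.exp q) * c + 1) * Real.exp q)
    + (k⁻¹ * (κ * 2 * Real.exp q) * c + 1) * Real.exp q
    + (κ * 2 * ((k⁻¹ * (κ * 2 * Real.exp q) * c + 1) * Real.exp q) + 1 + 2) * Real.exp q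

/-- The profile u determines W by transport, and v is defined by its constraint. The first two
components of the evolution equation then follow by differentiating the constraints. The bound uses
only the third component of G, as the operator on the space of G₂ requires. -/
theorem InDelta0.exists_solution_of_resolvent (h : InDelta0 γ τ k₀) {P : HH ℝ →L[ℝ] HH ℝ}
    (hP : IsCentreProjection γ τ k₀ P) {p q ν M B : ℝ} {r : ℝ → ℝ}
    (hp : 0 ≤ p) (hr : Continuous r) (hB : ∀ t, |r t| ≤ B * Real.exp (-p * |t|))
    (hres : ∀ t, r t = kern γ τ k₀ t + conv (kern γ τ k₀) r t) (hν : |ν| ≤ q) (hq : q < p)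
    (G : E0 ν (QhD P)) (hM : 0 ≤ M) (hGM : ∀ t, ‖(G t).1.1.2.2‖ ≤ M * Real.exp (ν * |t|)) :
    ∃ U : E0 ν (QhD P), IsSolution γ τ G U ∧
      ‖U‖ ≤ solBound |γ * τ ^ 2| k₀ q (1 + B * ∫ x, Real.exp (-(p - q) * |x|)) * M := by
  have hk := h.pos
  set g : ℝ → C1 ℝ := fun t => (G t).1.1.2.2 with hg
  have hGv : Continuous fun t => (G t).1.1 :=
    (continuous_val ℝ).comp (continuous_subtype_val.comp G.continuous)
  have hgc : Continuous g := continuous_snd.comp (continuous_snd.comp hGv)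
  have hGm := fun t => (h.mem_QhD_iff hP).1 (G t).2
  obtain ⟨u, u', hu'c, hud, hub, hueq⟩ :=
    exists_profile hk hp hr hB hres hν hq hgc hM hGM
  set κ : ℝ := |γ * τ ^ 2| with hκ
  set c : ℝ := 1 + B * ∫ x, Real.exp (-(p - q) * |x|) with hc
  have hκ0 : 0 ≤ κ := abs_nonneg _
  have hB0 : 0 ≤ B := by simpa using (abs_nonneg _).trans (hB 0)
  have hI0 : 0 ≤ ∫ x, Real.exp (-(p - q) * |x|) := integral_nonneg fun x => (Real.exp_pos _).le
  have hc0 : 0 ≤ c := by positivity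
  have hki : 0 < k₀⁻¹ := inv_pos.2 hk
  set c₂ : ℝ := k₀⁻¹ * (κ * 2 * Real.exp q) * c with hc₂
  have hc₂0 : 0 ≤ c₂ := by positivity
  set c₃ : ℝ := (c₂ + 1) * Real.exp q with hc₃
  have hc₃0 : 0 ≤ c₃ := by positivity
  have huc : Continuous u := continuous_iff_continuousAt.2 fun t => (hud t).continuousAt
  set w : ℝ → ℝ → ℝ := fun t s => u (t + s) - charInt g t s with hw
  set w' : ℝ → ℝ → ℝ := fun t s => u' (t + s) - charIntD g t s with hw'
  have hwc : Continuous (Function.uncurry w) :=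
    (huc.comp (continuous_fst.add continuous_snd)).sub (continuous_charInt hgc)
  have hw'c : Continuous (Function.uncurry w') :=
    (hu'c.comp (continuous_fst.add continuous_snd)).sub (continuous_charIntD hgc)
  have hwtc : Continuous (Function.uncurry fun t s => w' t s + extC1 (g t) s) :=
    hw'c.add (continuous_uncurry_extC1 hgc)
  have hws : ∀ t s, HasDerivAt (w t) (w' t s) s := fun t s =>
    ((hud (t + s)).comp_const_add t s).sub (hasDerivAt_charInt_snd hgc t s)
  have hwt : ∀ t s, HasDerivAt (fun t => w t s) (w' t s + extC1 (g t) s) t := fun t s =>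
    (((hud (t + s)).comp_add_const t s).sub (hasDerivAt_charInt_fst hgc t s)).congr_deriv (by
      simp only [hw']
      ring)
  set Z : ℝ → C1 ℝ := fun t =>
    mkC1 (w t) (w' t) (hws t) (hw'c.comp (Continuous.prodMk_right t)) with hZ
  have hZc : Continuous Z :=
    ((continuous_restr hwc).prodMk (continuous_restr hw'c)).subtype_mk _
  have hZ0 : ∀ t, evalC1 (Z t) 0 = u t := fun t => by
    refine (evalC1_mkC1 (hws t) (hw'c.comp (Continuous.prodMk_right t)) zero_mem_I).trans ?_
    simp only [hw]
    rw [charInt_zero, add_zero, sub_zero]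
  have hZd : ∀ t, HasDerivAt (fun t => toC0 (Z t)) (derivC1 (Z t) + toC0 (g t)) t := fun t => by
    refine (hasDerivAt_restr hwc hwtc hwt t).congr_deriv ?_
    ext s
    change w' t s + extC1 (g t) s = w' t s + toC0 (g t) s
    rw [toC0_eq_extC1]
  have hku : ∀ t, k₀ * u t = sinF γ τ k₀ (toC0 (Z t)) := fun t =>
    hueq t (hwc.comp (Continuous.prodMk_right t))
  set v : ℝ → ℝ := fun t => cosF γ τ k₀ (toC0 (Z t)) with hv
  -- Differentiating k₀u = sinF(W) gives k₀u' = sinF(W' + G₂) = k₀(v + G₀), by integration by parts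
  -- and the constraint on G.
  have hu'eq : ∀ t, u' t = v t + (G t).1.1.1 := by
    intro t
    have h1 := (sinF γ τ k₀).hasFDerivAt.comp_hasDerivAt t (hZd t)
    have h2 : HasDerivAt (fun t => k₀ * u t) (sinF γ τ k₀ (derivC1 (Z t) + toC0 (g t))) t :=
      h1.congr_of_eventuallyEq (Eventually.of_forall hku)
    have h3 := h2.unique ((hud t).const_mul k₀)
    rw [map_add, sinF_derivC1, ← (hGm t).2, ← mul_add] at h3
    exact (mul_left_cancel₀ hk.ne' h3).symm
  have hvd : ∀ t, HasDerivAt v (cosF γ τ k₀ (derivC1 (Z t)) + cosF γ τ k₀ (toC0 (g t))) t :=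
    fun t => ((cosF γ τ k₀).hasFDerivAt.comp_hasDerivAt t (hZd t)).congr_deriv
      (map_add (cosF γ τ k₀) _ _)
  have hvc : Continuous v := continuous_iff_continuousAt.2 fun t => (hvd t).continuousAt
  have hshift : ∀ {t s : ℝ}, s ∈ Set.Icc (-1 : ℝ) 1 →
      Real.exp (ν * |t + s|) ≤ Real.exp q * Real.exp (ν * |t|) := fun hs =>
    exp_mul_abs_add_le_of_abs_le_one hν (abs_le.2 hs)
  have hZb : ∀ t, ‖toC0 (Z t)‖ ≤ c₃ * M * Real.exp (ν * |t|) := by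
    intro t
    refine (ContinuousMap.norm_le _ (by positivity)).2 fun s => ?_
    change |u (t + s) - charInt g t s| ≤ _
    have h1 := hub (t + s)
    have h2 := mul_le_mul_of_nonneg_left (hshift (t := t) s.2) (mul_nonneg hc₂0 hM)
    have h3 := abs_charInt_le hM hν hGM t s.2
    refine (abs_sub _ _).trans ?_
    calc |u (t + s)| + |charInt g t s|
        ≤ c₂ * M * (Real.exp q * Real.exp (ν * |t|)) + M * Real.exp q * Real.exp (ν * |t|) :=
          add_le_add (h1.trans h2) h3
      _ = c₃ * M * Real.exp (ν * |t|) := by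
          rw [hc₃]
          ring
  have hvb : ∀ t, |v t| ≤ κ * 2 * c₃ * M * Real.exp (ν * |t|) := by
    intro t
    refine (abs_cosF_le γ τ k₀ (toC0 (Z t))).trans ?_
    calc |γ * τ ^ 2| * 2 * ‖toC0 (Z t)‖ ≤ κ * 2 * (c₃ * M * Real.exp (ν * |t|)) :=
          mul_le_mul_of_nonneg_left (hZb t) (by positivity)
      _ = _ := by ring
  have hu'b : ∀ t, |u' t| ≤ (κ * 2 * c₃ + 1) * M * Real.exp (ν * |t|) := by
    intro t
    rw [hu'eq t]
    -- G₀ = G₂(t,0) by membership in 𝔻, so it is controlled by the bound on G₂.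
    have h1 : |(G t).1.1.1| ≤ M * Real.exp (ν * |t|) := by
      rw [← DD_evalC1_zero]
      exact (abs_evalC1_le _ _).trans (hGM t)
    refine (abs_add_le _ _).trans ((add_le_add (hvb t) h1).trans (le_of_eq ?_))
    ring
  have hZ'b : ∀ t, ‖derivC1 (Z t)‖ ≤
      (κ * 2 * c₃ + 1 + 2) * Real.exp q * M * Real.exp (ν * |t|) := by
    intro t
    refine (ContinuousMap.norm_le _ (by positivity)).2 fun s => ?_
    change |u' (t + s) - charIntD g t s| ≤ _
    have h1 := hu'b (t + s)
    have h2 := mul_le_mul_of_nonneg_left (hshift (t := t) s.2)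
      (show 0 ≤ (κ * 2 * c₃ + 1) * M by positivity)
    have h3 := abs_charIntD_le hM hν hGM t s.2
    refine (abs_sub _ _).trans ?_
    calc |u' (t + s)| + |charIntD g t s|
        ≤ (κ * 2 * c₃ + 1) * M * (Real.exp q * Real.exp (ν * |t|))
          + 2 * M * Real.exp q * Real.exp (ν * |t|) := add_le_add (h1.trans h2) h3
      _ = _ := by ring
  have hUm : ∀ t, mkDD (u t) (v t) (Z t) (hZ0 t) ∈ QhD P := fun t =>
    (h.mem_QhD_iff hP).2 ⟨rfl, hku t⟩
  set U₀ : ℝ → QhD P := fun t => ⟨mkDD (u t) (v t) (Z t) (hZ0 t), hUm t⟩ with hU₀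
  have hU₀c : Continuous U₀ :=
    ((huc.prodMk (hvc.prodMk hZc)).subtype_mk hZ0).subtype_mk hUm
  set C : ℝ := c₂ + κ * 2 * c₃ + c₃ + (κ * 2 * c₃ + 1 + 2) * Real.exp q with hC
  have hU₀b : ∀ t, ‖U₀ t‖ ≤ C * M * Real.exp (ν * |t|) := by
    intro t
    have hle : ∀ {a : ℝ}, a ≤ C → a * M * Real.exp (ν * |t|) ≤ C * M * Real.exp (ν * |t|) :=
      fun ha => by gcongr
    have e1 : 0 ≤ κ * 2 * c₃ := by positivity
    have e2 : 0 ≤ (κ * 2 * c₃ + 1 + 2) * Real.exp q := by positivity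
    refine norm_DD_le ((hub t).trans (hle ?_)) ((hvb t).trans (hle ?_))
      (norm_C1_le ((hZb t).trans (hle ?_)) ((hZ'b t).trans (hle ?_)))
    all_goals
      rw [hC]
      linarith
  have hC0 : 0 ≤ C := by positivity
  have hder : ∀ t, HasDerivAt (fun t => incl ℝ (U₀ t).1)
      (LL ℝ γ τ (U₀ t).1 + incl ℝ (G t).1) t := by
    intro t
    refine ((hud t).prodMk ((hvd t).prodMk (hZd t))).congr_deriv ?_
    rw [LL_real_apply]
    refine Prod.ext (hu'eq t) (Prod.ext ?_ rfl)
    change cosF γ τ k₀ (derivC1 (Z t)) + cosF γ τ k₀ (toC0 (g t)) =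
      (-(τ ^ 2 * (1 + 2 * γ)) * u t + γ * τ ^ 2 * (evalC1 (Z t) 1 + evalC1 (Z t) (-1)))
        + (G t).1.1.2.1
    rw [cosF_derivC1, ← hku t, hZ0 t, (hGm t).1, h.relation]
    ring
  refine ⟨E0.mk U₀ hU₀c hU₀b, ⟨?_, hder⟩, E0.norm_le (by positivity) hU₀b⟩
  -- Q_h fixes the solution, so the curve in Q_h ℍ is a bounded linear image of the curve in ℍ and
  -- inherits its C¹ regularity.
  have hQ : (fun t => inclQh P (U₀ t)) = fun t =>
      ((Qh P).codRestrict (QhH P) fun x => ⟨x, rfl⟩) (incl ℝ (U₀ t).1) := by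
    funext t
    refine Subtype.ext ?_
    change incl ℝ (U₀ t).1 = incl ℝ (U₀ t).1 - P (incl ℝ (U₀ t).1)
    rw [hP.mem_QhD_iff.1 (U₀ t).2, sub_zero]
  change ContDiff ℝ 1 fun t => inclQh P (U₀ t)
  rw [hQ]
  refine ContinuousLinearMap.contDiff _ |>.comp ?_
  rw [contDiff_one_iff_deriv]
  refine ⟨fun t => (hder t).differentiableAt, ?_⟩
  have hd : deriv (fun t => incl ℝ (U₀ t).1) =
      fun t => LL ℝ γ τ (U₀ t).1 + incl ℝ (G t).1 := funext fun t => (hder t).deriv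
  rw [hd]
  exact ((LL ℝ γ τ).continuous.comp (continuous_subtype_val.comp hU₀c)).add
    ((incl ℝ).continuous.comp (continuous_subtype_val.comp G.continuous))

/-- A `C¹[-1,1]`-valued solution of the homogeneous transport equation depends on `t + s` only. -/
theorem toC0_eq_of_transport {W : ℝ → C1 ℝ} (hW : Continuous W)
    (h : ∀ t, HasDerivAt (fun t => toC0 (W t)) (derivC1 (W t)) t) (t : ℝ) (s : I) :
    toC0 (W t) s = evalC1 (W (t + s)) 0 := by
  have hIoo : ∀ t, ∀ s ∈ Set.Ioo (-1 : ℝ) 1, evalC1 (W t) s = evalC1 (W (t + s)) 0 := by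
    intro t s hs
    have hx : ∀ σ ∈ Set.Ioo (-1 : ℝ) 1,
        HasDerivAt (fun σ => evalC1 (W (t + s - σ)) σ) 0 σ := by
      intro σ hσ
      -- `evalC1` is differentiable in s only inside (-1,1). The chain rule needs the partial
      -- derivatives just near the point, and the endpoints are recovered by continuity.
      have hev : ∀ᶠ v : ℝ × ℝ in 𝓝 (t + s - σ, σ), v.2 ∈ Set.Ioo (-1 : ℝ) 1 :=
        continuous_snd.continuousAt.eventually (isOpen_Ioo.mem_nhds hσ)
      have h1 := hasDerivAt_comp_two (Φ := fun t s => evalC1 (W t) s)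
        (Φ₁ := fun t s => evalD (W t) s) (Φ₂ := fun t s => evalD (W t) s)
        (α := fun σ => t + s - σ) (β := fun σ => σ) (x := σ) (α' := -1) (β' := 1)
        (hev.mono fun v hv => ?_) (hev.mono fun v hv => ?_)
        (continuous_uncurry_evalD hW) (continuous_uncurry_evalD hW)
        ((hasDerivAt_id σ).const_sub (t + s)) (hasDerivAt_id σ)
      · exact h1.congr_deriv (by ring)
      · have hv' := Set.Ioo_subset_Icc_self hv
        have h2 := (ContinuousMap.evalCLM ℝ (⟨v.2, hv'⟩ : I)).hasFDerivAt.comp_hasDerivAt v.1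
          (h v.1)
        have h3 : (fun t => evalC1 (W t) v.2) = fun t => toC0 (W t) ⟨v.2, hv'⟩ :=
          funext fun t => ext_of_mem _ hv'
        rw [h3, evalD, ext_of_mem _ hv']
        exact h2
      · have hn : Set.Icc (-1 : ℝ) 1 ∈ 𝓝 v.2 := Icc_mem_nhds hv.1 hv.2
        refine (hasDerivAt_extC1 (W v.1) v.2).congr_of_eventuallyEq ?_
        filter_upwards [hn] with y hy
        exact (extC1_eq _ hy).symm
    have hc := isOpen_Ioo.is_const_of_deriv_eq_zero isPreconnected_Ioo
      (fun σ hσ => (hx σ hσ).differentiableAt.differentiableWithinAt)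
      (fun σ hσ => (hx σ hσ).deriv) hs (show (0 : ℝ) ∈ Set.Ioo (-1 : ℝ) 1 by norm_num)
    simpa using hc
  have hcl : Set.EqOn (fun s => evalC1 (W t) s) (fun s => evalC1 (W (t + s)) 0)
      (closure (Set.Ioo (-1 : ℝ) 1)) :=
    Set.EqOn.closure (hIoo t) (evalC1_continuous _)
      ((continuous_evalC1_const hW 0).comp (continuous_const.add continuous_id))
  rw [closure_Ioo (by norm_num)] at hcl
  have h1 := hcl s.2
  simp only at h1
  rw [← h1]
  exact (ext_of_mem _ s.2).symm

/-- Without forcing, W(t,s) = u(t+s), so the constraint on u is u = θ * u and the resolvent kernel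
forces u = 0. Then W = 0, and v = cosF(W) = 0. -/
theorem InDelta0.eq_zero_of_hasDerivAt (h : InDelta0 γ τ k₀) (hγ : 0 < γ) (hτ : 0 < τ)
    {P : HH ℝ →L[ℝ] HH ℝ} (hP : IsCentreProjection γ τ k₀ P) {ν : ℝ}
    (hν : ((|ν| : ℝ) : EReal) < p0 γ τ) {U : E0 ν (QhD P)}
    (hU : ∀ t, HasDerivAt (fun t => incl ℝ (U t).1) (LL ℝ γ τ (U t).1) t) : U = 0 := by
  obtain ⟨p, hp1, hp2⟩ := EReal.lt_iff_exists_real_btwn.1 hν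
  have hνp : |ν| < p := EReal.coe_lt_coe_iff.1 hp1
  have hp0 : 0 ≤ p := (abs_nonneg ν).trans hνp.le
  obtain ⟨r, B, hr, hB, hres⟩ := h.exists_resolvent hγ hτ hp0 hp2
  have hUv : Continuous fun t => (U t).1.1 :=
    (continuous_val ℝ).comp (continuous_subtype_val.comp U.continuous)
  have hWc : Continuous fun t => (U t).1.1.2.2 := continuous_snd.comp (continuous_snd.comp hUv)
  have huc : Continuous fun t => (U t).1.1.1 := continuous_fst.comp hUv
  have hUm := fun t => (h.mem_QhD_iff hP).1 (U t).2
  have htr : ∀ t (s : I), toC0 (U t).1.1.2.2 s = (U (t + s)).1.1.1 := by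
    intro t s
    have hd : ∀ t, HasDerivAt (fun t => toC0 (U t).1.1.2.2) (derivC1 (U t).1.1.2.2) t := fun t =>
      ((ContinuousLinearMap.snd ℝ ℝ C(I, ℝ)).comp
        (ContinuousLinearMap.snd ℝ ℝ (ℝ × C(I, ℝ)))).hasFDerivAt.comp_hasDerivAt t (hU t)
    rw [toC0_eq_of_transport hWc hd t s, DD_evalC1_zero]
  have hconv : conv (kern γ τ k₀) (fun t => (U t).1.1.1) = fun t => (U t).1.1.1 := by
    funext t
    rw [conv_kern_eq_sinF γ τ k₀ huc]
    have h1 : restr (fun s => (U (t + s)).1.1.1)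
        (huc.comp (continuous_const.add continuous_id)) = toC0 (U t).1.1.2.2 := by
      ext s
      exact (htr t s).symm
    rw [h1, ← (hUm t).2, inv_mul_cancel_left₀ h.pos.ne']
  have hzero := eq_zero_of_conv_eq_self (continuous_kern γ τ k₀) hr (abs_kern_le γ τ k₀ hp0) hB hres
    huc (fun t => (abs_fst_le_norm_DD (U t).1).trans (U.norm_apply_le t)) hνp hconv
  have hz : ∀ t, (U t).1.1.1 = 0 := fun t => congrFun hzero t
  refine E0.ext_apply fun t => Subtype.ext (incl_injective ?_)
  have hW : toC0 (U t).1.1.2.2 = 0 := by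
    ext s
    rw [htr, hz]
    rfl
  refine Prod.ext (hz t) (Prod.ext ?_ hW)
  change (U t).1.1.2.1 = 0
  rw [(hUm t).1, hW, map_zero]

end Solution

/-! ### The isomorphism J, the solution operator and a continuous bound -/

section SolutionOperator

open MeasureTheory Filter Topology

variable {γ τ k₀ ν : ℝ} {P : HH ℝ →L[ℝ] HH ℝ}

theorem continuous_cosF_toC0 {W : ℝ → C1 ℝ} (hW : Continuous W) :
    Continuous fun t => cosF γ τ k₀ (toC0 (W t)) :=
  (cosF γ τ k₀).continuous.comp ((continuous_toC0 ℝ).comp hW)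

theorem norm_mkDD_cosF_le (W : C1 ℝ) :
    ‖mkDD (evalC1 W 0) (cosF γ τ k₀ (toC0 W)) W rfl‖ ≤ (1 + |γ * τ ^ 2| * 2) * ‖W‖ := by
  have h0 : 0 ≤ |γ * τ ^ 2| * 2 * ‖W‖ := by positivity
  have h1 : ‖W‖ ≤ (1 + |γ * τ ^ 2| * 2) * ‖W‖ := by linarith
  refine norm_DD_le ((abs_evalC1_le W 0).trans h1) ((abs_cosF_le γ τ k₀ (toC0 W)).trans ?_) h1
  have h2 : |γ * τ ^ 2| * 2 * ‖toC0 W‖ ≤ |γ * τ ^ 2| * 2 * ‖W‖ :=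
    mul_le_mul_of_nonneg_left (le_max_left _ _) (by positivity)
  change |γ * τ ^ 2| * 2 * ‖toC0 W‖ ≤ (1 + |γ * τ ^ 2| * 2) * ‖W‖
  linarith [norm_nonneg W]

/-- The forcing in `E^ν_0(Q_h 𝔻)` that belongs to its third component. -/
noncomputable def InDelta0.forcing (h : InDelta0 γ τ k₀) (hP : IsCentreProjection γ τ k₀ P)
    (G₂ : Adm γ τ k₀ ν) : E0 ν (QhD P) :=
  E0.mk (fun t => ⟨mkDD (evalC1 (G₂.1 t) 0) (cosF γ τ k₀ (toC0 (G₂.1 t))) (G₂.1 t) rfl,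
      (h.mem_QhD_iff hP).2 ⟨rfl, G₂.2 t⟩⟩)
    ((((continuous_evalC1_const G₂.1.continuous 0).prodMk
      ((continuous_cosF_toC0 G₂.1.continuous).prodMk G₂.1.continuous)).subtype_mk _).subtype_mk _)
    (C := (1 + |γ * τ ^ 2| * 2) * ‖G₂‖)
    fun t => (norm_mkDD_cosF_le (G₂.1 t)).trans <| by
      rw [mul_assoc]
      exact mul_le_mul_of_nonneg_left (G₂.1.norm_apply_le t) (by positivity)

theorem InDelta0.norm_forcing_le (h : InDelta0 γ τ k₀) (hP : IsCentreProjection γ τ k₀ P)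
    (G₂ : Adm γ τ k₀ ν) : ‖h.forcing hP G₂‖ ≤ (1 + |γ * τ ^ 2| * 2) * ‖G₂‖ :=
  E0.norm_le (by positivity) fun t => (norm_mkDD_cosF_le (G₂.1 t)).trans <| by
    rw [mul_assoc]
    exact mul_le_mul_of_nonneg_left (G₂.1.norm_apply_le t) (by positivity)

theorem E0.norm_thd_le (G : E0 ν (QhD P)) (t : ℝ) :
    ‖(G t).1.1.2.2‖ ≤ ‖G‖ * Real.exp (ν * |t|) :=
  (norm_C1_le_norm_DD (G t).1).trans (G.norm_apply_le t)

/-- The third component of a forcing in `E^ν_0(Q_h 𝔻)`. -/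
noncomputable def InDelta0.thd (h : InDelta0 γ τ k₀) (hP : IsCentreProjection γ τ k₀ P)
    (G : E0 ν (QhD P)) : Adm γ τ k₀ ν :=
  ⟨E0.mk (fun t => (G t).1.1.2.2)
      (continuous_snd.comp (continuous_snd.comp
        ((continuous_val ℝ).comp (continuous_subtype_val.comp G.continuous))))
      G.norm_thd_le,
    fun t => by
      change k₀ * evalC1 (G t).1.1.2.2 0 = sinF γ τ k₀ (toC0 (G t).1.1.2.2)
      rw [DD_evalC1_zero]
      exact ((h.mem_QhD_iff hP).1 (G t).2).2⟩

theorem InDelta0.norm_thd_le (h : InDelta0 γ τ k₀) (hP : IsCentreProjection γ τ k₀ P)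
    (G : E0 ν (QhD P)) : ‖h.thd hP G‖ ≤ ‖G‖ :=
  E0.norm_le (norm_nonneg G) G.norm_thd_le

/-- The bijection `G₂ ↦ (G₀, G₁, G₂)`, with its algebraic structure. -/
noncomputable def InDelta0.forcingLinearEquiv (h : InDelta0 γ τ k₀)
    (hP : IsCentreProjection γ τ k₀ P) (ν : ℝ) :
    Adm γ τ k₀ ν ≃ₗ[ℝ] E0 ν (QhD P) where
  toFun := h.forcing hP
  map_add' F G := E0.ext_apply fun t => Subtype.ext <| Subtype.ext <|
    Prod.ext rfl (Prod.ext (map_add (cosF γ τ k₀) (toC0 (F.1 t)) (toC0 (G.1 t))) rfl)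
  map_smul' a F := E0.ext_apply fun t => Subtype.ext <| Subtype.ext <|
    Prod.ext rfl (Prod.ext (map_smul (cosF γ τ k₀) a (toC0 (F.1 t))) rfl)
  invFun := h.thd hP
  left_inv _ := rfl
  right_inv G := E0.ext_apply fun t => Subtype.ext <| Subtype.ext <|
    Prod.ext (DD_evalC1_zero (G t).1) (Prod.ext ((h.mem_QhD_iff hP).1 (G t).2).1.symm rfl)

/-- The topological isomorphism `G₂ ↦ (G₀, G₁, G₂)`. -/
noncomputable def InDelta0.forcingEquiv (h : InDelta0 γ τ k₀)
    (hP : IsCentreProjection γ τ k₀ P) (ν : ℝ) : Adm γ τ k₀ ν ≃L[ℝ] E0 ν (QhD P) :=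
  (h.forcingLinearEquiv hP ν).toContinuousLinearEquivOfBounds (1 + |γ * τ ^ 2| * 2) 1
    (h.norm_forcing_le hP) fun G => (h.norm_thd_le hP G).trans_eq (one_mul _).symm

theorem InDelta0.isForcing_forcingEquiv (h : InDelta0 γ τ k₀) (hP : IsCentreProjection γ τ k₀ P)
    (G₂ : Adm γ τ k₀ ν) : IsForcing γ τ k₀ (G₂ : E0 ν (C1 ℝ)) (h.forcingEquiv hP ν G₂) :=
  fun t => ⟨G₂.2 t, rfl, rfl⟩

theorem InDelta0.isSolution_unique (h : InDelta0 γ τ k₀) (hγ : 0 < γ) (hτ : 0 < τ)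
    (hP : IsCentreProjection γ τ k₀ P) (hν : ((|ν| : ℝ) : EReal) < p0 γ τ)
    {G U V : E0 ν (QhD P)}
    (hU : ∀ t, HasDerivAt (fun t => incl ℝ (U t).1) (LL ℝ γ τ (U t).1 + incl ℝ (G t).1) t)
    (hV : ∀ t, HasDerivAt (fun t => incl ℝ (V t).1) (LL ℝ γ τ (V t).1 + incl ℝ (G t).1) t) :
    U = V := by
  refine sub_eq_zero.1 (h.eq_zero_of_hasDerivAt hγ hτ hP hν fun t => ?_)
  have h1 : (fun t => incl ℝ ((U - V) t).1) = fun t => incl ℝ (U t).1 - incl ℝ (V t).1 :=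
    funext fun t => map_sub (incl ℝ) (U t).1 (V t).1
  have h2 : LL ℝ γ τ ((U - V) t).1 = LL ℝ γ τ (U t).1 - LL ℝ γ τ (V t).1 :=
    map_sub (LL ℝ γ τ) (U t).1 (V t).1
  rw [h1, h2]
  exact ((hU t).sub (hV t)).congr_deriv (add_sub_add_right_eq_sub _ _ _)

/-- The claim of the theorem for one weight `ν`, with the constant `C`. -/
def HasSolutionOperator (γ τ k₀ : ℝ) (P : HH ℝ →L[ℝ] HH ℝ) (ν C : ℝ) : Prop :=
  0 ≤ C ∧
    ∃ (J : Adm γ τ k₀ ν ≃L[ℝ] E0 ν (QhD P)) (K : Adm γ τ k₀ ν →L[ℝ] E0 ν (QhD P)),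
      (∀ G₂ : Adm γ τ k₀ ν, IsForcing γ τ k₀ (G₂ : E0 ν (C1 ℝ)) (J G₂)) ∧
      (∀ G₂ : Adm γ τ k₀ ν, IsSolution γ τ (J G₂) (K G₂)) ∧
      (∀ (G₂ : Adm γ τ k₀ ν) (U : E0 ν (QhD P)), IsSolution γ τ (J G₂) U → U = K G₂) ∧
      ‖K‖ ≤ C ∧ ‖K.comp (J.symm : E0 ν (QhD P) →L[ℝ] Adm γ τ k₀ ν)‖ ≤ C

/-- Upward closedness makes the set of admissible constants convex, as the selection argument needs.
-/
theorem HasSolutionOperator.mono {C C' : ℝ} (h : HasSolutionOperator γ τ k₀ P ν C)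
    (hC : C ≤ C') : HasSolutionOperator γ τ k₀ P ν C' := by
  obtain ⟨h0, J, K, h1, h2, h3, h4, h5⟩ := h
  exact ⟨h0.trans hC, J, K, h1, h2, h3, h4.trans hC, h5.trans hC⟩

/-- Solutions are chosen one by one; uniqueness makes the choice linear. The same constant bounds K,
because passing from G to its third component does not increase the norm. -/
theorem InDelta0.hasSolutionOperator (h : InDelta0 γ τ k₀) (hγ : 0 < γ) (hτ : 0 < τ)
    (hP : IsCentreProjection γ τ k₀ P) (hν : ((|ν| : ℝ) : EReal) < p0 γ τ) {C : ℝ} (hC : 0 ≤ C)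
    (hex : ∀ G₂ : Adm γ τ k₀ ν, ∃ U : E0 ν (QhD P),
      IsSolution γ τ (h.forcing hP G₂) U ∧ ‖U‖ ≤ C * ‖G₂‖) :
    HasSolutionOperator γ τ k₀ P ν C := by
  choose S hS hSb using hex
  set J := h.forcingEquiv hP ν with hJ
  have hJa : ∀ G, J G = h.forcing hP G := fun _ => rfl
  let K₀ : Adm γ τ k₀ ν →ₗ[ℝ] E0 ν (QhD P) :=
    { toFun := S
      map_add' := fun F G => by
        refine h.isSolution_unique hγ hτ hP hν (hS (F + G)).2 fun t => ?_
        have h1 : (fun t => incl ℝ ((S F + S G) t).1) =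
            fun t => incl ℝ (S F t).1 + incl ℝ (S G t).1 :=
          funext fun t => map_add (incl ℝ) (S F t).1 (S G t).1
        have h2 : LL ℝ γ τ ((S F + S G) t).1 = LL ℝ γ τ (S F t).1 + LL ℝ γ τ (S G t).1 :=
          map_add (LL ℝ γ τ) (S F t).1 (S G t).1
        have h3 : incl ℝ (h.forcing hP (F + G) t).1 =
            incl ℝ (h.forcing hP F t).1 + incl ℝ (h.forcing hP G t).1 := by
          rw [← hJa, map_add]
          exact map_add (incl ℝ) (J F t).1 (J G t).1
        rw [h1, h2, h3]
        exact (((hS F).2 t).add ((hS G).2 t)).congr_deriv (add_add_add_comm _ _ _ _)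
      map_smul' := fun a F => by
        refine h.isSolution_unique hγ hτ hP hν (hS (a • F)).2 fun t => ?_
        have h1 : (fun t => incl ℝ ((a • S F) t).1) = fun t => a • incl ℝ (S F t).1 :=
          funext fun t => map_smul (incl ℝ) a (S F t).1
        have h2 : LL ℝ γ τ ((a • S F) t).1 = a • LL ℝ γ τ (S F t).1 :=
          map_smul (LL ℝ γ τ) a (S F t).1
        have h3 : incl ℝ (h.forcing hP (a • F) t).1 = a • incl ℝ (h.forcing hP F t).1 := by
          rw [← hJa, map_smul]
          exact map_smul (incl ℝ) a (J F t).1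
        change HasDerivAt (fun t => incl ℝ ((a • S F) t).1)
          (LL ℝ γ τ ((a • S F) t).1 + incl ℝ (h.forcing hP (a • F) t).1) t
        rw [h1, h2, h3]
        exact (((hS F).2 t).const_smul a).congr_deriv (smul_add _ _ _) }
  have hK : ‖K₀.mkContinuous C hSb‖ ≤ C := K₀.mkContinuous_norm_le hC hSb
  refine ⟨hC, J, K₀.mkContinuous C hSb, h.isForcing_forcingEquiv hP, hS,
    fun G₂ U hU => h.isSolution_unique hγ hτ hP hν hU.2 (hS G₂).2, hK, ?_⟩
  refine ContinuousLinearMap.opNorm_le_bound _ hC fun G => (hSb (J.symm G)).trans ?_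
  exact mul_le_mul_of_nonneg_left (h.norm_thd_le hP G) hC

/-- A single rate p between q and p₀, and hence a single resolvent kernel, serves all |ν| ≤ q. -/
theorem InDelta0.exists_forall_hasSolutionOperator (h : InDelta0 γ τ k₀) (hγ : 0 < γ) (hτ : 0 < τ)
    (hP : IsCentreProjection γ τ k₀ P) {q : ℝ} (hq0 : 0 ≤ q) (hq : (q : EReal) < p0 γ τ) :
    ∃ C, ∀ ν, |ν| ≤ q → HasSolutionOperator γ τ k₀ P ν C := by
  obtain ⟨p, hp1, hp2⟩ := EReal.lt_iff_exists_real_btwn.1 hq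
  have hqp : q < p := EReal.coe_lt_coe_iff.1 hp1
  have hp0 : 0 ≤ p := hq0.trans hqp.le
  obtain ⟨r, B, hr, hB, hres⟩ := h.exists_resolvent hγ hτ hp0 hp2
  refine ⟨max 0 (solBound |γ * τ ^ 2| k₀ q (1 + B * ∫ x, Real.exp (-(p - q) * |x|))),
    fun ν hν => ?_⟩
  refine h.hasSolutionOperator hγ hτ hP (lt_of_le_of_lt (EReal.coe_le_coe_iff.2 hν) hq)
    (le_max_left _ _) fun G₂ => ?_
  obtain ⟨U, hU, hUb⟩ := h.exists_solution_of_resolvent hP hp0 hr hB hres hν hqp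
    (h.forcing hP G₂) (norm_nonneg G₂) fun t => G₂.1.norm_apply_le t
  exact ⟨U, hU, hUb.trans (mul_le_mul_of_nonneg_right (le_max_right _ _) (norm_nonneg _))⟩

/-- Near each ν one constant is admissible, and admissible constants form convex sets, so a
partition of unity glues them into a continuous function. -/
theorem InDelta0.exists_continuousOn_hasSolutionOperator (h : InDelta0 γ τ k₀) (hγ : 0 < γ)
    (hτ : 0 < τ) (hP : IsCentreProjection γ τ k₀ P) :
    ∃ γt : ℝ → ℝ, ContinuousOn γt {ν : ℝ | ((|ν| : ℝ) : EReal) < p0 γ τ} ∧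
      ∀ ν : ℝ, ((|ν| : ℝ) : EReal) < p0 γ τ → HasSolutionOperator γ τ k₀ P ν (γt ν) := by
  set S : Set ℝ := {ν : ℝ | ((|ν| : ℝ) : EReal) < p0 γ τ} with hS
  obtain ⟨f, hf⟩ := exists_continuous_forall_mem_convex_of_local_const
    (t := fun ν : S => {C : ℝ | HasSolutionOperator γ τ k₀ P ν C})
    (fun ν => (Set.OrdConnected.convex (𝕜 := ℝ) ⟨fun x hx y _ z hz => hx.mono hz.1⟩))
    (fun ν => by
      obtain ⟨q, hq1, hq2⟩ := EReal.lt_iff_exists_real_btwn.1 ν.2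
      have hνq : |(ν : ℝ)| < q := EReal.coe_lt_coe_iff.1 hq1
      obtain ⟨C, hC⟩ := h.exists_forall_hasSolutionOperator hγ hτ hP
        ((abs_nonneg _).trans hνq.le) hq2
      have hev : ∀ᶠ μ : S in 𝓝 ν, |(μ : ℝ)| < q :=
        (continuous_abs.comp continuous_subtype_val).continuousAt.eventually (gt_mem_nhds hνq)
      exact ⟨C, hev.mono fun μ hμ => hC μ hμ.le⟩)
  classical
  -- The value 0 outside the interval is arbitrary; continuity is claimed only on the interval.
  refine ⟨fun ν => if hν : ν ∈ S then f ⟨ν, hν⟩ else 0, ?_, fun ν hν => ?_⟩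
  · rw [continuousOn_iff_continuous_domRestrict]
    convert f.continuous using 1
    funext ν
    exact dif_pos ν.2
  · have h1 : HasSolutionOperator γ τ k₀ P ν (f ⟨ν, hν⟩) := hf ⟨ν, hν⟩
    have h2 : (if hν : ν ∈ S then f ⟨ν, hν⟩ else 0) = f ⟨ν, hν⟩ := dif_pos hν
    exact h1.mono h2.ge

end SolutionOperator

end FKChain

theorem theoremB1 (γ τ k₀ : ℝ) (hγ : 0 < γ) (hτ : 0 < τ) (hΔ : InDelta0 γ τ k₀) :
    0 < p0 γ τ ∧
    (∃! P : HH ℝ →L[ℝ] HH ℝ, IsCentreProjection γ τ k₀ P) ∧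
    ∀ P : HH ℝ →L[ℝ] HH ℝ, IsCentreProjection γ τ k₀ P →
      ∃ γt : ℝ → ℝ,
        ContinuousOn γt {ν : ℝ | ((|ν| : ℝ) : EReal) < p0 γ τ} ∧
        ∀ ν : ℝ, ((|ν| : ℝ) : EReal) < p0 γ τ →
          0 ≤ γt ν ∧
          ∃ (J : Adm γ τ k₀ ν ≃L[ℝ] E0 ν (QhD P)) (K : Adm γ τ k₀ ν →L[ℝ] E0 ν (QhD P)),
            (∀ G₂ : Adm γ τ k₀ ν, IsForcing γ τ k₀ (G₂ : E0 ν (C1 ℝ)) (J G₂)) ∧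
            (∀ G₂ : Adm γ τ k₀ ν, IsSolution γ τ (J G₂) (K G₂)) ∧
            (∀ (G₂ : Adm γ τ k₀ ν) (U : E0 ν (QhD P)),
              IsSolution γ τ (J G₂) U → U = K G₂) ∧
            ‖K‖ ≤ γt ν ∧
            ‖K.comp (J.symm : E0 ν (QhD P) →L[ℝ] Adm γ τ k₀ ν)‖ ≤ γt ν :=
  ⟨hΔ.p0_pos hγ hτ,
    ⟨centreProj γ τ k₀, hΔ.isCentreProjection, fun _ hP => hΔ.eq_centreProj hP⟩,
    fun _ hP => hΔ.exists_continuousOn_hasSolutionOperator hγ hτ hP⟩
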